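/- Let $(M,\omega)$ be a symplectic manifold (without boundary). For a compactly supported smooth function $H\colon[0,1]\times M\to\mathbb R$ let $\phi_H^1$ be the time-one map of the time-dependent Hamiltonian vector field $X_{H_t}$ given by $\omega(\cdot,X_{H_t})=d(H(t,\cdot))$, let $\mathrm{Ham}(M,\omega)$ be the group of all such maps $\phi^1_H$, and for $\phi\in \mathrm{Ham}(M,\omega)$ let $$\|\phi\|=\inf\Big\{\int_0^1\big(\max_M H(t,\cdot)-\min_M H(t,\cdot)\big)\,dt \;\Big|\; \phi_H^1=\phi\Big\}$$ be its Hofer norm. For a closed subset $N\subset M$ let $\mathcal L(N)=\{\phi(N)\mid\phi\in\mathrm{Ham}(M,\omega)\}$, and for $N_0,N_1\in\mathcal L(N)$ let $\delta(N_0,N_1)=\inf\{\|\phi\| \mid \phi\in\mathrm{Ham}(M,\omega),\ \phi(N_0)=N_1\}$. The set $N$ is called weightless if $\delta$ vanishes identically on $\mathcal L(N)$. An embedded submanifold $N$ of $M$ (without boundary) is called nowhere coisotropic if $T_xN^\omega\not\subset T_xN$ for every $x\in N$, where $T_xN^\omega$ is the $\omega$-orthogonal complement of $T_xN$ in $T_xM$.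 Theorem. Let $N$ be an embedded submanifold of $M$. (a) If $N$ is closed as a subset of $M$ (not necessarily compact) and nowhere coisotropic, then $N$ is weightless. (b) If $\dim N<\frac12\dim M$, then $N$ is nowhere coisotropic; hence $N$ is weightless if it is also closed as a subset. (c) If $N$ is a symplectic submanifold of positive codimension, then $N$ is nowhere coisotropic; hence $N$ is weightless if it is also closed as a subset. -/

import Mathlib

open scoped Manifold ContDiff

/-- A symplectic form on a smooth manifold `M` without boundary modelled on the normed space `E`:
a smooth, closed, pointwise nondegenerate differential 2-form. Smoothness and closedness are
expressed in every chart of the atlas, for the pullback of the form by the inverse of the chart. -/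
structure SymplecticForm (E : Type*) [NormedAddCommGroup E] [NormedSpace ℝ E]
    (M : Type*) [TopologicalSpace M] [ChartedSpace E M] where
  /-- the value of the 2-form at each point -/
  form : ∀ x : M, TangentSpace 𝓘(ℝ, E) x [⋀^Fin 2]→L[ℝ] ℝ
  nondegenerate : ∀ (x : M) (v : TangentSpace 𝓘(ℝ, E) x), (∀ w, form x ![v, w] = 0) → v = 0
  smooth : ∀ e ∈ atlas E M, ContDiffOn ℝ ∞
    (fun y : E => (((form (e.symm y)).compContinuousLinearMap
      (mfderiv 𝓘(ℝ, E) 𝓘(ℝ, E) e.symm y)) : E [⋀^Fin 2]→L[ℝ] ℝ)) e.target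
  closed : ∀ e ∈ atlas E M, ∀ y ∈ e.target, extDeriv
    (fun y : E => (((form (e.symm y)).compContinuousLinearMap
      (mfderiv 𝓘(ℝ, E) 𝓘(ℝ, E) e.symm y)) : E [⋀^Fin 2]→L[ℝ] ℝ)) y = 0

namespace SymplecticForm

variable {E : Type*} [NormedAddCommGroup E] [NormedSpace ℝ E]
  {M : Type*} [TopologicalSpace M] [ChartedSpace E M]

/-- The bilinear form `(v, w) ↦ Ω(v, w)` on `T_x M`. -/
noncomputable def bilin (Ω : SymplecticForm E M) (x : M) :
    TangentSpace 𝓘(ℝ, E) x →ₗ[ℝ] TangentSpace 𝓘(ℝ, E) x →ₗ[ℝ] ℝ :=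
  have h0 (a b w : TangentSpace 𝓘(ℝ, E) x) : Function.update ![a, w] 0 b = ![b, w] := by
    ext i; fin_cases i <;> rfl
  have h1 (v a b : TangentSpace 𝓘(ℝ, E) x) : Function.update ![v, a] 1 b = ![v, b] := by
    ext i; fin_cases i <;> rfl
  LinearMap.mk₂ ℝ (fun v w => Ω.form x ![v, w])
    (fun a b w => by
      simpa only [h0] using (Ω.form x).map_update_add ![a, w] 0 a b)
    (fun c a w => by
      simpa only [h0] using (Ω.form x).map_update_smul ![a, w] 0 c a)
    (fun v a b => by
      simpa only [h1] using (Ω.form x).map_update_add ![v, a] 1 a b)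
    (fun c v a => by
      simpa only [h1] using (Ω.form x).map_update_smul ![v, a] 1 c a)

theorem bilin_apply (Ω : SymplecticForm E M) (x : M) (v w : TangentSpace 𝓘(ℝ, E) x) :
    Ω.bilin x v w = Ω.form x ![v, w] := rfl

theorem bilin_swap (Ω : SymplecticForm E M) (x : M) (v w : TangentSpace 𝓘(ℝ, E) x) :
    Ω.bilin x v w = - Ω.bilin x w v := by
  have h := (Ω.form x).toAlternatingMap.map_swap ![w, v] (i := 0) (j := 1) (by decide)
  have hs : ![w, v] ∘ (Equiv.swap (0 : Fin 2) 1) = ![v, w] := by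
    ext i
    fin_cases i <;> simp
  rw [hs] at h
  exact h

/-- The `Ω`-orthogonal complement `W^Ω` of a subspace `W` of `T_x M`. -/
def orthogonal (Ω : SymplecticForm E M) (x : M) (W : Submodule ℝ (TangentSpace 𝓘(ℝ, E) x)) :
    Submodule ℝ (TangentSpace 𝓘(ℝ, E) x) where
  carrier := {v | ∀ w ∈ W, Ω.bilin x v w = 0}
  add_mem' := fun ha hb w hw => by simp [ha w hw, hb w hw]
  zero_mem' := fun w _ => by simp
  smul_mem' := fun c a ha w hw => by simp [ha w hw]

/-- By nondegeneracy, a function `h` has exactly one Hamiltonian vector at each point. -/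
theorem existsUnique_hamiltonianVector [FiniteDimensional ℝ E] (Ω : SymplecticForm E M)
    (h : M → ℝ) (x : M) : ∃! X : TangentSpace 𝓘(ℝ, E) x, ∀ v : TangentSpace 𝓘(ℝ, E) x,
      Ω.bilin x v X = (mfderiv 𝓘(ℝ, E) 𝓘(ℝ, ℝ) h x v : ℝ) := by
  have : FiniteDimensional ℝ (TangentSpace 𝓘(ℝ, E) x) := inferInstanceAs (FiniteDimensional ℝ E)
  have hinj : Function.Injective (Ω.bilin x).flip := by
    rw [injective_iff_map_eq_zero]
    intro a ha
    refine Ω.nondegenerate x a fun w => ?_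
    have h1 : Ω.bilin x w a = 0 := LinearMap.congr_fun ha w
    rw [← bilin_apply, bilin_swap, h1, neg_zero]
  have hsurj : Function.Surjective (Ω.bilin x).flip :=
    (LinearMap.injective_iff_surjective_of_finrank_eq_finrank
      (Subspace.dual_finrank_eq (K := ℝ) (V := TangentSpace 𝓘(ℝ, E) x)).symm).1 hinj
  obtain ⟨X, hX⟩ := hsurj (mfderiv 𝓘(ℝ, E) 𝓘(ℝ, ℝ) h x).toLinearMap
  refine ⟨X, fun v => LinearMap.congr_fun hX v, fun Y hY => hinj ?_⟩
  rw [hX]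
  ext v
  exact hY v

/-- The Hamiltonian vector field `X_h` of a function `h`, characterized by `Ω(·, X_h) = dh`. -/
noncomputable def hamiltonianVectorField [FiniteDimensional ℝ E] (Ω : SymplecticForm E M)
    (h : M → ℝ) (x : M) : TangentSpace 𝓘(ℝ, E) x :=
  (Ω.existsUnique_hamiltonianVector h x).choose

theorem bilin_hamiltonianVectorField [FiniteDimensional ℝ E] (Ω : SymplecticForm E M)
    (h : M → ℝ) (x : M) (v : TangentSpace 𝓘(ℝ, E) x) :
    Ω.bilin x v (Ω.hamiltonianVectorField h x) =
      (mfderiv 𝓘(ℝ, E) 𝓘(ℝ, ℝ) h x v : ℝ) :=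
  (Ω.existsUnique_hamiltonianVector h x).choose_spec.1 v

end SymplecticForm

section Hofer

variable {E : Type*} [NormedAddCommGroup E] [NormedSpace ℝ E]
  {M : Type*} [TopologicalSpace M] [ChartedSpace E M]

/-- `H` is a smooth function on `[0,1] × M` with compact support. Its values at times outside
`[0,1]` are irrelevant. -/
structure IsCompactlySupportedHamiltonian (E : Type*) [NormedAddCommGroup E] [NormedSpace ℝ E]
    {M : Type*} [TopologicalSpace M] [ChartedSpace E M] (H : ℝ → M → ℝ) : Prop where
  smooth : ContMDiffOn (𝓘(ℝ, ℝ).prod 𝓘(ℝ, E)) 𝓘(ℝ, ℝ) ∞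
    (fun p : ℝ × M => H p.1 p.2) (Set.Icc (0 : ℝ) 1 ×ˢ Set.univ)
  compactSupport : ∃ K : Set M, IsCompact K ∧ ∀ t ∈ Set.Icc (0 : ℝ) 1, ∀ x ∉ K, H t x = 0

/-- `φ` is the time-one map of the time-dependent Hamiltonian vector field `X_{H_t}`,
`0 ≤ t ≤ 1`: each `φ x` is the endpoint at time one of an integral curve starting at `x`. -/
def IsTimeOneMap [FiniteDimensional ℝ E] (Ω : SymplecticForm E M) (H : ℝ → M → ℝ)
    (φ : M → M) : Prop :=
  ∀ x : M, ∃ γ : ℝ → M, γ 0 = x ∧ γ 1 = φ x ∧ ∀ t ∈ Set.Icc (0 : ℝ) 1,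
    HasMFDerivWithinAt 𝓘(ℝ, ℝ) 𝓘(ℝ, E) γ (Set.Icc (0 : ℝ) 1) t
      ((1 : ℝ →L[ℝ] ℝ).smulRight (Ω.hamiltonianVectorField (H t) (γ t)))

/-- `Ham(M, Ω)`, as a set of self-maps of `M`: the time-one maps of the time-dependent
Hamiltonian vector fields of compactly supported smooth functions on `[0,1] × M`. -/
def Ham [FiniteDimensional ℝ E] (Ω : SymplecticForm E M) : Set (M → M) :=
  {φ | ∃ H : ℝ → M → ℝ, IsCompactlySupportedHamiltonian E H ∧ IsTimeOneMap Ω H φ}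

/-- `∫₀¹ (max_M H(t,·) - min_M H(t,·)) dt`. For a compactly supported smooth `H` the maximum and
the minimum exist (if `M` is nonempty) and depend continuously on `t`. -/
noncomputable def hamiltonianEnergy (H : ℝ → M → ℝ) : ℝ :=
  ∫ t in (0 : ℝ)..1, ((⨆ x, H t x) - (⨅ x, H t x))

/-- The Hofer norm of `φ`: the infimum of the energies of the Hamiltonians that generate `φ`.
It takes the value `∞` exactly when `φ` is not in `Ham(M, Ω)`. -/
noncomputable def hoferNorm [FiniteDimensional ℝ E] (Ω : SymplecticForm E M) (φ : M → M) : ENNReal :=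
  ⨅ (H : ℝ → M → ℝ) (_ : IsCompactlySupportedHamiltonian E H) (_ : IsTimeOneMap Ω H φ),
    ENNReal.ofReal (hamiltonianEnergy H)

/-- The orbit `𝓛(N)` of a subset `N` of `M` under `Ham(M, Ω)`. -/
def hamOrbit [FiniteDimensional ℝ E] (Ω : SymplecticForm E M) (N : Set M) : Set (Set M) :=
  {N' | ∃ φ ∈ Ham Ω, φ '' N = N'}

/-- The Chekanov–Hofer pseudometric `δ(N₀, N₁) = inf {‖φ‖ : φ ∈ Ham(M, Ω), φ(N₀) = N₁}`. -/
noncomputable def chekanovHofer [FiniteDimensional ℝ E] (Ω : SymplecticForm E M)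
    (N₀ N₁ : Set M) : ENNReal :=
  ⨅ (φ : M → M) (_ : φ ∈ Ham Ω) (_ : φ '' N₀ = N₁), hoferNorm Ω φ

/-- `N` is weightless: the Chekanov–Hofer pseudometric vanishes identically on `𝓛(N)`. -/
def IsWeightless [FiniteDimensional ℝ E] (Ω : SymplecticForm E M) (N : Set M) : Prop :=
  ∀ N₀ ∈ hamOrbit Ω N, ∀ N₁ ∈ hamOrbit Ω N, chekanovHofer Ω N₀ N₁ = 0

end Hofer

section Submanifold

variable {E : Type*} [NormedAddCommGroup E] [NormedSpace ℝ E]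
  {M : Type*} [TopologicalSpace M] [ChartedSpace E M]
  {X : Type*} [TopologicalSpace X]

/-- The tangent space `T_{f(p)} N ⊆ T_{f(p)} M` of the image `N = f(X)` of an embedding `f`. -/
noncomputable def imageTangentSpace (E F : Type*) [NormedAddCommGroup E] [NormedSpace ℝ E]
    [NormedAddCommGroup F] [NormedSpace ℝ F] {M X : Type*} [TopologicalSpace M] [ChartedSpace E M]
    [TopologicalSpace X] [ChartedSpace F X] (f : X → M) (p : X) :
    Submodule ℝ (TangentSpace 𝓘(ℝ, E) (f p)) :=
  LinearMap.range (mfderiv 𝓘(ℝ, F) 𝓘(ℝ, E) f p).toLinearMap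

/-- The submanifold `N = f(X)` is nowhere coisotropic: `T_x N^Ω ⊄ T_x N` for every `x ∈ N`. -/
def IsNowhereCoisotropic (F : Type*) [NormedAddCommGroup F] [NormedSpace ℝ F] [ChartedSpace F X]
    (Ω : SymplecticForm E M) (f : X → M) : Prop :=
  ∀ p : X, ¬ Ω.orthogonal (f p) (imageTangentSpace E F f p) ≤ imageTangentSpace E F f p

/-- The submanifold `N = f(X)` is symplectic: `Ω` restricts to a nondegenerate form on each
`T_x N`. -/
def IsSymplecticSubmanifold (F : Type*) [NormedAddCommGroup F] [NormedSpace ℝ F]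
    [ChartedSpace F X] (Ω : SymplecticForm E M) (f : X → M) : Prop :=
  ∀ p : X, ∀ v ∈ imageTangentSpace E F f p,
    (∀ w ∈ imageTangentSpace E F f p, Ω.bilin (f p) v w = 0) → v = 0

end Submanifold

/-!
A closed, nowhere coisotropic submanifold `N` is weightless because it can be moved, at arbitrarily
small Hofer cost, off each given point, and because this already forces every Hamiltonian
diffeomorphism to move `N` at arbitrarily small cost. Two subsets `A` and `B` of `M` are called
*Hofer close* (`SymplecticForm.HoferClose`) if time-one maps of arbitrarily small Hamiltonians take
`A` to `B`. This is an equivalence relation, invariant under symplectic diffeomorphisms, and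
`chekanovHofer` vanishes on Hofer close subsets. The claim is that `N` is Hofer close to `φ(N)` for
all `φ` in `Ham(M, Ω)`.

*Displacement* (`SymplecticForm.exists_hoferClose_notMem`). Let `x ∈ N`, and let `v` be a vector in
`T_x N^Ω` but not in `T_x N`. The covector `Ω(·, v)` vanishes on `T_x N`, so it is the differential
at `x` of a compactly supported function `G` that vanishes on `N`. The flow of `G` moves `x` with
velocity `v`, hence off `N`. It moves `N` at no cost: `G` is conserved along its flow, so that the
orbits of the points of `N` are also orbits of `δ sin (G / δ)`, which is as small as desired. So
some closed set `A` that does not contain `x` is Hofer close to `N`. For `x ∉ N` one takes `A = N`.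

*Fragmentation* (`SymplecticForm.eventually_hoferClose_evolution_image`). If `g` and `g'` are
symplectic diffeomorphisms that agree on a set `A` Hofer close to `N`, then `g N`, `g A = g' A` and
`g' N` are Hofer close to each other. A partition of unity subordinate to the complements of
finitely many such sets `A` cuts a Hamiltonian into pieces; for short times, adding a piece to the
Hamiltonian changes its evolution only off the corresponding `A`. Hence the evolution from time `s`
to time `t` moves `N` to a Hofer close set if `t` is near `s`, and connectedness of the time
interval extends this to all times.

The analytic input is the existence and smoothness of evolutions of compactly supported
time-dependent vector fields (`exists_evolution`), based on the implicit function theorem in a space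
of curves, and the invariance of `Ω` under Hamiltonian evolutions
(`SymplecticForm.isSymplectic_evolution`), which rests on the closedness of `Ω`. To be able to
concatenate, Hamiltonians are taken smooth on `ℝ × M` and zero for times outside `[0, 1]`
(`IsFlatHamiltonian`); slowing down the time near the end points reduces to this case.
-/

/-! ### Smooth dependence of solutions of ordinary differential equations on initial values -/

section LocalFlow

open Set Filter Topology

universe u

/-- Pointwise application `(A, h) ↦ (s ↦ A s (h s))` of a continuous family of operators to a
continuous family of vectors, as a continuous linear map in the family of operators. -/
noncomputable def ContinuousMap.applyCLM (K : Type*) [TopologicalSpace K] [CompactSpace K]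
    (E F : Type*) [NormedAddCommGroup E] [NormedSpace ℝ E] [NormedAddCommGroup F]
    [NormedSpace ℝ F] : C(K, E →L[ℝ] F) →L[ℝ] C(K, E) →L[ℝ] C(K, F) :=
  LinearMap.mkContinuous₂
    (LinearMap.mk₂ ℝ (fun (A : C(K, E →L[ℝ] F)) (h : C(K, E)) =>
        (⟨fun s => A s (h s), A.continuous.clm_apply h.continuous⟩ : C(K, F)))
      (fun _ _ _ => by ext; simp) (fun _ _ _ => by ext; simp)
      (fun _ _ _ => by ext; simp) (fun _ _ _ => by ext; simp)) 1
    (fun A h => by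
      rw [one_mul, ContinuousMap.norm_le _ (by positivity)]
      intro s
      exact ((A s).le_opNorm (h s)).trans (mul_le_mul (A.norm_coe_le_norm s)
        (h.norm_coe_le_norm s) (norm_nonneg _) (by positivity)))

/-- The composition operator `γ ↦ v ∘ γ` is differentiable when `v` is `C¹`. -/
theorem ContinuousMap.hasFDerivAt_comp {K : Type*} [TopologicalSpace K] [CompactSpace K]
    {E F : Type*} [NormedAddCommGroup E] [NormedSpace ℝ E] [NormedAddCommGroup F]
    [NormedSpace ℝ F] (v : C(E, F)) (v' : C(E, E →L[ℝ] F))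
    (hv : ∀ x, HasFDerivAt v (v' x) x) (γ : C(K, E)) :
    HasFDerivAt (fun γ : C(K, E) => v.comp γ) (ContinuousMap.applyCLM K E F (v'.comp γ)) γ := by
  rw [hasFDerivAt_iff_isLittleO_nhds_zero, Asymptotics.isLittleO_iff]
  intro c hc
  -- `γ ↦ v' ∘ γ` is continuous for the sup norm, hence `v'` varies little along short segments
  have hcont := (ContinuousMap.continuous_postcomp (X := K) v').continuousAt (x := γ)
  obtain ⟨δ, hδ, hclose⟩ :=
    (Metric.continuousAt_iff (α := C(K, E)) (β := C(K, E →L[ℝ] F))).1 hcont c hc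
  filter_upwards [Metric.ball_mem_nhds (0 : C(K, E)) hδ] with h hh
  rw [mem_ball_zero_iff] at hh
  rw [ContinuousMap.norm_le _ (by positivity)]
  intro s
  have key : ‖v (γ s + h s) - v (γ s) - (v' (γ s)) (γ s + h s - γ s)‖
      ≤ c * ‖γ s + h s - γ s‖ := by
    refine Convex.norm_image_sub_le_of_norm_hasFDerivWithin_le' (s := segment ℝ (γ s) (γ s + h s))
      (f' := v') (fun x _ => (hv x).hasFDerivWithinAt) ?_ (convex_segment _ _)
      (left_mem_segment _ _ _) (right_mem_segment _ _ _)
    intro x hx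
    rw [segment_eq_image'] at hx
    obtain ⟨τ, hτ, rfl⟩ := hx
    have h1 : dist (γ + τ • h) γ < δ := by
      rw [dist_eq_norm, add_sub_cancel_left, norm_smul, Real.norm_of_nonneg hτ.1]
      exact lt_of_le_of_lt (mul_le_of_le_one_left (norm_nonneg _) hτ.2) hh
    have h2 := (ContinuousMap.dist_apply_le_dist (f := v'.comp (γ + τ • h)) (g := v'.comp γ)
      s).trans (hclose h1).le
    simpa [dist_eq_norm] using h2
  rw [add_sub_cancel_left] at key
  refine le_trans ?_ (key.trans (mul_le_mul_of_nonneg_left (h.norm_coe_le_norm s) hc.le))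
  exact le_rfl

/-- The composition operator `γ ↦ v ∘ γ` on continuous functions on a compact space is `Cⁿ` when
`v` is `Cⁿ`. -/
theorem ContinuousMap.contDiff_comp_nat {K : Type*} [TopologicalSpace K] [CompactSpace K]
    {E : Type u} [NormedAddCommGroup E] [NormedSpace ℝ E] (n : ℕ) :
    ∀ {F : Type u} [NormedAddCommGroup F] [NormedSpace ℝ F] (v : C(E, F)), ContDiff ℝ n v →
      ContDiff ℝ n (fun γ : C(K, E) => v.comp γ) := by
  induction n with
  | zero =>
    intro F _ _ v _
    exact contDiff_zero.2 (ContinuousMap.continuous_postcomp v)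
  | succ n ih =>
    intro F _ _ v hv
    have hv' : ContDiff ℝ ((n : ℕ∞ω) + 1) v := by exact_mod_cast hv
    obtain ⟨v', hv'1, hv'2⟩ := contDiff_succ_iff_hasFDerivAt.1 hv'
    have h := ih (F := E →L[ℝ] F) ⟨v', hv'1.continuous⟩ hv'1
    push_cast
    refine contDiff_succ_iff_hasFDerivAt.2
      ⟨_, (ContinuousMap.applyCLM K E F).contDiff.comp h, fun γ => ?_⟩
    exact ContinuousMap.hasFDerivAt_comp v ⟨v', hv'1.continuous⟩ hv'2 γ

variable {E : Type u} [NormedAddCommGroup E] [NormedSpace ℝ E]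

/-- The primitive `s ↦ ∫₀ˢ γ` of a continuous curve on `[-1, 1]`, as a bounded operator. -/
noncomputable def primitiveCLM (E : Type u) [NormedAddCommGroup E] [NormedSpace ℝ E] :
    C(Icc (-1 : ℝ) 1, E) →L[ℝ] C(Icc (-1 : ℝ) 1, E) :=
  have hc (γ : C(Icc (-1 : ℝ) 1, E)) :
      Continuous (IccExtend (by norm_num : (-1 : ℝ) ≤ 1) γ) := γ.continuous.Icc_extend'
  LinearMap.mkContinuous
    { toFun := fun γ => ⟨fun s => ∫ σ in (0 : ℝ)..s, IccExtend (by norm_num : (-1 : ℝ) ≤ 1) γ σ,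
        (intervalIntegral.continuous_primitive (fun a b => (hc γ).intervalIntegrable a b) 0).comp
          continuous_subtype_val⟩
      map_add' := fun γ γ' => by
        ext s
        exact intervalIntegral.integral_add ((hc γ).intervalIntegrable _ _)
          ((hc γ').intervalIntegrable _ _)
      map_smul' := fun c γ => by
        ext s
        exact intervalIntegral.integral_smul c _ } 1
    (fun γ => by
      rw [one_mul, ContinuousMap.norm_le _ (norm_nonneg _)]
      intro s
      refine (intervalIntegral.norm_integral_le_of_norm_le_const
        (fun σ _ => γ.norm_coe_le_norm _)).trans ?_
      have : |(s : ℝ) - 0| ≤ 1 := by rw [sub_zero]; exact abs_le.2 s.2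
      exact mul_le_of_le_one_right (norm_nonneg _) this)

theorem primitiveCLM_apply (γ : C(Icc (-1 : ℝ) 1, E)) (s : Icc (-1 : ℝ) 1) :
    primitiveCLM E γ s
      = ∫ σ in (0 : ℝ)..s, IccExtend (by norm_num : (-1 : ℝ) ≤ 1) γ σ := rfl

/-- The defect of a curve `γ` on `[-1, 1]` as a solution of `γ' = t v(γ)`, `γ(0) = x`. -/
noncomputable def flowDefect (v : C(E, E)) (p : (ℝ × E) × C(Icc (-1 : ℝ) 1, E)) :
    C(Icc (-1 : ℝ) 1, E) :=
  p.2 - ContinuousLinearMap.const ℝ (Icc (-1 : ℝ) 1) p.1.2 - p.1.1 • primitiveCLM E (v.comp p.2)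

theorem flowDefect_eq_zero_iff (v : C(E, E)) (t : ℝ) (x : E) (γ : C(Icc (-1 : ℝ) 1, E)) :
    flowDefect v ((t, x), γ) = 0 ↔ ∀ s : Icc (-1 : ℝ) 1,
      γ s = x + t • ∫ σ in (0 : ℝ)..s, v (IccExtend (by norm_num : (-1 : ℝ) ≤ 1) γ σ) := by
  rw [ContinuousMap.ext_iff]
  refine forall_congr' fun s => ?_
  have : flowDefect v ((t, x), γ) s = γ s - (x + t •
      ∫ σ in (0 : ℝ)..s, v (IccExtend (by norm_num : (-1 : ℝ) ≤ 1) γ σ)) := by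
    simp only [flowDefect, ContinuousMap.sub_apply, ContinuousMap.smul_apply, primitiveCLM_apply,
      ContinuousLinearMap.const_apply_apply]
    rw [sub_sub]
    rfl
  rw [this, ContinuousMap.zero_apply, sub_eq_zero]

theorem contDiff_flowDefect (v : C(E, E)) (hv : ContDiff ℝ ∞ v) :
    ContDiff ℝ ∞ (flowDefect v) := by
  have h : ContDiff ℝ ∞ (fun γ : C(Icc (-1 : ℝ) 1, E) => v.comp γ) :=
    contDiff_infty.2 fun n => ContinuousMap.contDiff_comp_nat n v (contDiff_infty.1 hv n)
  exact (contDiff_snd.sub ((ContinuousLinearMap.contDiff _).comp contDiff_fst.snd)).sub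
    (contDiff_fst.fst.smul ((primitiveCLM E).contDiff.comp (h.comp contDiff_snd)))

/-- Reparametrizing a solution on `[-1, 1]` by a factor `r ∈ [-1, 1]` gives a solution for the
correspondingly rescaled time. -/
theorem flowDefect_rescale (v : C(E, E)) {t : ℝ} {x : E} {γ : C(Icc (-1 : ℝ) 1, E)}
    (h : flowDefect v ((t, x), γ) = 0) (r : Icc (-1 : ℝ) 1) (m : C(Icc (-1 : ℝ) 1, Icc (-1 : ℝ) 1))
    (hm : ∀ s, (m s : ℝ) = r * s) : flowDefect v ((r * t, x), γ.comp m) = 0 := by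
  rw [flowDefect_eq_zero_iff] at h ⊢
  intro s
  rw [ContinuousMap.comp_apply, h (m s), hm, mul_comm (r : ℝ) t, mul_smul]
  congr 2
  rw [← mul_zero (r : ℝ), ← intervalIntegral.smul_integral_comp_mul_left
    (fun σ => v (IccExtend (by norm_num : (-1 : ℝ) ≤ 1) γ σ)), mul_zero]
  congr 1
  refine intervalIntegral.integral_congr fun σ hσ => ?_
  have hσ' : σ ∈ Icc (-1 : ℝ) 1 := by
    rcases le_total 0 (s : ℝ) with h0 | h0
    · rw [uIcc_of_le h0] at hσ
      exact ⟨by linarith [hσ.1], hσ.2.trans s.2.2⟩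
    · rw [uIcc_of_ge h0] at hσ
      exact ⟨s.2.1.trans hσ.1, by linarith [hσ.2]⟩
  have h1 : (r : ℝ) * σ ∈ Icc (-1 : ℝ) 1 := by rw [← hm ⟨σ, hσ'⟩]; exact (m _).2
  have h2 : m ⟨σ, hσ'⟩ = ⟨r * σ, h1⟩ := Subtype.ext (hm ⟨σ, hσ'⟩)
  rw [IccExtend_of_mem _ _ h1, IccExtend_of_mem _ _ hσ', ContinuousMap.comp_apply, h2]

/-- Local flows of smooth vector fields on Banach spaces are jointly smooth in time and initial
value. The curves solve `flowDefect v = 0`, and at time scale `t = 0` the derivative of the defect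
in the curve is the identity, so the implicit function theorem applies. -/
theorem exists_local_flow [CompleteSpace E] {v : E → E} (hv : ContDiff ℝ ∞ v) (x₀ : E) :
    ∃ ε > 0, ∃ θ : ℝ × E → E,
      (∀ p ∈ Metric.ball (0 : ℝ) ε ×ˢ Metric.ball x₀ ε, ContDiffAt ℝ ∞ θ p) ∧
      ∀ x ∈ Metric.ball x₀ ε, θ (0, x) = x ∧ ∀ t ∈ Metric.ball (0 : ℝ) ε,
        HasDerivAt (fun t => θ (t, x)) (v (θ (t, x))) t := by
  set f := flowDefect (E := E) ⟨v, hv.continuous⟩ with hfdef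
  have hf : ContDiff ℝ ∞ f := contDiff_flowDefect _ hv
  set γ₀ : C(Icc (-1 : ℝ) 1, E) := ContinuousLinearMap.const ℝ _ x₀ with hγ₀
  set u : (ℝ × E) × C(Icc (-1 : ℝ) 1, E) := ((0, x₀), γ₀) with hu
  have hfu : f u = 0 := by simp [hfdef, flowDefect, hu, hγ₀]
  set D : (ℝ × E) × C(Icc (-1 : ℝ) 1, E) → C(Icc (-1 : ℝ) 1, E) →L[ℝ] C(Icc (-1 : ℝ) 1, E) :=
    fun w => fderiv ℝ f w ∘L .inr ℝ (ℝ × E) C(Icc (-1 : ℝ) 1, E) with hD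
  have hDcont : Continuous D := (hf.continuous_fderiv (by simp)).clm_comp continuous_const
  have hDu : D u = ContinuousLinearMap.id ℝ _ := by
    have h1 : HasFDerivAt (fun γ => f (((0 : ℝ), x₀), γ)) (D u) γ₀ :=
      ((hf.differentiable (by simp)) u).hasFDerivAt.comp γ₀ (hasFDerivAt_prodMk_right _ _)
    have h2 : HasFDerivAt (fun γ => f (((0 : ℝ), x₀), γ)) (ContinuousLinearMap.id ℝ _) γ₀ := by
      have : (fun γ => f (((0 : ℝ), x₀), γ)) = fun γ => γ - γ₀ := by
        funext γ; simp [hfdef, flowDefect, hγ₀]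
      rw [this]
      exact (hasFDerivAt_id _).sub_const _
    exact h1.unique h2
  have hinv : ∀ᶠ w in 𝓝 u, (D w).IsInvertible := by
    have := (ContinuousLinearEquiv.isOpen (𝕜 := ℝ) (E := C(Icc (-1 : ℝ) 1, E))
      (F := C(Icc (-1 : ℝ) 1, E))).preimage hDcont
    exact this.mem_nhds ⟨ContinuousLinearEquiv.refl ℝ _, hDu.symm⟩
  set ψ := hf.contDiffAt.implicitFunction (by simp) hinv.self_of_nhds with hψ
  have hψ0 : ψ (0, x₀) = γ₀ := ContDiffAt.implicitFunction_apply_self ..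
  have hψsm : ContDiffAt ℝ ∞ ψ (0, x₀) := ContDiffAt.contDiffAt_implicitFunction ..
  have hsol : ∀ᶠ p in 𝓝 ((0 : ℝ), x₀), f (p, ψ p) = 0 :=
    hfu ▸ ContDiffAt.eventually_apply_implicitFunction hf.contDiffAt (by simp) hinv.self_of_nhds
  have huniq : ∀ᶠ w in 𝓝 u, f w = 0 ↔ ψ w.1 = w.2 :=
    hfu ▸ ContDiffAt.eventually_apply_eq_iff_implicitFunction hf.contDiffAt (by simp)
      hinv.self_of_nhds
  have hψc : ∀ᶠ p in 𝓝 ((0 : ℝ), x₀), ContinuousAt ψ p :=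
    ((hψsm.of_le (m := 1) (by simp)).eventually (by simp)).mono fun p hp => hp.continuousAt
  have htend : Tendsto (fun p => (p, ψ p)) (𝓝 ((0 : ℝ), x₀)) (𝓝 u) := by
    have := continuousAt_id.prodMk hψsm.continuousAt
    rwa [ContinuousAt, hψ0] at this
  -- the implicit function is smooth at nearby points, by uniqueness of implicit functions there
  have hsmooth : ∀ᶠ p in 𝓝 ((0 : ℝ), x₀), ContDiffAt ℝ ∞ ψ p := by
    filter_upwards [hψc, hsol.eventually_nhds, htend.eventually hinv] with p hpc hps hpi
    have h1 := ContDiffAt.eventually_apply_eq_iff_implicitFunction (hf.contDiffAt (x := (p, ψ p)))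
      (by simp) hpi
    have h2 := ContDiffAt.contDiffAt_implicitFunction (hf.contDiffAt (x := (p, ψ p)))
      (by simp) hpi
    refine h2.congr_of_eventuallyEq ?_
    filter_upwards [(continuousAt_id.prodMk hpc).eventually h1, hps] with q hq hqs
    exact ((hq.1 (hqs.trans hps.self_of_nhds.symm))).symm
  obtain ⟨η, hη, hball⟩ := Metric.eventually_nhds_iff_ball.1 huniq
  have hnear : ∀ᶠ p in 𝓝 ((0 : ℝ), x₀), (p, ψ p) ∈ Metric.ball u η :=
    htend.eventually (Metric.ball_mem_nhds u hη)
  obtain ⟨ε, hε, hgood⟩ := Metric.eventually_nhds_iff_ball.1 (hsmooth.and (hsol.and hnear))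
  set one : Icc (-1 : ℝ) 1 := ⟨1, by norm_num⟩ with hone
  have hmem {t : ℝ} {x : E} (ht : t ∈ Metric.ball (0 : ℝ) ε) (hx : x ∈ Metric.ball x₀ ε) :
      (t, x) ∈ Metric.ball ((0 : ℝ), x₀) ε := by
    rw [← ball_prod_same]; exact ⟨ht, hx⟩
  -- the solution with time scale `T` restricts to those with smaller time scales
  have hscale {T : ℝ} {x : E} (hT : T ∈ Metric.ball (0 : ℝ) ε) (hx : x ∈ Metric.ball x₀ ε)
      (r : Icc (-1 : ℝ) 1) : ψ (r * T, x) one = ψ (T, x) r := by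
    have hrabs : |(r : ℝ)| ≤ 1 := abs_le.2 r.2
    let m : C(Icc (-1 : ℝ) 1, Icc (-1 : ℝ) 1) :=
      ⟨fun s => ⟨r * s, abs_le.1 (by
        rw [abs_mul]; exact mul_le_one₀ hrabs (abs_nonneg _) (abs_le.2 s.2))⟩, by fun_prop⟩
    have h1 := flowDefect_rescale _ (hgood _ (hmem hT hx)).2.1 r m fun s => rfl
    have hn := (hgood _ (hmem hT hx)).2.2
    rw [Metric.mem_ball, Prod.dist_eq, max_lt_iff] at hn
    obtain ⟨hn1, hn2⟩ := hn
    have h2 : (((r : ℝ) * T, x), (ψ (T, x)).comp m) ∈ Metric.ball u η := by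
      rw [Metric.mem_ball, Prod.dist_eq, max_lt_iff]
      constructor
      · refine lt_of_le_of_lt ?_ hn1
        simp only [hu, Prod.dist_eq, Real.dist_eq, sub_zero, abs_mul]
        exact max_le_max (mul_le_of_le_one_left (abs_nonneg _) hrabs) le_rfl
      · refine lt_of_le_of_lt ?_ hn2
        rw [ContinuousMap.dist_le dist_nonneg]
        intro s
        exact ContinuousMap.dist_apply_le_dist (f := ψ (T, x)) (g := γ₀) (m s)
    have h3 : ψ (r * T, x) = (ψ (T, x)).comp m := (hball _ h2).1 h1
    rw [h3, ContinuousMap.comp_apply]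
    congr 1
    exact Subtype.ext (mul_one _)
  refine ⟨ε, hε, fun p => ψ p one, fun p hp => ?_, fun x hx => ⟨?_, fun t ht => ?_⟩⟩
  · exact (ContinuousMap.evalCLM (M := E) ℝ one).contDiff.contDiffAt.comp p
      (hgood _ (hmem hp.1 hp.2)).1
  · have h0 : (0 : ℝ) ∈ Metric.ball (0 : ℝ) ε := Metric.mem_ball_self hε
    have h1 := hscale h0 hx ⟨0, by norm_num⟩
    have h2 := (flowDefect_eq_zero_iff _ _ _ _).1 (hgood _ (hmem h0 hx)).2.1 ⟨0, by norm_num⟩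
    simp only [zero_mul, intervalIntegral.integral_same, smul_zero, add_zero] at h1 h2
    exact h1.trans h2
  · rw [Metric.mem_ball, Real.dist_eq, sub_zero] at ht
    obtain ⟨T, htT, hTε⟩ := exists_between ht
    have hT0 : 0 < T := (abs_nonneg t).trans_lt htT
    have hT : T ∈ Metric.ball (0 : ℝ) ε := by
      rwa [Metric.mem_ball, Real.dist_eq, sub_zero, abs_of_pos hT0]
    have hsolT := (flowDefect_eq_zero_iff _ _ _ _).1 (hgood _ (hmem hT hx)).2.1
    set g : ℝ → E := fun σ => v (IccExtend (by norm_num : (-1 : ℝ) ≤ 1) (ψ (T, x)) σ) with hg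
    have hgc : Continuous g := hv.continuous.comp (ψ (T, x)).continuous.Icc_extend'
    have hin {t' : ℝ} (ht' : |t'| < T) : t' / T ∈ Icc (-1 : ℝ) 1 := by
      rw [mem_Icc, ← abs_le, abs_div, abs_of_pos hT0]
      exact (div_le_one hT0).2 ht'.le
    have hform {t' : ℝ} (ht' : |t'| < T) : ψ (t', x) one = ψ (T, x) ⟨t' / T, hin ht'⟩ := by
      rw [← hscale hT hx, div_mul_cancel₀ _ hT0.ne']
    have hev : (fun t => ψ (t, x) one) =ᶠ[𝓝 t] fun t' => x + T • ∫ σ in (0 : ℝ)..(t' / T), g σ := by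
      filter_upwards [continuous_abs.continuousAt.eventually_lt continuousAt_const htT] with t' ht'
      rw [hform ht', hsolT]
      rfl
    have hval : v (ψ (t, x) one) = g (t / T) := by
      rw [hform htT, hg]
      simp only
      rw [IccExtend_of_mem _ _ (hin htT)]
    rw [hval]
    refine HasDerivAt.congr_of_eventuallyEq ?_ hev
    have h1 : HasDerivAt (fun s => ∫ σ in (0 : ℝ)..s, g σ) (g (t / T)) (t / T) :=
      intervalIntegral.integral_hasDerivAt_right (hgc.intervalIntegrable _ _)
        (hgc.stronglyMeasurableAtFilter _ _) hgc.continuousAt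
    have h2 := ((h1.scomp t ((hasDerivAt_id t).div_const T)).const_smul T).const_add x
    rw [smul_smul, mul_one_div_cancel hT0.ne', one_smul] at h2
    exact h2

end LocalFlow

/-! ### Flows of vector fields on manifolds -/

section ManifoldFlow

open Set Filter Topology

variable {E : Type*} [NormedAddCommGroup E] [NormedSpace ℝ E]
  {H : Type*} [TopologicalSpace H] {I : ModelWithCorners ℝ E H}
  {M : Type*} [TopologicalSpace M] [ChartedSpace H M]

/-- The velocity of the image of a curve under a differentiable map. -/
theorem HasMFDerivAt.comp_curve {E H M E' H' N : Type*} [NormedAddCommGroup E] [NormedSpace ℝ E]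
    [TopologicalSpace H] {I : ModelWithCorners ℝ E H} [TopologicalSpace M] [ChartedSpace H M]
    [NormedAddCommGroup E'] [NormedSpace ℝ E'] [TopologicalSpace H']
    {J : ModelWithCorners ℝ E' H'} [TopologicalSpace N] [ChartedSpace H' N] {g : M → N}
    {γ : ℝ → M} {t : ℝ} {v : TangentSpace I (γ t)}
    {g' : TangentSpace I (γ t) →L[ℝ] TangentSpace J (g (γ t))}
    (hg : HasMFDerivAt I J g (γ t) g')
    (hγ : HasMFDerivAt 𝓘(ℝ, ℝ) I γ t ((1 : ℝ →L[ℝ] ℝ).smulRight v)) :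
    HasMFDerivAt 𝓘(ℝ, ℝ) J (fun t => g (γ t)) t ((1 : ℝ →L[ℝ] ℝ).smulRight (g' v)) := by
  have h : g'.comp ((1 : ℝ →L[ℝ] ℝ).smulRight v) = (1 : ℝ →L[ℝ] ℝ).smulRight (g' v) :=
    ContinuousLinearMap.ext fun r => g'.map_smul r v
  exact h ▸ hg.comp t hγ

theorem hasDerivAt_of_velocity {F : Type*} [NormedAddCommGroup F] [NormedSpace ℝ F] {g : ℝ → F}
    {t : ℝ} {v : F} (h : HasMFDerivAt 𝓘(ℝ, ℝ) 𝓘(ℝ, F) g t ((1 : ℝ →L[ℝ] ℝ).smulRight v)) :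
    HasDerivAt g v t := by
  have h1 : HasFDerivAt g ((1 : ℝ →L[ℝ] ℝ).smulRight v) t := hasMFDerivAt_iff_hasFDerivAt.1 h
  exact h1.hasDerivAt.congr_deriv (one_smul ℝ v)

theorem hasMFDerivAt_const_zero_velocity (x : M) (t : ℝ) :
    HasMFDerivAt 𝓘(ℝ, ℝ) I (fun _ : ℝ => x) t
      ((1 : ℝ →L[ℝ] ℝ).smulRight (0 : TangentSpace I x)) := by
  have h : (1 : ℝ →L[ℝ] ℝ).smulRight (0 : TangentSpace I x) = 0 :=
    ContinuousLinearMap.ext fun r => smul_zero r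
  exact h ▸ hasMFDerivAt_const x t

/-- `θ` is a smooth local flow of `v` for times in `(-ε, ε)` and initial values in `U`. -/
structure IsLocalFlow (v : ∀ x : M, TangentSpace I x) (ε : ℝ) (U : Set M) (θ : ℝ → M → M) :
    Prop where
  smooth : ContMDiffOn (𝓘(ℝ, ℝ).prod I) I ∞ (Function.uncurry θ) (Ioo (-ε) ε ×ˢ U)
  map_zero : ∀ x ∈ U, θ 0 x = x
  isMIntegralCurveOn : ∀ x ∈ U, IsMIntegralCurveOn (fun t => θ t x) v (Ioo (-ε) ε)

theorem IsLocalFlow.mono {v : ∀ x : M, TangentSpace I x} {ε ε' : ℝ} {U U' : Set M}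
    {θ : ℝ → M → M} (h : IsLocalFlow v ε U θ) (hε : ε' ≤ ε) (hU : U' ⊆ U) :
    IsLocalFlow v ε' U' θ where
  smooth := h.smooth.mono (prod_mono (Ioo_subset_Ioo (neg_le_neg hε) hε) hU)
  map_zero x hx := h.map_zero x (hU hx)
  isMIntegralCurveOn x hx := (h.isMIntegralCurveOn x (hU hx)).mono
    (Ioo_subset_Ioo (neg_le_neg hε) hε)

variable [IsManifold I ∞ M]

/-- Smoothness of a vector field along a map `g`, read in a fixed chart. -/
theorem contMDiffAt_tangentBundle_iff {E' : Type*} [NormedAddCommGroup E'] [NormedSpace ℝ E']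
    {H' : Type*} [TopologicalSpace H'] {J : ModelWithCorners ℝ E' H'}
    {N : Type*} [TopologicalSpace N] [ChartedSpace H' N] {g : N → M}
    {s : ∀ q : N, TangentSpace I (g q)} {p : N} {x₀ : M} (hp : g p ∈ (chartAt H x₀).source) :
    ContMDiffAt J I.tangent ∞ (fun q => (⟨g q, s q⟩ : TangentBundle I M)) p ↔
      ContMDiffAt J I ∞ g p ∧ ContMDiffAt J 𝓘(ℝ, E) ∞
        (fun q => (mfderiv I 𝓘(ℝ, E) (extChartAt I x₀) (g q) (s q) : E)) p := by
  have : IsManifold I 1 M := IsManifold.of_le (n := ∞) (by simp)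
  rw [Bundle.Trivialization.contMDiffAt_iff (e := trivializationAt E (TangentSpace I) x₀)
    (by rw [Bundle.Trivialization.mem_source]; simpa using hp)]
  refine and_congr_right fun hg => ?_
  have hev : (fun q => (trivializationAt E (TangentSpace I) x₀ ⟨g q, s q⟩).2) =ᶠ[𝓝 p]
      fun q => (mfderiv I 𝓘(ℝ, E) (extChartAt I x₀) (g q) (s q) : E) := by
    filter_upwards [hg.continuousAt.preimage_mem_nhds ((chartAt H x₀).open_source.mem_nhds hp)]
      with q hq
    have h1 := DFunLike.congr_fun
      (TangentBundle.continuousLinearMapAt_trivializationAt (I := I) (x₀ := x₀) hq) (s q)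
    refine Eq.trans ?_ h1
    rw [Bundle.Trivialization.continuousLinearMapAt_apply,
      Bundle.Trivialization.coe_linearMapAt_of_mem]
    simpa using hq
  exact ⟨fun h => h.congr_of_eventuallyEq hev.symm, fun h => h.congr_of_eventuallyEq hev⟩

/-- The chart representative of a smooth vector field is smooth. -/
theorem contDiffOn_vectorField_chart [I.Boundaryless] {v : ∀ x : M, TangentSpace I x}
    (hv : ContMDiff I I.tangent ∞ (fun x => (⟨x, v x⟩ : TangentBundle I M))) (x₀ : M) :
    ContDiffOn ℝ ∞ (fun y => (mfderiv I 𝓘(ℝ, E) (extChartAt I x₀) ((extChartAt I x₀).symm y)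
      (v ((extChartAt I x₀).symm y)) : E)) (extChartAt I x₀).target := by
  intro y hy
  have hy' : (extChartAt I x₀).symm y ∈ (chartAt H x₀).source := by
    rw [← extChartAt_source (I := I)]; exact (extChartAt I x₀).map_target hy
  have h2 : ContMDiffAt 𝓘(ℝ, E) I ∞ (extChartAt I x₀).symm y :=
    (contMDiffOn_extChartAt_symm x₀ y hy).contMDiffAt
      ((isOpen_extChartAt_target x₀).mem_nhds hy)
  have h1 := ((contMDiffAt_tangentBundle_iff
    (s := fun y => v ((extChartAt I x₀).symm y)) hy').1 (hv.contMDiffAt.comp y h2)).2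
  exact (contMDiffAt_iff_contDiffAt.1 h1).contDiffWithinAt

/-- A smooth map on an open set of a finite-dimensional space agrees with a globally smooth map
near each point. -/
theorem exists_contDiff_eventuallyEq [FiniteDimensional ℝ E] {F : Type*} [NormedAddCommGroup F]
    [NormedSpace ℝ F] {w : E → F} {s : Set E} (hs : IsOpen s) (hw : ContDiffOn ℝ ∞ w s) {x : E}
    (hx : x ∈ s) : ∃ w' : E → F, ContDiff ℝ ∞ w' ∧ w' =ᶠ[𝓝 x] w := by
  obtain ⟨f, hf, hfc⟩ : ∃ f : ContDiffBump x, tsupport f ⊆ s ∧ ContDiff ℝ ∞ f := by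
    obtain ⟨ε, hε, hεs⟩ := Metric.nhds_basis_closedBall.mem_iff.1 (hs.mem_nhds hx)
    refine ⟨⟨ε / 2, ε, by positivity, by linarith⟩, ?_, ContDiffBump.contDiff _⟩
    rw [ContDiffBump.tsupport_eq]; exact hεs
  refine ⟨fun y => f y • w y, contDiff_iff_contDiffAt.2 fun y => ?_, ?_⟩
  · by_cases hy : y ∈ tsupport f
    · exact hfc.contDiffAt.smul ((hw y (hf hy)).contDiffAt (hs.mem_nhds (hf hy)))
    · refine contDiffAt_const (c := (0 : F)) |>.congr_of_eventuallyEq ?_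
      filter_upwards [(isClosed_tsupport f).isOpen_compl.mem_nhds hy] with z hz
      rw [image_eq_zero_of_notMem_tsupport hz, zero_smul]
  · filter_upwards [f.eventuallyEq_one] with y hy
    rw [hy, Pi.one_apply, one_smul]

/-- A smooth vector field has a smooth local flow near each point. -/
theorem exists_isLocalFlow [I.Boundaryless] [FiniteDimensional ℝ E] {v : ∀ x : M, TangentSpace I x}
    (hv : ContMDiff I I.tangent ∞ (fun x => (⟨x, v x⟩ : TangentBundle I M))) (x₀ : M) :
    ∃ ε > 0, ∃ U ∈ 𝓝 x₀, ∃ θ : ℝ → M → M, IsLocalFlow v ε U θ := by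
  have : IsManifold I 1 M := IsManifold.of_le (n := ∞) (by simp)
  have : CompleteSpace E := FiniteDimensional.complete ℝ E
  set e := extChartAt I x₀ with he
  have htopen : IsOpen e.target := isOpen_extChartAt_target x₀
  set w : E → E := fun y => mfderiv I 𝓘(ℝ, E) e (e.symm y) (v (e.symm y)) with hw
  obtain ⟨w', hw', hww'⟩ := exists_contDiff_eventuallyEq htopen
    (contDiffOn_vectorField_chart hv x₀) (mem_extChartAt_target x₀)
  obtain ⟨ε₁, hε₁, θ, hθ, hθ'⟩ := exists_local_flow hw' (e x₀)
  have hcont : ContinuousAt θ (0, e x₀) :=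
    (hθ _ ⟨Metric.mem_ball_self hε₁, Metric.mem_ball_self hε₁⟩).continuousAt
  have hθ0 : θ (0, e x₀) = e x₀ := (hθ' _ (Metric.mem_ball_self hε₁)).1
  have hgood : ∀ᶠ y in 𝓝 (e x₀), y ∈ e.target ∧ w' y = w y :=
    Filter.Eventually.and (htopen.mem_nhds (mem_extChartAt_target x₀)) hww'
  rw [ContinuousAt, hθ0] at hcont
  obtain ⟨ε₂, hε₂, hb⟩ := Metric.eventually_nhds_iff_ball.1 (hcont.eventually hgood)
  set ε := min ε₁ ε₂
  have hε : 0 < ε := lt_min hε₁ hε₂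
  have hIoo {t : ℝ} (ht : t ∈ Ioo (-ε) ε) : t ∈ Metric.ball (0 : ℝ) ε := by
    rwa [Real.ball_eq_Ioo, zero_sub, zero_add]
  have hb' {t : ℝ} {y : E} (ht : t ∈ Ioo (-ε) ε) (hy : y ∈ Metric.ball (e x₀) ε) :
      θ (t, y) ∈ e.target ∧ w' (θ (t, y)) = w (θ (t, y)) := by
    refine hb _ ?_
    rw [← ball_prod_same]
    exact ⟨Metric.ball_subset_ball (min_le_right _ _) (hIoo ht),
      Metric.ball_subset_ball (min_le_right _ _) hy⟩
  have hle : ε ≤ ε₁ := min_le_left _ _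
  refine ⟨ε, hε, e.source ∩ e ⁻¹' Metric.ball (e x₀) ε, ?_, fun t x => e.symm (θ (t, e x)),
    ?_, ?_, ?_⟩
  · exact inter_mem (extChartAt_source_mem_nhds x₀)
      ((continuousAt_extChartAt x₀).preimage_mem_nhds (Metric.ball_mem_nhds _ hε))
  · rintro ⟨t, x⟩ ⟨ht, hxs, hx⟩
    refine ContMDiffAt.contMDiffWithinAt ?_
    have h1 : ContMDiffAt I 𝓘(ℝ, E) ∞ e x :=
      contMDiffAt_extChartAt' (by rwa [← extChartAt_source (I := I)])
    have h2 : ContMDiffAt (𝓘(ℝ, ℝ).prod I) 𝓘(ℝ, ℝ × E) ∞ (fun p : ℝ × M => (p.1, e p.2)) (t, x) :=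
      ContMDiffAt.prodMk_space contMDiffAt_fst (h1.comp (t, x) contMDiffAt_snd)
    have h3 : ContMDiffAt 𝓘(ℝ, ℝ × E) 𝓘(ℝ, E) ∞ θ (t, e x) :=
      (hθ (t, e x) ⟨Metric.ball_subset_ball hle (hIoo ht),
        Metric.ball_subset_ball hle hx⟩).contMDiffAt
    have h4 : ContMDiffAt 𝓘(ℝ, E) I ∞ e.symm (θ (t, e x)) :=
      (contMDiffOn_extChartAt_symm x₀ _ (hb' ht hx).1).contMDiffAt (htopen.mem_nhds (hb' ht hx).1)
    exact h4.comp (t, x) (h3.comp (t, x) h2)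
  · rintro x ⟨hxs, hx⟩
    rw [(hθ' _ (Metric.ball_subset_ball hle hx)).1, e.left_inv hxs]
  · rintro x ⟨hxs, hx⟩ t ht
    obtain ⟨htar, hww⟩ := hb' ht hx
    refine HasMFDerivAt.hasMFDerivWithinAt ?_
    have h1 : HasMFDerivAt 𝓘(ℝ, ℝ) 𝓘(ℝ, E) (fun t => θ (t, e x)) t
        ((1 : ℝ →L[ℝ] ℝ).smulRight (w' (θ (t, e x)))) :=
      ((hθ' _ (Metric.ball_subset_ball hle hx)).2 t
        (Metric.ball_subset_ball hle (hIoo ht))).hasFDerivAt.hasMFDerivAt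
    have h2 : HasMFDerivAt 𝓘(ℝ, E) I e.symm (θ (t, e x))
        (mfderiv 𝓘(ℝ, E) I e.symm (θ (t, e x))) := by
      have := mdifferentiableWithinAt_extChartAt_symm htar
      rw [I.range_eq_univ, mdifferentiableWithinAt_univ] at this
      exact this.hasMFDerivAt
    have h3 := DFunLike.congr_fun
      (mfderivWithin_extChartAt_symm_comp_mfderiv_extChartAt htar) (v (e.symm (θ (t, e x))))
    rw [I.range_eq_univ, mfderivWithin_univ] at h3
    have h4 : w' (θ (t, e x)) = mfderiv I 𝓘(ℝ, E) e (e.symm (θ (t, e x)))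
      (v (e.symm (θ (t, e x)))) := hww
    rw [h4] at h1
    have h5 := HasMFDerivAt.comp_curve h2 h1
    exact (congrArg (fun z => (1 : ℝ →L[ℝ] ℝ).smulRight z) h3) ▸ h5

/-- The flow of a complete vector field is additive in time. -/
theorem flow_add [T2Space M] [I.Boundaryless] {v : ∀ x : M, TangentSpace I x}
    (hv : ContMDiff I I.tangent ∞ (fun x => (⟨x, v x⟩ : TangentBundle I M)))
    {Θ : ℝ → M → M} (h0 : ∀ x, Θ 0 x = x) (hΘ : ∀ x, IsMIntegralCurve (fun t => Θ t x) v)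
    (s t : ℝ) (x : M) : Θ (s + t) x = Θ s (Θ t x) := by
  have : IsManifold I 1 M := IsManifold.of_le (n := ∞) (by simp)
  have h1 := (hΘ x).comp_add t
  have h2 := isMIntegralCurve_Ioo_eq_of_contMDiff_boundaryless (t₀ := 0) (hv.of_le (by simp))
    h1 (hΘ (Θ t x)) (by simp [h0])
  exact congrFun h2 s

/-- A smooth vector field with smooth local flows defined for a uniform time has a smooth global
flow. Smoothness at large times follows by writing the flow as an iterate of a short-time flow. -/
theorem exists_global_flow [T2Space M] [I.Boundaryless] [CompleteSpace E]
    {v : ∀ x : M, TangentSpace I x}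
    (hv : ContMDiff I I.tangent ∞ (fun x => (⟨x, v x⟩ : TangentBundle I M)))
    {ε : ℝ} (hε : 0 < ε)
    (hloc : ∀ x₀ : M, ∃ U ∈ 𝓝 x₀, ∃ θ : ℝ → M → M, IsLocalFlow v ε U θ) :
    ∃ Θ : ℝ → M → M, ContMDiff (𝓘(ℝ, ℝ).prod I) I ∞ (Function.uncurry Θ) ∧
      (∀ x, Θ 0 x = x) ∧ ∀ x, IsMIntegralCurve (fun t => Θ t x) v := by
  have : IsManifold I 1 M := IsManifold.of_le (n := ∞) (by simp)
  have hv1 := hv.of_le (m := 1) (by simp)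
  have hex : ∀ x, ∃ γ : ℝ → M, γ 0 = x ∧ IsMIntegralCurve γ v :=
    exists_isMIntegralCurve_of_isMIntegralCurveOn hv1 hε fun x => by
      obtain ⟨U, hU, θ, hθ⟩ := hloc x
      exact ⟨fun t => θ t x, hθ.map_zero x (mem_of_mem_nhds hU),
        hθ.isMIntegralCurveOn x (mem_of_mem_nhds hU)⟩
  choose γ hγ0 hγ using hex
  set Θ : ℝ → M → M := fun t x => γ x t with hΘ
  have hadd : ∀ s t x, Θ (s + t) x = Θ s (Θ t x) := flow_add hv hγ0 hγ
  have hshort : ContMDiffOn (𝓘(ℝ, ℝ).prod I) I ∞ (Function.uncurry Θ)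
      (Ioo (-ε) ε ×ˢ (univ : Set M)) := by
    rintro ⟨t, x⟩ ⟨ht, -⟩
    obtain ⟨U, hU, θ, hθ⟩ := hloc x
    have hnhds : Ioo (-ε) ε ×ˢ U ∈ 𝓝 (t, x) := prod_mem_nhds (Ioo_mem_nhds ht.1 ht.2) hU
    refine ((hθ.smooth.contMDiffAt hnhds).congr_of_eventuallyEq ?_).contMDiffWithinAt
    filter_upwards [hnhds] with p hp
    have := isMIntegralCurveOn_Ioo_eqOn_of_contMDiff_boundaryless (t₀ := 0)
      ⟨neg_lt_zero.2 hε, hε⟩ hv1 ((hγ p.2).isMIntegralCurveOn _)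
      (hθ.isMIntegralCurveOn p.2 hp.2) ((hγ0 _).trans (hθ.map_zero p.2 hp.2).symm)
    exact this hp.1
  have hiter (n : ℕ) : ContMDiffOn (𝓘(ℝ, ℝ).prod I) I ∞
      (fun p : ℝ × M => Θ (n * p.1) p.2) (Ioo (-ε) ε ×ˢ (univ : Set M)) := by
    induction n with
    | zero =>
      refine contMDiffOn_snd.congr fun p _ => ?_
      simp [hΘ, hγ0]
    | succ n ih =>
      have h := hshort.comp (contMDiffOn_fst.prodMk ih) (fun p hp => ⟨hp.1, mem_univ _⟩)
      refine h.congr fun p _ => ?_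
      simp only [Function.comp_apply, Function.uncurry_apply_pair]
      rw [← hadd]
      push_cast
      ring_nf
  refine ⟨Θ, ?_, hγ0, hγ⟩
  rintro ⟨t, x⟩
  obtain ⟨n, hn⟩ := exists_nat_gt (|t| / ε)
  have hn0 : (0 : ℝ) < n := lt_of_le_of_lt (by positivity) hn
  have ht : t / n ∈ Ioo (-ε) ε := by
    rw [mem_Ioo, ← abs_lt, abs_div, abs_of_pos hn0, div_lt_iff₀ hn0, mul_comm]
    exact (div_lt_iff₀ hε).1 hn
  have h1 : ContMDiffAt (𝓘(ℝ, ℝ).prod I) (𝓘(ℝ, ℝ).prod I) ∞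
      (fun p : ℝ × M => (p.1 / n, p.2)) (t, x) := by
    refine ContMDiffAt.prodMk ?_ contMDiffAt_snd
    exact (contDiff_id.div_const (n : ℝ)).contMDiff.contMDiffAt.comp (t, x) contMDiffAt_fst
  have h2 := ((hiter n).contMDiffAt (x := (t / n, x))
    (prod_mem_nhds (Ioo_mem_nhds ht.1 ht.2) univ_mem)).comp (t, x) h1
  refine h2.congr_of_eventuallyEq (Eventually.of_forall fun p => ?_)
  simp only [Function.comp_apply, Function.uncurry]
  rw [mul_div_cancel₀ _ hn0.ne']

end ManifoldFlow

/-! ### Evolution of compactly supported time-dependent vector fields -/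

section Evolution

open Set Filter Topology

variable {E : Type*} [NormedAddCommGroup E] [NormedSpace ℝ E]
  {M : Type*} [TopologicalSpace M] [ChartedSpace E M]

/-- The suspension `(1, V)` on `ℝ × M` of a time-dependent vector field `V` on `M`. -/
def suspension (V : ℝ → ∀ x : M, TangentSpace 𝓘(ℝ, E) x) (p : ℝ × M) :
    TangentSpace (𝓘(ℝ, ℝ).prod 𝓘(ℝ, E)) p :=
  ((1 : ℝ), V p.1 p.2)

theorem isMIntegralCurve_suspension {V : ℝ → ∀ x : M, TangentSpace 𝓘(ℝ, E) x} {γ : ℝ → M}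
    {c t : ℝ} (h : HasMFDerivAt 𝓘(ℝ, ℝ) 𝓘(ℝ, E) γ t
      ((1 : ℝ →L[ℝ] ℝ).smulRight (V (c + t) (γ t)))) :
    HasMFDerivAt 𝓘(ℝ, ℝ) (𝓘(ℝ, ℝ).prod 𝓘(ℝ, E)) (fun t => (c + t, γ t)) t
      ((1 : ℝ →L[ℝ] ℝ).smulRight (suspension V (c + t, γ t))) := by
  have h1 : HasMFDerivAt 𝓘(ℝ, ℝ) 𝓘(ℝ, ℝ) (fun t => c + t) t
      ((1 : ℝ →L[ℝ] ℝ).smulRight (1 : ℝ)) :=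
    ((hasDerivAt_id t).const_add c).hasFDerivAt.hasMFDerivAt
  refine (h1.prodMk h).congr_mfderiv ?_
  exact ContinuousLinearMap.ext fun r => rfl

variable [IsManifold 𝓘(ℝ, E) ∞ M]

theorem contMDiff_suspension {V : ℝ → ∀ x : M, TangentSpace 𝓘(ℝ, E) x}
    (hV : ContMDiff (𝓘(ℝ, ℝ).prod 𝓘(ℝ, E)) 𝓘(ℝ, E).tangent ∞
      (fun p : ℝ × M => (⟨p.2, V p.1 p.2⟩ : TangentBundle 𝓘(ℝ, E) M))) :
    ContMDiff (𝓘(ℝ, ℝ).prod 𝓘(ℝ, E)) (𝓘(ℝ, ℝ).prod 𝓘(ℝ, E)).tangent ∞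
      (fun p : ℝ × M =>
        (⟨p, suspension V p⟩ : TangentBundle (𝓘(ℝ, ℝ).prod 𝓘(ℝ, E)) (ℝ × M))) := by
  have : IsManifold 𝓘(ℝ, E) 1 M := IsManifold.of_le (n := ∞) (by simp)
  have h1 : ContMDiff 𝓘(ℝ, ℝ) 𝓘(ℝ, ℝ).tangent ∞
      (fun t : ℝ => (⟨t, (1 : ℝ)⟩ : TangentBundle 𝓘(ℝ, ℝ) ℝ)) :=
    contMDiff_vectorSpace_iff_contDiff.2 contDiff_const
  exact contMDiff_equivTangentBundleProd_symm.comp ((h1.comp contMDiff_fst).prodMk hV)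

/-- Integral curves of a smooth time-dependent vector field are unique. -/
theorem eqOn_of_hasMFDerivAt_timeDependent [T2Space M] [CompleteSpace E]
    {V : ℝ → ∀ x : M, TangentSpace 𝓘(ℝ, E) x}
    (hV : ContMDiff (𝓘(ℝ, ℝ).prod 𝓘(ℝ, E)) 𝓘(ℝ, E).tangent ∞
      (fun p : ℝ × M => (⟨p.2, V p.1 p.2⟩ : TangentBundle 𝓘(ℝ, E) M)))
    {γ γ' : ℝ → M} {a b t₀ : ℝ} (ht₀ : t₀ ∈ Ioo a b)
    (hγ : ∀ t ∈ Ioo a b, HasMFDerivAt 𝓘(ℝ, ℝ) 𝓘(ℝ, E) γ t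
      ((1 : ℝ →L[ℝ] ℝ).smulRight (V t (γ t))))
    (hγ' : ∀ t ∈ Ioo a b, HasMFDerivAt 𝓘(ℝ, ℝ) 𝓘(ℝ, E) γ' t
      ((1 : ℝ →L[ℝ] ℝ).smulRight (V t (γ' t))))
    (h : γ t₀ = γ' t₀) : EqOn γ γ' (Ioo a b) := by
  have : IsManifold 𝓘(ℝ, E) 1 M := IsManifold.of_le (n := ∞) (by simp)
  have hsus {γ : ℝ → M} (hγ : ∀ t ∈ Ioo a b, HasMFDerivAt 𝓘(ℝ, ℝ) 𝓘(ℝ, E) γ t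
      ((1 : ℝ →L[ℝ] ℝ).smulRight (V t (γ t)))) :
      IsMIntegralCurveOn (fun t => ((0 : ℝ) + t, γ t)) (suspension V) (Ioo a b) := fun t ht =>
    (isMIntegralCurve_suspension (c := 0) (by rw [zero_add]; exact hγ t ht)).hasMFDerivWithinAt
  have h1 := isMIntegralCurveOn_Ioo_eqOn_of_contMDiff_boundaryless ht₀
    ((contMDiff_suspension hV).of_le (by simp)) (hsus hγ) (hsus hγ') (by rw [h])
  exact fun t ht => congrArg Prod.snd (h1 ht)

/-- A smooth time-dependent vector field that vanishes for times outside `[0, 1]` and outside a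
compact set has a globally defined smooth evolution `Φ s t x`: the value at time `t` of the
integral curve that passes through `x` at time `s`. -/
theorem exists_evolution [T2Space M] [FiniteDimensional ℝ E]
    {V : ℝ → ∀ x : M, TangentSpace 𝓘(ℝ, E) x}
    (hV : ContMDiff (𝓘(ℝ, ℝ).prod 𝓘(ℝ, E)) 𝓘(ℝ, E).tangent ∞
      (fun p : ℝ × M => (⟨p.2, V p.1 p.2⟩ : TangentBundle 𝓘(ℝ, E) M)))
    {K : Set M} (hK : IsCompact K)
    (hsupp : ∀ t x, t ∉ Icc (0 : ℝ) 1 ∨ x ∉ K → V t x = 0) :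
    ∃ Φ : ℝ → ℝ → M → M,
      ContMDiff (𝓘(ℝ, ℝ).prod (𝓘(ℝ, ℝ).prod 𝓘(ℝ, E))) 𝓘(ℝ, E) ∞
        (fun p : ℝ × ℝ × M => Φ p.1 p.2.1 p.2.2) ∧
      (∀ s x, Φ s s x = x) ∧
      ∀ s t x, HasMFDerivAt 𝓘(ℝ, ℝ) 𝓘(ℝ, E) (fun t => Φ s t x) t
        ((1 : ℝ →L[ℝ] ℝ).smulRight (V t (Φ s t x))) := by
  have : CompleteSpace E := FiniteDimensional.complete ℝ E
  have hY := contMDiff_suspension hV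
  -- local flows have a uniform existence time: by compactness on `[-1, 2] × K`, and because
  -- elsewhere the suspended flow is a translation in time for time at least `1`
  have hunif : ∃ ε > 0, ∀ p : ℝ × M, ∃ U ∈ 𝓝 p, ∃ θ : ℝ → ℝ × M → ℝ × M,
      IsLocalFlow (suspension V) ε U θ := by
    have hC : IsCompact (Icc (-1 : ℝ) 2 ×ˢ K) := isCompact_Icc.prod hK
    have hcpt : ∃ ε > 0, ∀ p ∈ Icc (-1 : ℝ) 2 ×ˢ K, ∃ U ∈ 𝓝 p, ∃ θ : ℝ → ℝ × M → ℝ × M,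
        IsLocalFlow (suspension V) ε U θ := by
      refine hC.induction_on (p := fun S => ∃ ε > 0, ∀ p ∈ S, ∃ U ∈ 𝓝 p,
        ∃ θ : ℝ → ℝ × M → ℝ × M, IsLocalFlow (suspension V) ε U θ) ?_ ?_ ?_ ?_
      · exact ⟨1, one_pos, fun p hp => hp.elim⟩
      · rintro S T hST ⟨ε, hε, h⟩
        exact ⟨ε, hε, fun p hp => h p (hST hp)⟩
      · rintro S T ⟨ε, hε, h⟩ ⟨ε', hε', h'⟩
        refine ⟨min ε ε', lt_min hε hε', ?_⟩
        rintro p (hp | hp)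
        · obtain ⟨U, hU, θ, hθ⟩ := h p hp
          exact ⟨U, hU, θ, hθ.mono (min_le_left _ _) subset_rfl⟩
        · obtain ⟨U, hU, θ, hθ⟩ := h' p hp
          exact ⟨U, hU, θ, hθ.mono (min_le_right _ _) subset_rfl⟩
      · intro p _
        obtain ⟨ε, hε, U, hU, θ, hθ⟩ := exists_isLocalFlow hY p
        obtain ⟨W, hWU, hW, hpW⟩ := mem_nhds_iff.1 hU
        exact ⟨W, mem_nhdsWithin_of_mem_nhds (hW.mem_nhds hpW), ε, hε, fun q hq =>
          ⟨W, hW.mem_nhds hq, θ, hθ.mono le_rfl hWU⟩⟩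
    obtain ⟨ε, hε, h⟩ := hcpt
    refine ⟨min ε 1, lt_min hε one_pos, fun p => ?_⟩
    by_cases hp : p ∈ Icc (-1 : ℝ) 2 ×ˢ K
    · obtain ⟨U, hU, θ, hθ⟩ := h p hp
      exact ⟨U, hU, θ, hθ.mono (min_le_left _ _) subset_rfl⟩
    · refine ⟨(Icc (-1 : ℝ) 2 ×ˢ K)ᶜ, hC.isClosed.isOpen_compl.mem_nhds hp,
        fun t q => (q.1 + t, q.2), ?_, fun q _ => by simp, fun q hq t ht => ?_⟩
      · exact (((contMDiff_fst.comp contMDiff_snd).add contMDiff_fst).prodMk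
          (contMDiff_snd.comp contMDiff_snd)).contMDiffOn
      · have hzero : V (q.1 + t) q.2 = 0 := by
          refine hsupp _ _ ?_
          by_contra hcon
          push Not at hcon
          have h1 := min_le_right ε 1
          exact hq ⟨⟨by linarith [hcon.1.1, ht.2], by linarith [hcon.1.2, ht.1]⟩, hcon.2⟩
        have hconst : HasMFDerivAt 𝓘(ℝ, ℝ) 𝓘(ℝ, E) (fun _ : ℝ => q.2) t
            ((1 : ℝ →L[ℝ] ℝ).smulRight (V (q.1 + t) q.2)) := by
          rw [hzero]
          exact hasMFDerivAt_const_zero_velocity q.2 t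
        exact (isMIntegralCurve_suspension hconst).hasMFDerivWithinAt
  obtain ⟨ε, hε, hloc⟩ := hunif
  obtain ⟨Θ, hΘ, hΘ0, hΘc⟩ := exists_global_flow hY hε hloc
  -- the time component of the suspended flow is a translation
  have htime (r : ℝ) (p : ℝ × M) : (Θ r p).1 = p.1 + r := by
    have hd (r : ℝ) : HasDerivAt (fun r => (Θ r p).1 - r) 0 r := by
      have h1 := HasMFDerivAt.comp_curve (hasMFDerivAt_fst (Θ r p)) (hΘc p r)
      have h2 : HasDerivAt (fun r => (Θ r p).1) 1 r := hasDerivAt_of_velocity h1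
      exact (h2.sub (hasDerivAt_id r)).congr_deriv (sub_self 1)
    have h3 := is_const_of_deriv_eq_zero (fun r => (hd r).differentiableAt)
      (fun r => (hd r).deriv) r 0
    simp only [hΘ0, sub_zero] at h3
    linarith
  refine ⟨fun s t x => (Θ (t + -s) (s, x)).2, ?_, fun s x => by simp [hΘ0], fun s t x => ?_⟩
  · have h1 : ContMDiff (𝓘(ℝ, ℝ).prod (𝓘(ℝ, ℝ).prod 𝓘(ℝ, E)))
        (𝓘(ℝ, ℝ).prod (𝓘(ℝ, ℝ).prod 𝓘(ℝ, E))) ∞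
        (fun p : ℝ × ℝ × M => (p.2.1 + -p.1, (p.1, p.2.2))) :=
      ((contMDiff_fst.comp contMDiff_snd).add contMDiff_fst.neg).prodMk
        (contMDiff_fst.prodMk (contMDiff_snd.comp contMDiff_snd))
    exact contMDiff_snd.comp (hΘ.comp h1)
  · have h1 := (((hΘc (s, x)).comp_add (-s)) t)
    have h2 := HasMFDerivAt.comp_curve (hasMFDerivAt_snd (Θ (t + -s) (s, x))) h1
    have h3 : V (Θ (t + -s) (s, x)).1 (Θ (t + -s) (s, x)).2 = V t (Θ (t + -s) (s, x)).2 :=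
      congrArg (fun r => V r (Θ (t + -s) (s, x)).2) (by rw [htime]; ring)
    exact (congrArg (fun z => (1 : ℝ →L[ℝ] ℝ).smulRight z) h3) ▸ h2

end Evolution

/-! ### Symplectic forms and Hamiltonian vector fields in charts -/

section Charts

open Set Filter Topology

variable {E : Type*} [NormedAddCommGroup E] [NormedSpace ℝ E]
  {M : Type*} [TopologicalSpace M] [ChartedSpace E M]

/-- The bilinear form `(a, b) ↦ η(a, b)` of a continuous alternating 2-form, as a continuous
linear function of the 2-form. -/
noncomputable def alternatingBilin (E : Type*) [NormedAddCommGroup E] [NormedSpace ℝ E] :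
    (E [⋀^Fin 2]→L[ℝ] ℝ) →L[ℝ] E →L[ℝ] E →L[ℝ] ℝ :=
  have h0 (a b w : E) : Function.update ![a, w] 0 b = ![b, w] := by
    ext i; fin_cases i <;> rfl
  have h1 (v a b : E) : Function.update ![v, a] 1 b = ![v, b] := by
    ext i; fin_cases i <;> rfl
  have hb (η : E [⋀^Fin 2]→L[ℝ] ℝ) (a b : E) : ‖η ![a, b]‖ ≤ ‖η‖ * ‖a‖ * ‖b‖ := by
    have := η.le_opNorm ![a, b]
    rwa [Fin.prod_univ_two, ← mul_assoc] at this
  LinearMap.mkContinuous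
    { toFun := fun η => LinearMap.mkContinuous₂
        (LinearMap.mk₂ ℝ (fun v w => η ![v, w])
          (fun a b w => by simpa only [h0] using η.map_update_add ![a, w] 0 a b)
          (fun c a w => by simpa only [h0] using η.map_update_smul ![a, w] 0 c a)
          (fun v a b => by simpa only [h1] using η.map_update_add ![v, a] 1 a b)
          (fun c v a => by simpa only [h1] using η.map_update_smul ![v, a] 1 c a))
        ‖η‖ (hb η)
      map_add' := fun _ _ => rfl
      map_smul' := fun _ _ => rfl } 1
    (fun η => by
      rw [one_mul]
      refine ContinuousLinearMap.opNorm_le_bound₂ _ (norm_nonneg _) (hb η))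

namespace SymplecticForm

/-- The symplectic form in the chart at `x₀`, as a field of bilinear forms on the model space. -/
noncomputable def chartForm (Ω : SymplecticForm E M) (x₀ : M) (y : E) : E →L[ℝ] E →L[ℝ] ℝ :=
  alternatingBilin E ((Ω.form ((extChartAt 𝓘(ℝ, E) x₀).symm y)).compContinuousLinearMap
    (mfderiv 𝓘(ℝ, E) 𝓘(ℝ, E) (extChartAt 𝓘(ℝ, E) x₀).symm y))

theorem chartForm_apply (Ω : SymplecticForm E M) (x₀ : M) (y a b : E) :
    Ω.chartForm x₀ y a b = Ω.bilin ((extChartAt 𝓘(ℝ, E) x₀).symm y)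
      (mfderiv 𝓘(ℝ, E) 𝓘(ℝ, E) (extChartAt 𝓘(ℝ, E) x₀).symm y a)
      (mfderiv 𝓘(ℝ, E) 𝓘(ℝ, E) (extChartAt 𝓘(ℝ, E) x₀).symm y b) := by
  rw [bilin_apply]
  refine congrArg (Ω.form ((extChartAt 𝓘(ℝ, E) x₀).symm y)) ?_
  funext i
  fin_cases i <;> rfl

theorem chartForm_swap (Ω : SymplecticForm E M) (x₀ : M) (y a b : E) :
    Ω.chartForm x₀ y a b = - Ω.chartForm x₀ y b a := by
  rw [chartForm_apply, chartForm_apply, bilin_swap]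

theorem contDiffOn_chartForm (Ω : SymplecticForm E M) (x₀ : M) :
    ContDiffOn ℝ ∞ (Ω.chartForm x₀) (extChartAt 𝓘(ℝ, E) x₀).target := by
  have h := Ω.smooth (chartAt E x₀) (chart_mem_atlas E x₀)
  have ht : (extChartAt 𝓘(ℝ, E) x₀).target = (chartAt E x₀).target := by simp [extChartAt]
  rw [ht]
  exact (ContinuousLinearMap.contDiff (F := E →L[ℝ] E →L[ℝ] ℝ)
    (alternatingBilin E)).comp_contDiffOn h

/-- Closedness of the symplectic form, as an identity between derivatives of its coefficients. -/
theorem fderiv_chartForm_cyclic (Ω : SymplecticForm E M) (x₀ : M) {y : E}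
    (hy : y ∈ (extChartAt 𝓘(ℝ, E) x₀).target) (a b c : E) :
    fderiv ℝ (Ω.chartForm x₀) y a b c - fderiv ℝ (Ω.chartForm x₀) y b a c
      + fderiv ℝ (Ω.chartForm x₀) y c a b = 0 := by
  have ht : (extChartAt 𝓘(ℝ, E) x₀).target = (chartAt E x₀).target := by simp [extChartAt]
  rw [ht] at hy
  have hd := ((Ω.smooth (chartAt E x₀) (chart_mem_atlas E x₀)).contDiffAt
    ((chartAt E x₀).open_target.mem_nhds hy)).differentiableAt (by simp)
  have h := congrArg (fun f => f ![a, b, c]) (Ω.closed (chartAt E x₀) (chart_mem_atlas E x₀) y hy)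
  set f : E → E [⋀^Fin 2]→L[ℝ] ℝ := fun y =>
    ((Ω.form ((chartAt E x₀).symm y)).compContinuousLinearMap
      (mfderiv 𝓘(ℝ, E) 𝓘(ℝ, E) (chartAt E x₀).symm y)) with hf
  have hB (u v w : E) : fderiv ℝ (Ω.chartForm x₀) y u v w =
      fderiv ℝ (fun y => f y ![v, w]) y u := by
    have h1 : HasFDerivAt (Ω.chartForm x₀) ((alternatingBilin E).comp (fderiv ℝ f y)) y :=
      HasFDerivAt.comp (g := alternatingBilin E) (F := E [⋀^Fin 2]→L[ℝ] ℝ)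
        (G := E →L[ℝ] E →L[ℝ] ℝ) y
        (ContinuousLinearMap.hasFDerivAt (F := E →L[ℝ] E →L[ℝ] ℝ) (alternatingBilin E))
        hd.hasFDerivAt
    have h2 : HasFDerivAt (fun y => f y ![v, w]) _ y :=
      (h1.clm_apply (hasFDerivAt_const v y)).clm_apply (hasFDerivAt_const w y)
    rw [h1.fderiv, h2.fderiv]
    simp
  replace h : extDeriv f y ![a, b, c] = 0 := h
  rw [extDeriv_apply hd, Fin.sum_univ_succ, Fin.sum_univ_succ, Fin.sum_univ_succ] at h
  simp only [hB]
  have e0 : (0 : Fin 3).removeNth ![a, b, c] = ![b, c] := by ext i; fin_cases i <;> rfl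
  have e1 : (Fin.succ 0 : Fin 3).removeNth ![a, b, c] = ![a, c] := by ext i; fin_cases i <;> rfl
  have e2 : ((Fin.succ 0).succ : Fin 3).removeNth ![a, b, c] = ![a, b] := by
    ext i; fin_cases i <;> rfl
  rw [e0, e1, e2] at h
  simpa [sub_eq_add_neg, add_assoc] using h

variable [IsManifold 𝓘(ℝ, E) ∞ M]

theorem mfderiv_symm_mfderiv_extChartAt (x₀ : M) {y : E}
    (hy : y ∈ (extChartAt 𝓘(ℝ, E) x₀).target)
    (u : TangentSpace 𝓘(ℝ, E) ((extChartAt 𝓘(ℝ, E) x₀).symm y)) :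
    mfderiv 𝓘(ℝ, E) 𝓘(ℝ, E) (extChartAt 𝓘(ℝ, E) x₀).symm y
      (mfderiv 𝓘(ℝ, E) 𝓘(ℝ, E) (extChartAt 𝓘(ℝ, E) x₀)
        ((extChartAt 𝓘(ℝ, E) x₀).symm y) u : E) = u := by
  have : IsManifold 𝓘(ℝ, E) 1 M := IsManifold.of_le (n := ∞) (by simp)
  have h := DFunLike.congr_fun (mfderivWithin_extChartAt_symm_comp_mfderiv_extChartAt hy) u
  rw [ModelWithCorners.range_eq_univ, mfderivWithin_univ] at h
  exact h

theorem mfderiv_mfderiv_symm_extChartAt (x₀ : M) {y : E}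
    (hy : y ∈ (extChartAt 𝓘(ℝ, E) x₀).target) (u : E) :
    (mfderiv 𝓘(ℝ, E) 𝓘(ℝ, E) (extChartAt 𝓘(ℝ, E) x₀) ((extChartAt 𝓘(ℝ, E) x₀).symm y)
      (mfderiv 𝓘(ℝ, E) 𝓘(ℝ, E) (extChartAt 𝓘(ℝ, E) x₀).symm y u) : E) = u := by
  have : IsManifold 𝓘(ℝ, E) 1 M := IsManifold.of_le (n := ∞) (by simp)
  have h := DFunLike.congr_fun (mfderiv_extChartAt_comp_mfderivWithin_extChartAt_symm hy) u
  rw [ModelWithCorners.range_eq_univ, mfderivWithin_univ] at h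
  exact h

/-- The symplectic form on tangent vectors, read in a chart. -/
theorem bilin_eq_chartForm (Ω : SymplecticForm E M) (x₀ : M) {x : M}
    (hx : x ∈ (extChartAt 𝓘(ℝ, E) x₀).source) (u w : TangentSpace 𝓘(ℝ, E) x) :
    Ω.bilin x u w = Ω.chartForm x₀ (extChartAt 𝓘(ℝ, E) x₀ x)
      (mfderiv 𝓘(ℝ, E) 𝓘(ℝ, E) (extChartAt 𝓘(ℝ, E) x₀) x u)
      (mfderiv 𝓘(ℝ, E) 𝓘(ℝ, E) (extChartAt 𝓘(ℝ, E) x₀) x w) := by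
  obtain ⟨y, hy, rfl⟩ : ∃ y ∈ (extChartAt 𝓘(ℝ, E) x₀).target,
      (extChartAt 𝓘(ℝ, E) x₀).symm y = x :=
    ⟨_, (extChartAt 𝓘(ℝ, E) x₀).map_source hx, (extChartAt 𝓘(ℝ, E) x₀).left_inv hx⟩
  have h1 := mfderiv_symm_mfderiv_extChartAt x₀ hy u
  have h2 := mfderiv_symm_mfderiv_extChartAt x₀ hy w
  have h3 := chartForm_apply Ω x₀ y
    (mfderiv 𝓘(ℝ, E) 𝓘(ℝ, E) (extChartAt 𝓘(ℝ, E) x₀) ((extChartAt 𝓘(ℝ, E) x₀).symm y) u)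
    (mfderiv 𝓘(ℝ, E) 𝓘(ℝ, E) (extChartAt 𝓘(ℝ, E) x₀) ((extChartAt 𝓘(ℝ, E) x₀).symm y) w)
  rw [h1, h2] at h3
  rw [← h3]
  have h4 : extChartAt 𝓘(ℝ, E) x₀ ((extChartAt 𝓘(ℝ, E) x₀).symm y) = y :=
    (extChartAt 𝓘(ℝ, E) x₀).right_inv hy
  exact congrArg (fun z => Ω.chartForm x₀ z
    (mfderiv 𝓘(ℝ, E) 𝓘(ℝ, E) (extChartAt 𝓘(ℝ, E) x₀) ((extChartAt 𝓘(ℝ, E) x₀).symm y) u)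
    (mfderiv 𝓘(ℝ, E) 𝓘(ℝ, E) (extChartAt 𝓘(ℝ, E) x₀) ((extChartAt 𝓘(ℝ, E) x₀).symm y) w))
    h4.symm

theorem contDiffAt_hamiltonian_chart {H : ℝ → M → ℝ}
    (hH : ContMDiff (𝓘(ℝ, ℝ).prod 𝓘(ℝ, E)) 𝓘(ℝ, ℝ) ∞ (fun p : ℝ × M => H p.1 p.2))
    (x₀ : M) (t : ℝ) {y : E} (hy : y ∈ (extChartAt 𝓘(ℝ, E) x₀).target) :
    ContDiffAt ℝ ∞ (fun q : ℝ × E => H q.1 ((extChartAt 𝓘(ℝ, E) x₀).symm q.2)) (t, y) := by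
  rw [← contMDiffAt_iff_contDiffAt]
  have h1 : ContMDiffAt 𝓘(ℝ, E) 𝓘(ℝ, E) ∞ (extChartAt 𝓘(ℝ, E) x₀).symm y :=
    (contMDiffOn_extChartAt_symm x₀ y hy).contMDiffAt ((isOpen_extChartAt_target x₀).mem_nhds hy)
  have h2 : ContMDiffAt 𝓘(ℝ, ℝ × E) (𝓘(ℝ, ℝ).prod 𝓘(ℝ, E)) ∞
      (fun q : ℝ × E => (q.1, (extChartAt 𝓘(ℝ, E) x₀).symm q.2)) (t, y) :=
    ContMDiffAt.prodMk (contDiff_fst.contMDiff.contMDiffAt)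
      (h1.comp (t, y) contDiff_snd.contMDiff.contMDiffAt)
  exact hH.contMDiffAt.comp (t, y) h2

variable [FiniteDimensional ℝ E]

/-- The map `b ↦ Ω(·, b)` is invertible at each point of a chart. -/
theorem isInvertible_flip_chartForm (Ω : SymplecticForm E M) (x₀ : M) {y : E}
    (hy : y ∈ (extChartAt 𝓘(ℝ, E) x₀).target) : (Ω.chartForm x₀ y).flip.IsInvertible := by
  have hinj : Function.Injective (Ω.chartForm x₀ y).flip := by
    rw [injective_iff_map_eq_zero]
    intro b hb
    have h1 : mfderiv 𝓘(ℝ, E) 𝓘(ℝ, E) (extChartAt 𝓘(ℝ, E) x₀).symm y b = 0 := by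
      refine Ω.nondegenerate _ _ fun w => ?_
      rw [← bilin_apply, ← mfderiv_symm_mfderiv_extChartAt x₀ hy w]
      have h2 := chartForm_apply Ω x₀ y b
        (mfderiv 𝓘(ℝ, E) 𝓘(ℝ, E) (extChartAt 𝓘(ℝ, E) x₀) ((extChartAt 𝓘(ℝ, E) x₀).symm y) w)
      refine h2.symm.trans ((chartForm_swap Ω x₀ y b _).trans ?_)
      exact neg_eq_zero.2 (DFunLike.congr_fun hb _)
    rw [← mfderiv_mfderiv_symm_extChartAt x₀ hy b, h1]
    exact map_zero _
  have hrank : Module.finrank ℝ E = Module.finrank ℝ (E →L[ℝ] ℝ) := by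
    rw [← (LinearMap.toContinuousLinearMap (𝕜 := ℝ) (E := E) (F' := ℝ)).finrank_eq]
    exact (Subspace.dual_finrank_eq (K := ℝ) (V := E)).symm
  exact ⟨(LinearEquiv.ofInjectiveOfFinrankEq (Ω.chartForm x₀ y).flip.toLinearMap hinj
    hrank).toContinuousLinearEquiv, ContinuousLinearMap.ext fun _ => rfl⟩

/-- The Hamiltonian vector field of `H t` in the chart at `x₀`, as a function of `(t, y)`. -/
noncomputable def chartHamiltonianField (Ω : SymplecticForm E M) (H : ℝ → M → ℝ) (x₀ : M)
    (q : ℝ × E) : E :=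
  (Ω.chartForm x₀ q.2).flip.inverse
    (fderiv ℝ (fun y => H q.1 ((extChartAt 𝓘(ℝ, E) x₀).symm y)) q.2)

theorem chartForm_chartHamiltonianField (Ω : SymplecticForm E M) (H : ℝ → M → ℝ) (x₀ : M)
    (t : ℝ) {y : E} (hy : y ∈ (extChartAt 𝓘(ℝ, E) x₀).target) (a : E) :
    Ω.chartForm x₀ y a (Ω.chartHamiltonianField H x₀ (t, y)) =
      fderiv ℝ (fun y => H t ((extChartAt 𝓘(ℝ, E) x₀).symm y)) y a := by
  obtain ⟨L, hL⟩ := Ω.isInvertible_flip_chartForm x₀ hy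
  rw [chartHamiltonianField, ← ContinuousLinearMap.flip_apply]
  simp only
  rw [← hL, ContinuousLinearMap.inverse_equiv]
  simp

theorem contDiffAt_chartHamiltonianField (Ω : SymplecticForm E M) {H : ℝ → M → ℝ}
    (hH : ContMDiff (𝓘(ℝ, ℝ).prod 𝓘(ℝ, E)) 𝓘(ℝ, ℝ) ∞ (fun p : ℝ × M => H p.1 p.2))
    (x₀ : M) (t : ℝ) {y : E} (hy : y ∈ (extChartAt 𝓘(ℝ, E) x₀).target) :
    ContDiffAt ℝ ∞ (Ω.chartHamiltonianField H x₀) (t, y) := by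
  have : CompleteSpace E := FiniteDimensional.complete ℝ E
  refine ContDiffAt.clm_apply ?_ ?_
  · obtain ⟨L, hL⟩ := Ω.isInvertible_flip_chartForm x₀ hy
    have h1 : ContDiffAt ℝ ∞ (fun q : ℝ × E => (Ω.chartForm x₀ q.2).flip) (t, y) := by
      have h2 : ContDiffAt ℝ ∞ (Ω.chartForm x₀) y :=
        (Ω.contDiffOn_chartForm x₀).contDiffAt ((isOpen_extChartAt_target x₀).mem_nhds hy)
      exact (LinearIsometryEquiv.contDiff (E := E →L[ℝ] E →L[ℝ] ℝ) (F := E →L[ℝ] E →L[ℝ] ℝ)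
        (ContinuousLinearMap.flipₗᵢ ℝ E E ℝ)).contDiffAt.comp (t, y)
        (h2.comp (t, y) contDiffAt_snd)
    have h3 := contDiffAt_map_inverse (𝕜 := ℝ) (n := ∞) L
    rw [hL] at h3
    exact h3.comp (t, y) h1
  · refine ContDiffAt.fderiv (n := ∞) (m := ∞)
      (f := fun (q : ℝ × E) y => H q.1 ((extChartAt 𝓘(ℝ, E) x₀).symm y)) ?_ contDiffAt_snd
      (by simp)
    exact (contDiffAt_hamiltonian_chart hH x₀ t hy).comp ((t, y), y)
      ((contDiffAt_fst.comp _ contDiffAt_fst).prodMk contDiffAt_snd)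

/-- The Hamiltonian vector field read in a chart. -/
theorem mfderiv_extChartAt_hamiltonianVectorField (Ω : SymplecticForm E M) {H : ℝ → M → ℝ}
    (t : ℝ) (hH : MDifferentiable 𝓘(ℝ, E) 𝓘(ℝ, ℝ) (H t)) (x₀ : M) {x : M}
    (hx : x ∈ (extChartAt 𝓘(ℝ, E) x₀).source) :
    (mfderiv 𝓘(ℝ, E) 𝓘(ℝ, E) (extChartAt 𝓘(ℝ, E) x₀) x (Ω.hamiltonianVectorField (H t) x) : E) =
      Ω.chartHamiltonianField H x₀ (t, extChartAt 𝓘(ℝ, E) x₀ x) := by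
  have : IsManifold 𝓘(ℝ, E) 1 M := IsManifold.of_le (n := ∞) (by simp)
  obtain ⟨y, hy, rfl⟩ : ∃ y ∈ (extChartAt 𝓘(ℝ, E) x₀).target,
      (extChartAt 𝓘(ℝ, E) x₀).symm y = x :=
    ⟨_, (extChartAt 𝓘(ℝ, E) x₀).map_source hx, (extChartAt 𝓘(ℝ, E) x₀).left_inv hx⟩
  rw [(extChartAt 𝓘(ℝ, E) x₀).right_inv hy]
  obtain ⟨L, hL⟩ := Ω.isInvertible_flip_chartForm x₀ hy
  refine L.injective (ContinuousLinearMap.ext fun a => ?_)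
  have h1 : ∀ z, L z a = Ω.chartForm x₀ y a z := fun z => by
    rw [← ContinuousLinearMap.flip_apply, ← hL]; rfl
  refine (h1 _).trans (Eq.trans ?_ (h1 _).symm)
  refine Eq.trans ?_ (chartForm_chartHamiltonianField Ω H x₀ t hy a).symm
  refine (chartForm_apply ..).trans ?_
  have h2 := mfderiv_symm_mfderiv_extChartAt x₀ hy
    (Ω.hamiltonianVectorField (H t) ((extChartAt 𝓘(ℝ, E) x₀).symm y))
  refine (congrArg (Ω.bilin ((extChartAt 𝓘(ℝ, E) x₀).symm y)
    (mfderiv 𝓘(ℝ, E) 𝓘(ℝ, E) (extChartAt 𝓘(ℝ, E) x₀).symm y a)) h2).trans ?_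
  refine (bilin_hamiltonianVectorField ..).trans ?_
  have h3 : MDifferentiableAt 𝓘(ℝ, E) 𝓘(ℝ, E) (extChartAt 𝓘(ℝ, E) x₀).symm y := by
    have := mdifferentiableWithinAt_extChartAt_symm hy
    rwa [ModelWithCorners.range_eq_univ, mdifferentiableWithinAt_univ] at this
  have h4 := DFunLike.congr_fun (mfderiv_comp y (hH _) h3) a
  rw [mfderiv_eq_fderiv] at h4
  exact h4.symm

/-- The Hamiltonian vector fields of a smooth time-dependent function depend smoothly on time and
position. -/
theorem contMDiff_hamiltonianVectorField (Ω : SymplecticForm E M) {H : ℝ → M → ℝ}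
    (hH : ContMDiff (𝓘(ℝ, ℝ).prod 𝓘(ℝ, E)) 𝓘(ℝ, ℝ) ∞ (fun p : ℝ × M => H p.1 p.2)) :
    ContMDiff (𝓘(ℝ, ℝ).prod 𝓘(ℝ, E)) 𝓘(ℝ, E).tangent ∞ (fun p : ℝ × M =>
      (⟨p.2, Ω.hamiltonianVectorField (H p.1) p.2⟩ : TangentBundle 𝓘(ℝ, E) M)) := by
  rintro ⟨t, x₀⟩
  have hd (t : ℝ) : MDifferentiable 𝓘(ℝ, E) 𝓘(ℝ, ℝ) (H t) :=
    (hH.comp (contMDiff_const.prodMk contMDiff_id)).mdifferentiable (by simp)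
  rw [contMDiffAt_tangentBundle_iff (g := fun p : ℝ × M => p.2) (x₀ := x₀)
    (mem_chart_source E x₀)]
  refine ⟨contMDiffAt_snd, ?_⟩
  have h1 : ContMDiffAt (𝓘(ℝ, ℝ).prod 𝓘(ℝ, E)) 𝓘(ℝ, ℝ × E) ∞
      (fun p : ℝ × M => (p.1, extChartAt 𝓘(ℝ, E) x₀ p.2)) (t, x₀) :=
    ContMDiffAt.prodMk_space contMDiffAt_fst (contMDiffAt_extChartAt.comp (t, x₀) contMDiffAt_snd)
  have h2 := ((contMDiffAt_iff_contDiffAt.2 (Ω.contDiffAt_chartHamiltonianField hH x₀ t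
    (mem_extChartAt_target x₀))).comp (t, x₀) h1)
  refine h2.congr_of_eventuallyEq ?_
  filter_upwards [continuousAt_snd.preimage_mem_nhds (extChartAt_source_mem_nhds (I := 𝓘(ℝ, E)) x₀)]
    with p hp
  exact Ω.mfderiv_extChartAt_hamiltonianVectorField p.1 (hd p.1) x₀ hp

end SymplecticForm

end Charts

/-! ### Invariance of a closed form under a Hamiltonian evolution, in a vector space -/

section PullbackDerivative

open Set Filter Topology

variable {E : Type*} [NormedAddCommGroup E] [NormedSpace ℝ E]

/-- The infinitesimal form of the invariance of a closed 2-form `B` under a Hamiltonian evolution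
`g`, in a vector space. The derivative of the pullback is the sum of the derivative of `B` along
`Y` and of two terms with the linearization of `Y`; the symmetry of the second derivative of the
Hamiltonian `h` turns these into derivatives of `B`, and closedness makes the total vanish. -/
theorem hasDerivAt_pullback_form_eq_zero {B : E → E →L[ℝ] E →L[ℝ] ℝ} {g Y : ℝ × E → E}
    {h : E → ℝ} {t₀ : ℝ} {y₀ : E} (hB : DifferentiableAt ℝ B (g (t₀, y₀)))
    (hskew : ∀ y a b, B y a b = - B y b a)
    (hcyc : ∀ a b c, fderiv ℝ B (g (t₀, y₀)) a b c - fderiv ℝ B (g (t₀, y₀)) b a c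
      + fderiv ℝ B (g (t₀, y₀)) c a b = 0)
    (hg : ContDiffAt ℝ 2 g (t₀, y₀)) (hY : DifferentiableAt ℝ Y (t₀, g (t₀, y₀)))
    (hgt : ∀ᶠ q in 𝓝 (t₀, y₀), fderiv ℝ g q (1, 0) = Y (q.1, g q))
    (hh : ContDiffAt ℝ 2 h (g (t₀, y₀)))
    (hhY : ∀ᶠ y in 𝓝 (g (t₀, y₀)), ∀ a, B y a (Y (t₀, y)) = fderiv ℝ h y a) (u w : E) :
    HasDerivAt (fun t => B (g (t, y₀)) (fderiv ℝ g (t, y₀) (0, u)) (fderiv ℝ g (t, y₀) (0, w)))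
      0 t₀ := by
  set p := g (t₀, y₀) with hp
  set Dg := fderiv ℝ g (t₀, y₀) with hDg
  set A : E → E := fun a => fderiv ℝ Y (t₀, p) (0, a) with hA
  have hgd : HasFDerivAt g Dg (t₀, y₀) := (hg.differentiableAt (by simp)).hasFDerivAt
  have hline : HasDerivAt (fun t : ℝ => (t, y₀)) ((1 : ℝ), (0 : E)) t₀ :=
    (hasDerivAt_id t₀).prodMk (hasDerivAt_const t₀ y₀)
  have hg1 : HasDerivAt (fun t => g (t, y₀)) (Y (t₀, p)) t₀ :=
    (hgd.comp_hasDerivAt t₀ hline).congr_deriv hgt.self_of_nhds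
  have hD2 : DifferentiableAt ℝ (fderiv ℝ g) (t₀, y₀) :=
    (hg.fderiv_right (m := 1) (by norm_num)).differentiableAt (by simp)
  have hsymm := (hg.isSymmSndFDerivAt (by simp)).eq
  -- commuting `∂_t` with the derivative in space
  have hslice (u : E) : HasDerivAt (fun t => fderiv ℝ g (t, y₀) (0, u)) (A (Dg (0, u))) t₀ := by
    have h0 : HasDerivAt (fun t => fderiv ℝ g (t, y₀))
        (fderiv ℝ (fderiv ℝ g) (t₀, y₀) (1, 0)) t₀ :=
      HasFDerivAt.comp_hasDerivAt (l := fderiv ℝ g) t₀ hD2.hasFDerivAt hline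
    refine (h0.clm_apply (hasDerivAt_const t₀ ((0 : ℝ), u))).congr_deriv ?_
    rw [map_zero, add_zero, hsymm (1, 0) (0, u)]
    have h2 : HasFDerivAt (fun q : ℝ × E => fderiv ℝ g q (1, 0))
        ((fderiv ℝ Y (t₀, p)).comp ((ContinuousLinearMap.fst ℝ ℝ E).prod Dg)) (t₀, y₀) :=
      (HasFDerivAt.comp (t₀, y₀) hY.hasFDerivAt
        (hasFDerivAt_fst.prodMk hgd)).congr_of_eventuallyEq hgt
    have h3 := (hD2.hasFDerivAt.clm_apply (hasFDerivAt_const ((1 : ℝ), (0 : E)) (t₀, y₀))).unique h2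
    have h4 := DFunLike.congr_fun h3 (0, u)
    simpa using h4
  set y := Y (t₀, p) with hy
  set U := Dg (0, u)
  set W := Dg (0, w)
  -- the linearization of `B(·, Y) = dh`
  have hlin (a b : E) : fderiv ℝ B p b a y + B p a (A b) = fderiv ℝ (fderiv ℝ h) p b a := by
    have hYp : HasFDerivAt (fun y => Y (t₀, y))
        ((fderiv ℝ Y (t₀, p)).comp (ContinuousLinearMap.inr ℝ ℝ E)) p :=
      hY.hasFDerivAt.comp p (hasFDerivAt_prodMk_right t₀ p)
    have h1 := (hB.hasFDerivAt.clm_apply (hasFDerivAt_const a p)).clm_apply hYp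
    have h2 : DifferentiableAt ℝ (fderiv ℝ h) p :=
      (hh.fderiv_right (m := 1) (by norm_num)).differentiableAt (by simp)
    have h3 := h2.hasFDerivAt.clm_apply (hasFDerivAt_const a p)
    have h4 := DFunLike.congr_fun
      (h1.unique (h3.congr_of_eventuallyEq (hhY.mono fun y hy => hy a))) b
    simpa [add_comm, hA] using h4
  have hskew' (a b c : E) : fderiv ℝ B p a b c = - fderiv ℝ B p a c b := by
    have h1 := (hB.hasFDerivAt.clm_apply (hasFDerivAt_const b p)).clm_apply (hasFDerivAt_const c p)
    have h2 := (hB.hasFDerivAt.clm_apply (hasFDerivAt_const c p)).clm_apply (hasFDerivAt_const b p)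
    have h3 := DFunLike.congr_fun (h1.unique (h2.neg.congr_of_eventuallyEq
      (Eventually.of_forall fun y => hskew y b c))) a
    simpa using h3
  have hhs := (hh.isSymmSndFDerivAt (by simp)).eq U W
  have hmain : fderiv ℝ B p y U W + B p (A U) W + B p U (A W) = 0 := by
    have h1 := hlin U W
    have h2 := hlin W U
    have h3 := hcyc y U W
    have h4 := hskew' U y W
    have h5 := hskew' W y U
    have h6 := hskew p (A U) W
    linarith
  have hBg : HasDerivAt (fun t => B (g (t, y₀))) (fderiv ℝ B p y) t₀ :=
    HasFDerivAt.comp_hasDerivAt (l := B) t₀ hB.hasFDerivAt hg1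
  refine ((hBg.clm_apply (hslice u)).clm_apply (hslice w)).congr_deriv ?_
  simpa using hmain

end PullbackDerivative

/-! ### Hamiltonian evolutions -/

section HamiltonianEvolution

open Set Filter Topology

variable {E : Type*} [NormedAddCommGroup E] [NormedSpace ℝ E]
  {M : Type*} [TopologicalSpace M] [ChartedSpace E M]

/-- `H` is a smooth function on `ℝ × M` that vanishes for times outside `[0, 1]` and outside a
compact subset of `M`. Unlike Hamiltonians on `[0, 1] × M`, such functions can be concatenated
without loss of smoothness. -/
structure IsFlatHamiltonian (E : Type*) [NormedAddCommGroup E] [NormedSpace ℝ E]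
    {M : Type*} [TopologicalSpace M] [ChartedSpace E M] (H : ℝ → M → ℝ) : Prop where
  smooth : ContMDiff (𝓘(ℝ, ℝ).prod 𝓘(ℝ, E)) 𝓘(ℝ, ℝ) ∞ (fun p : ℝ × M => H p.1 p.2)
  support : ∃ K : Set M, IsCompact K ∧ ∀ t x, t ∉ Icc (0 : ℝ) 1 ∨ x ∉ K → H t x = 0

theorem IsFlatHamiltonian.contMDiff_time {H : ℝ → M → ℝ} (hH : IsFlatHamiltonian E H) (t : ℝ) :
    ContMDiff 𝓘(ℝ, E) 𝓘(ℝ, ℝ) ∞ (H t) :=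
  hH.smooth.comp (contMDiff_const.prodMk contMDiff_id)

theorem IsFlatHamiltonian.mdifferentiable {H : ℝ → M → ℝ} (hH : IsFlatHamiltonian E H) (t : ℝ) :
    MDifferentiable 𝓘(ℝ, E) 𝓘(ℝ, ℝ) (H t) :=
  (hH.contMDiff_time t).mdifferentiable (by simp)

theorem isFlatHamiltonian_zero : IsFlatHamiltonian E (fun (_ : ℝ) (_ : M) => (0 : ℝ)) where
  smooth := contMDiff_const
  support := ⟨∅, isCompact_empty, fun _ _ _ => rfl⟩

theorem IsFlatHamiltonian.add {H K : ℝ → M → ℝ} (hH : IsFlatHamiltonian E H)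
    (hK : IsFlatHamiltonian E K) : IsFlatHamiltonian E (fun t x => H t x + K t x) where
  smooth := hH.smooth.add hK.smooth
  support := by
    obtain ⟨A, hA, hA'⟩ := hH.support
    obtain ⟨B, hB, hB'⟩ := hK.support
    refine ⟨A ∪ B, hA.union hB, fun t x h => ?_⟩
    rw [hA' t x (h.imp_right fun h hx => h (Or.inl hx)),
      hB' t x (h.imp_right fun h hx => h (Or.inr hx)), add_zero]

namespace SymplecticForm

variable [FiniteDimensional ℝ E]

theorem hamiltonianVectorField_eq (Ω : SymplecticForm E M) {h : M → ℝ} {x : M}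
    {X : TangentSpace 𝓘(ℝ, E) x}
    (hX : ∀ v, Ω.bilin x v X = (mfderiv 𝓘(ℝ, E) 𝓘(ℝ, ℝ) h x v : ℝ)) :
    Ω.hamiltonianVectorField h x = X :=
  (Ω.existsUnique_hamiltonianVector h x).unique (Ω.bilin_hamiltonianVectorField h x) hX

theorem hamiltonianVectorField_congr (Ω : SymplecticForm E M) {h k : M → ℝ} {x : M}
    (hhk : h =ᶠ[𝓝 x] k) : Ω.hamiltonianVectorField h x = Ω.hamiltonianVectorField k x := by
  refine Ω.hamiltonianVectorField_eq fun v => ?_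
  rw [bilin_hamiltonianVectorField]
  exact (DFunLike.congr_fun (hhk.mfderiv_eq (I := 𝓘(ℝ, E)) (I' := 𝓘(ℝ, ℝ))) v).symm

theorem hamiltonianVectorField_eq_smul (Ω : SymplecticForm E M) {h k : M → ℝ} {x : M} {c : ℝ}
    (hhk : HasMFDerivAt 𝓘(ℝ, E) 𝓘(ℝ, ℝ) k x
      (c • (mfderiv 𝓘(ℝ, E) 𝓘(ℝ, ℝ) h x : E →L[ℝ] ℝ) : E →L[ℝ] ℝ)) :
    Ω.hamiltonianVectorField k x = c • Ω.hamiltonianVectorField h x := by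
  refine Ω.hamiltonianVectorField_eq fun v => ?_
  rw [map_smul, bilin_hamiltonianVectorField]
  exact (DFunLike.congr_fun hhk.mfderiv v).symm

theorem hamiltonianVectorField_const_mul (Ω : SymplecticForm E M) {h : M → ℝ} {x : M} (c : ℝ)
    (hh : MDifferentiableAt 𝓘(ℝ, E) 𝓘(ℝ, ℝ) h x) :
    Ω.hamiltonianVectorField (fun x => c * h x) x = c • Ω.hamiltonianVectorField h x :=
  Ω.hamiltonianVectorField_eq_smul (hh.hasMFDerivAt.const_smul c)

theorem hamiltonianVectorField_zero (Ω : SymplecticForm E M) (x : M) :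
    Ω.hamiltonianVectorField (fun _ => 0) x = 0 :=
  Ω.hamiltonianVectorField_eq fun v => by
    rw [map_zero]
    exact (DFunLike.congr_fun (mfderiv_const (I := 𝓘(ℝ, E)) (I' := 𝓘(ℝ, ℝ)) (c := (0 : ℝ))) v).symm

theorem hamiltonianVectorField_eq_zero [T2Space M] (Ω : SymplecticForm E M) {H : ℝ → M → ℝ}
    {K : Set M} (hK : IsCompact K) (hHK : ∀ t x, t ∉ Icc (0 : ℝ) 1 ∨ x ∉ K → H t x = 0) (t : ℝ)
    (x : M) (h : t ∉ Icc (0 : ℝ) 1 ∨ x ∉ K) : Ω.hamiltonianVectorField (H t) x = 0 := by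
  refine (Ω.hamiltonianVectorField_congr ?_).trans (Ω.hamiltonianVectorField_zero x)
  rcases h with h | h
  · exact Eventually.of_forall fun y => hHK t y (Or.inl h)
  · filter_upwards [hK.isClosed.isOpen_compl.mem_nhds h] with y hy
    exact hHK t y (Or.inr hy)

variable [IsManifold 𝓘(ℝ, E) ∞ M] [T2Space M]

theorem exists_hamiltonian_evolution (Ω : SymplecticForm E M) {H : ℝ → M → ℝ}
    (hH : IsFlatHamiltonian E H) :
    ∃ Φ : ℝ → ℝ → M → M,
      ContMDiff (𝓘(ℝ, ℝ).prod (𝓘(ℝ, ℝ).prod 𝓘(ℝ, E))) 𝓘(ℝ, E) ∞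
        (fun p : ℝ × ℝ × M => Φ p.1 p.2.1 p.2.2) ∧
      (∀ s x, Φ s s x = x) ∧
      ∀ s t x, HasMFDerivAt 𝓘(ℝ, ℝ) 𝓘(ℝ, E) (fun t => Φ s t x) t
        ((1 : ℝ →L[ℝ] ℝ).smulRight (Ω.hamiltonianVectorField (H t) (Φ s t x))) := by
  obtain ⟨K, hK, hHK⟩ := hH.support
  exact exists_evolution (Ω.contMDiff_hamiltonianVectorField hH.smooth) hK
    (Ω.hamiltonianVectorField_eq_zero hK hHK)

open Classical in
/-- The evolution `Φ s t` of the Hamiltonian vector fields of `H`, from time `s` to time `t`. By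
convention it is the identity if `H` is not a flat Hamiltonian. -/
noncomputable def evolution (Ω : SymplecticForm E M) (H : ℝ → M → ℝ) : ℝ → ℝ → M → M :=
  if hH : IsFlatHamiltonian E H then (Ω.exists_hamiltonian_evolution hH).choose
  else fun _ _ x => x

variable (Ω : SymplecticForm E M)

theorem evolution_spec {H : ℝ → M → ℝ} (hH : IsFlatHamiltonian E H) :
    ContMDiff (𝓘(ℝ, ℝ).prod (𝓘(ℝ, ℝ).prod 𝓘(ℝ, E))) 𝓘(ℝ, E) ∞
        (fun p : ℝ × ℝ × M => Ω.evolution H p.1 p.2.1 p.2.2) ∧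
      (∀ s x, Ω.evolution H s s x = x) ∧
      ∀ s t x, HasMFDerivAt 𝓘(ℝ, ℝ) 𝓘(ℝ, E) (fun t => Ω.evolution H s t x) t
        ((1 : ℝ →L[ℝ] ℝ).smulRight (Ω.hamiltonianVectorField (H t) (Ω.evolution H s t x))) := by
  rw [evolution, dif_pos hH]
  exact (Ω.exists_hamiltonian_evolution hH).choose_spec

theorem evolution_self {H : ℝ → M → ℝ} (hH : IsFlatHamiltonian E H) (s : ℝ) (x : M) :
    Ω.evolution H s s x = x :=
  (Ω.evolution_spec hH).2.1 s x

theorem hasMFDerivAt_evolution {H : ℝ → M → ℝ} (hH : IsFlatHamiltonian E H) (s t : ℝ) (x : M) :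
    HasMFDerivAt 𝓘(ℝ, ℝ) 𝓘(ℝ, E) (fun t => Ω.evolution H s t x) t
      ((1 : ℝ →L[ℝ] ℝ).smulRight (Ω.hamiltonianVectorField (H t) (Ω.evolution H s t x))) :=
  (Ω.evolution_spec hH).2.2 s t x

theorem contMDiff_evolution_from {H : ℝ → M → ℝ} (hH : IsFlatHamiltonian E H) (s : ℝ) :
    ContMDiff (𝓘(ℝ, ℝ).prod 𝓘(ℝ, E)) 𝓘(ℝ, E) ∞ (fun p : ℝ × M => Ω.evolution H s p.1 p.2) :=
  (Ω.evolution_spec hH).1.comp (contMDiff_const.prodMk contMDiff_id)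

theorem contMDiff_evolution {H : ℝ → M → ℝ} (hH : IsFlatHamiltonian E H) (s t : ℝ) :
    ContMDiff 𝓘(ℝ, E) 𝓘(ℝ, E) ∞ (Ω.evolution H s t) :=
  (Ω.contMDiff_evolution_from hH s).comp (contMDiff_const.prodMk contMDiff_id)

/-- Integral curves are determined by their value at one time. -/
theorem eq_of_integralCurve {H : ℝ → M → ℝ} (hH : IsFlatHamiltonian E H) {γ γ' : ℝ → M} {s : ℝ}
    (hγ : ∀ t, HasMFDerivAt 𝓘(ℝ, ℝ) 𝓘(ℝ, E) γ t
      ((1 : ℝ →L[ℝ] ℝ).smulRight (Ω.hamiltonianVectorField (H t) (γ t))))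
    (hγ' : ∀ t, HasMFDerivAt 𝓘(ℝ, ℝ) 𝓘(ℝ, E) γ' t
      ((1 : ℝ →L[ℝ] ℝ).smulRight (Ω.hamiltonianVectorField (H t) (γ' t))))
    (h : γ s = γ' s) (t : ℝ) : γ t = γ' t := by
  have : CompleteSpace E := FiniteDimensional.complete ℝ E
  refine eqOn_of_hasMFDerivAt_timeDependent (a := min s t - 1) (b := max s t + 1) (t₀ := s)
    (Ω.contMDiff_hamiltonianVectorField hH.smooth) ?_ (fun t _ => hγ t) (fun t _ => hγ' t) h ?_
  · exact ⟨by linarith [min_le_left s t], by linarith [le_max_left s t]⟩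
  · exact ⟨by linarith [min_le_right s t], by linarith [le_max_right s t]⟩

theorem evolution_eq_of_integralCurve {H : ℝ → M → ℝ} (hH : IsFlatHamiltonian E H) {γ : ℝ → M}
    (hγ : ∀ t, HasMFDerivAt 𝓘(ℝ, ℝ) 𝓘(ℝ, E) γ t
      ((1 : ℝ →L[ℝ] ℝ).smulRight (Ω.hamiltonianVectorField (H t) (γ t)))) (s t : ℝ) :
    Ω.evolution H s t (γ s) = γ t :=
  Ω.eq_of_integralCurve hH (fun t => Ω.hasMFDerivAt_evolution hH s t (γ s)) hγ
    (Ω.evolution_self hH s (γ s)) t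

theorem evolution_evolution {H : ℝ → M → ℝ} (hH : IsFlatHamiltonian E H) (s t u : ℝ) (x : M) :
    Ω.evolution H t u (Ω.evolution H s t x) = Ω.evolution H s u x :=
  Ω.evolution_eq_of_integralCurve hH (fun t => Ω.hasMFDerivAt_evolution hH s t x) t u

/-- A continuous curve on `[a, b]` that is an integral curve on `(a, b)` is a piece of the
evolution. -/
theorem evolution_eq_of_integralCurveOn {H : ℝ → M → ℝ} (hH : IsFlatHamiltonian E H) {γ : ℝ → M}
    {a b : ℝ} (hab : a < b) (hc : ContinuousOn γ (Icc a b))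
    (hγ : ∀ t ∈ Ioo a b, HasMFDerivAt 𝓘(ℝ, ℝ) 𝓘(ℝ, E) γ t
      ((1 : ℝ →L[ℝ] ℝ).smulRight (Ω.hamiltonianVectorField (H t) (γ t)))) {s t : ℝ}
    (hs : s ∈ Icc a b) (ht : t ∈ Icc a b) : Ω.evolution H s t (γ s) = γ t := by
  have : CompleteSpace E := FiniteDimensional.complete ℝ E
  have hm : (a + b) / 2 ∈ Ioo a b := ⟨by linarith, by linarith⟩
  set m := (a + b) / 2
  have h1 : EqOn γ (fun t => Ω.evolution H m t (γ m)) (Ioo a b) :=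
    eqOn_of_hasMFDerivAt_timeDependent (Ω.contMDiff_hamiltonianVectorField hH.smooth) hm hγ
      (fun t _ => Ω.hasMFDerivAt_evolution hH m t (γ m)) (Ω.evolution_self hH m (γ m)).symm
  have h2 : ContinuousOn (fun t => Ω.evolution H m t (γ m)) (Icc a b) := fun t _ =>
    (Ω.hasMFDerivAt_evolution hH m t (γ m)).continuousAt.continuousWithinAt
  have h3 : EqOn γ (fun t => Ω.evolution H m t (γ m)) (Icc a b) :=
    h1.of_subset_closure hc h2 Ioo_subset_Icc_self (closure_Ioo hab.ne).ge
  rw [h3 hs, h3 ht]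
  exact Ω.evolution_evolution hH m s t (γ m)

/-- The evolution from time `s` to time `t`, as a diffeomorphism. -/
noncomputable def evolutionDiffeo {H : ℝ → M → ℝ} (hH : IsFlatHamiltonian E H) (s t : ℝ) :
    M ≃ₘ^∞⟮𝓘(ℝ, E), 𝓘(ℝ, E)⟯ M where
  toFun := Ω.evolution H s t
  invFun := Ω.evolution H t s
  left_inv x := (Ω.evolution_evolution hH s t s x).trans (Ω.evolution_self hH s x)
  right_inv x := (Ω.evolution_evolution hH t s t x).trans (Ω.evolution_self hH t x)
  contMDiff_toFun := Ω.contMDiff_evolution hH s t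
  contMDiff_invFun := Ω.contMDiff_evolution hH t s

end SymplecticForm

end HamiltonianEvolution

/-! ### Invariance of the symplectic form -/

section Symplectic

open Set Filter Topology

variable {E : Type*} [NormedAddCommGroup E] [NormedSpace ℝ E]
  {M : Type*} [TopologicalSpace M] [ChartedSpace E M]

namespace SymplecticForm

/-- `g` preserves the symplectic form. -/
def IsSymplectic (Ω : SymplecticForm E M) (g : M → M) : Prop :=
  ∀ (x : M) (u w : TangentSpace 𝓘(ℝ, E) x),
    Ω.bilin (g x) (mfderiv 𝓘(ℝ, E) 𝓘(ℝ, E) g x u) (mfderiv 𝓘(ℝ, E) 𝓘(ℝ, E) g x w) =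
      Ω.bilin x u w

variable [FiniteDimensional ℝ E] [IsManifold 𝓘(ℝ, E) ∞ M] [T2Space M]

/-- The pullback of the symplectic form by a Hamiltonian evolution does not depend on time. -/
theorem hasDerivAt_bilin_evolution (Ω : SymplecticForm E M) {H : ℝ → M → ℝ}
    (hH : IsFlatHamiltonian E H) (s t₀ : ℝ) (x : M) (u w : TangentSpace 𝓘(ℝ, E) x) :
    HasDerivAt (fun t => Ω.bilin (Ω.evolution H s t x)
      (mfderiv 𝓘(ℝ, E) 𝓘(ℝ, E) (Ω.evolution H s t) x u)
      (mfderiv 𝓘(ℝ, E) 𝓘(ℝ, E) (Ω.evolution H s t) x w)) 0 t₀ := by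
  have : IsManifold 𝓘(ℝ, E) 1 M := IsManifold.of_le (n := ∞) (by simp)
  have h2 : (2 : WithTop ℕ∞) ≤ ∞ := WithTop.coe_le_coe.2 (le_top : (2 : ℕ∞) ≤ ⊤)
  set Φ := Ω.evolution H s with hΦ
  have hΦs : ContMDiff (𝓘(ℝ, ℝ).prod 𝓘(ℝ, E)) 𝓘(ℝ, E) ∞ (fun p : ℝ × M => Φ p.1 p.2) :=
    Ω.contMDiff_evolution_from hH s
  have hΦt (t : ℝ) : ContMDiff 𝓘(ℝ, E) 𝓘(ℝ, E) ∞ (Φ t) := Ω.contMDiff_evolution hH s t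
  set e' := extChartAt 𝓘(ℝ, E) x with he'
  set z := Φ t₀ x with hz
  set e := extChartAt 𝓘(ℝ, E) z with he
  set y₀ : E := e' x with hy₀
  have hx : x ∈ e'.source := mem_extChartAt_source x
  have hy₀' : y₀ ∈ e'.target := mem_extChartAt_target x
  have hxy : e'.symm y₀ = x := e'.left_inv hx
  set g : ℝ × E → E := fun q => e (Φ q.1 (e'.symm q.2)) with hg
  have hgz : g (t₀, y₀) = e z := by rw [hg]; simp only [hxy, hz]
  have hmap : ContMDiffAt 𝓘(ℝ, ℝ × E) 𝓘(ℝ, E) ∞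
      (fun q : ℝ × E => Φ q.1 (e'.symm q.2)) (t₀, y₀) := by
    have h1 : ContMDiffAt 𝓘(ℝ, E) 𝓘(ℝ, E) ∞ e'.symm y₀ :=
      (contMDiffOn_extChartAt_symm x y₀ hy₀').contMDiffAt
        ((isOpen_extChartAt_target x).mem_nhds hy₀')
    exact hΦs.contMDiffAt.comp (t₀, y₀) (ContMDiffAt.prodMk
      (contDiff_fst.contMDiff.contMDiffAt) (h1.comp (t₀, y₀) contDiff_snd.contMDiff.contMDiffAt))
  have hzz : Φ t₀ (e'.symm y₀) = z := by rw [hxy]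
  have hsrc : ∀ᶠ q : ℝ × E in 𝓝 (t₀, y₀), Φ q.1 (e'.symm q.2) ∈ e.source := by
    refine hmap.continuousAt.preimage_mem_nhds ?_
    rw [hzz]
    exact extChartAt_source_mem_nhds z
  have hgs : ContDiffAt ℝ ∞ g (t₀, y₀) := by
    rw [← contMDiffAt_iff_contDiffAt]
    have h1 : ContMDiffAt 𝓘(ℝ, E) 𝓘(ℝ, E) ∞ e (Φ t₀ (e'.symm y₀)) := by
      rw [hzz]; exact contMDiffAt_extChartAt
    exact h1.comp (t₀, y₀) hmap
  have hgdiff : ∀ᶠ q in 𝓝 (t₀, y₀), DifferentiableAt ℝ g q :=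
    ((hgs.of_le (m := 1) (by simp)).eventually (by simp)).mono fun q hq =>
      hq.differentiableAt (by simp)
  have hdown : Continuous (fun t : ℝ => (t, y₀)) := by fun_prop
  have hslice (u : TangentSpace 𝓘(ℝ, E) x) : ∀ᶠ t in 𝓝 t₀,
      (mfderiv 𝓘(ℝ, E) 𝓘(ℝ, E) e (Φ t x) (mfderiv 𝓘(ℝ, E) 𝓘(ℝ, E) (Φ t) x u) : E) =
        fderiv ℝ g (t, y₀) (0, (mfderiv 𝓘(ℝ, E) 𝓘(ℝ, E) e' x u : E)) := by
    filter_upwards [hdown.continuousAt.eventually hgdiff, hdown.continuousAt.eventually hsrc]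
      with t ht hts
    replace hts : Φ t x ∈ e.source := by rwa [hxy] at hts
    have h1 : HasMFDerivAt 𝓘(ℝ, E) 𝓘(ℝ, E) e (Φ t x) (mfderiv 𝓘(ℝ, E) 𝓘(ℝ, E) e (Φ t x)) :=
      (mdifferentiableAt_extChartAt (by rwa [← extChartAt_source 𝓘(ℝ, E)])).hasMFDerivAt
    have h2 : HasMFDerivAt 𝓘(ℝ, E) 𝓘(ℝ, E) (Φ t) x (mfderiv 𝓘(ℝ, E) 𝓘(ℝ, E) (Φ t) x) :=
      ((hΦt t).mdifferentiable (by simp) x).hasMFDerivAt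
    have h3 : HasMFDerivAt 𝓘(ℝ, E) 𝓘(ℝ, E) e' x (mfderiv 𝓘(ℝ, E) 𝓘(ℝ, E) e' x) :=
      (mdifferentiableAt_extChartAt (by rwa [← extChartAt_source 𝓘(ℝ, E)])).hasMFDerivAt
    have h4 : HasMFDerivAt 𝓘(ℝ, E) 𝓘(ℝ, E) (fun y => g (t, y)) (e' x)
        ((fderiv ℝ g (t, y₀)).comp (ContinuousLinearMap.inr ℝ ℝ E)) :=
      (ht.hasFDerivAt.comp y₀ (hasFDerivAt_prodMk_right t y₀)).hasMFDerivAt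
    have h5 : (fun x' => g (t, e' x')) =ᶠ[𝓝 x] fun x' => e (Φ t x') := by
      filter_upwards [extChartAt_source_mem_nhds (I := 𝓘(ℝ, E)) x] with x' hx'
      simp only [hg]
      rw [e'.left_inv hx']
    have h6 := hasMFDerivAt_unique (h1.comp x h2) ((h4.comp x h3).congr_of_eventuallyEq h5.symm)
    exact DFunLike.congr_fun h6 u
  have htarget : g (t₀, y₀) ∈ e.target := by rw [hgz]; exact mem_extChartAt_target z
  have htn : e.target ∈ 𝓝 (g (t₀, y₀)) := (isOpen_extChartAt_target z).mem_nhds htarget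
  have key := hasDerivAt_pullback_form_eq_zero (B := Ω.chartForm z) (g := g)
    (Y := Ω.chartHamiltonianField H z) (h := fun y => H t₀ (e.symm y)) (t₀ := t₀) (y₀ := y₀)
    (((Ω.contDiffOn_chartForm z).contDiffAt htn).differentiableAt (by simp))
    (Ω.chartForm_swap z) (Ω.fderiv_chartForm_cyclic z htarget) (hgs.of_le h2)
    ((Ω.contDiffAt_chartHamiltonianField hH.smooth z t₀ htarget).differentiableAt (by simp))
    (by
      filter_upwards [hgdiff, hsrc] with q hq hqs
      have h1 : HasMFDerivAt 𝓘(ℝ, E) 𝓘(ℝ, E) e (Φ q.1 (e'.symm q.2))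
          (mfderiv 𝓘(ℝ, E) 𝓘(ℝ, E) e (Φ q.1 (e'.symm q.2))) :=
        (mdifferentiableAt_extChartAt (by rwa [← extChartAt_source 𝓘(ℝ, E)])).hasMFDerivAt
      have h2 : HasDerivAt (fun t => g (t, q.2)) _ q.1 := hasDerivAt_of_velocity
        (HasMFDerivAt.comp_curve (g := e) (γ := fun t => Φ t (e'.symm q.2)) h1
          (Ω.hasMFDerivAt_evolution hH s q.1 (e'.symm q.2)))
      have h3 : HasDerivAt (fun t => g (t, q.2)) (fderiv ℝ g q (1, 0)) q.1 :=
        HasFDerivAt.comp_hasDerivAt (l := g) q.1 hq.hasFDerivAt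
          ((hasDerivAt_id q.1).prodMk (hasDerivAt_const q.1 q.2))
      exact (h3.unique h2).trans
        (Ω.mfderiv_extChartAt_hamiltonianVectorField q.1 (hH.mdifferentiable q.1) z hqs))
    (((contDiffAt_hamiltonian_chart hH.smooth z t₀ htarget).comp (g (t₀, y₀))
      (contDiffAt_const.prodMk contDiffAt_id)).of_le h2)
    (by
      filter_upwards [htn] with y hy a
      exact Ω.chartForm_chartHamiltonianField H z t₀ hy a)
    (mfderiv 𝓘(ℝ, E) 𝓘(ℝ, E) e' x u : E) (mfderiv 𝓘(ℝ, E) 𝓘(ℝ, E) e' x w : E)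
  refine key.congr_of_eventuallyEq ?_
  filter_upwards [hslice u, hslice w, hdown.continuousAt.eventually hsrc] with t hu hw hts
  replace hts : Φ t x ∈ e.source := by rwa [hxy] at hts
  refine (Ω.bilin_eq_chartForm z hts _ _).trans ?_
  have h7 : g (t, y₀) = e (Φ t x) := by simp only [hg, hxy]
  rw [h7, ← hu, ← hw]

theorem isSymplectic_evolution (Ω : SymplecticForm E M) {H : ℝ → M → ℝ}
    (hH : IsFlatHamiltonian E H) (s t : ℝ) : Ω.IsSymplectic (Ω.evolution H s t) := by
  intro x u w
  have h1 := is_const_of_deriv_eq_zero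
    (fun t => (Ω.hasDerivAt_bilin_evolution hH s t x u w).differentiableAt)
    (fun t => (Ω.hasDerivAt_bilin_evolution hH s t x u w).deriv) t s
  refine h1.trans ?_
  have h2 : Ω.evolution H s s = id := funext (Ω.evolution_self hH s)
  rw [h2, mfderiv_id]
  rfl

end SymplecticForm

end Symplectic

/-! ### The infinitesimal Hofer relation on subsets -/

section HoferClose

open Set Filter Topology

variable {E : Type*} [NormedAddCommGroup E] [NormedSpace ℝ E]
  {M : Type*} [TopologicalSpace M] [ChartedSpace E M]

theorem HasMFDerivAt.reparam {γ : ℝ → M} {σ : ℝ → ℝ} {c t : ℝ}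
    {v : TangentSpace 𝓘(ℝ, E) (γ (σ t))}
    (hγ : HasMFDerivAt 𝓘(ℝ, ℝ) 𝓘(ℝ, E) γ (σ t) ((1 : ℝ →L[ℝ] ℝ).smulRight v))
    (hσ : HasDerivAt σ c t) :
    HasMFDerivAt 𝓘(ℝ, ℝ) 𝓘(ℝ, E) (fun t => γ (σ t)) t ((1 : ℝ →L[ℝ] ℝ).smulRight (c • v)) := by
  have h1 : HasMFDerivAt 𝓘(ℝ, ℝ) 𝓘(ℝ, ℝ) σ t ((1 : ℝ →L[ℝ] ℝ).smulRight c) :=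
    hσ.hasFDerivAt.hasMFDerivAt
  refine (hγ.comp t h1).congr_mfderiv ?_
  exact ContinuousLinearMap.ext fun r =>
    @mul_smul ℝ (TangentSpace 𝓘(ℝ, E) (γ (σ t))) _ _ r c v

/-- A smooth step function, that is `0` before time `0` and `1` after time `1`. -/
noncomputable abbrev timeStep : ℝ → ℝ := Real.smoothTransition

theorem contDiff_deriv_timeStep : ContDiff ℝ ∞ (deriv timeStep) :=
  (contDiff_infty_iff_deriv.1 Real.smoothTransition.contDiff).2

theorem hasDerivAt_timeStep (t : ℝ) : HasDerivAt timeStep (deriv timeStep t) t :=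
  ((Real.smoothTransition.contDiff (n := 1)).differentiable (by simp) t).hasDerivAt

theorem deriv_timeStep_eq_zero {t : ℝ} (ht : t ∉ Icc (0 : ℝ) 1) : deriv timeStep t = 0 := by
  rw [mem_Icc, not_and_or, not_le, not_le] at ht
  rcases ht with ht | ht
  · have : timeStep =ᶠ[𝓝 t] fun _ => 0 := by
      filter_upwards [Iio_mem_nhds ht] with s hs
      exact Real.smoothTransition.zero_of_nonpos (le_of_lt hs)
    rw [this.deriv_eq, deriv_const]
  · have : timeStep =ᶠ[𝓝 t] fun _ => 1 := by
      filter_upwards [Ioi_mem_nhds ht] with s hs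
      exact Real.smoothTransition.one_of_one_le (le_of_lt hs)
    rw [this.deriv_eq, deriv_const]

theorem timeStep_zero : timeStep 0 = 0 := Real.smoothTransition.zero_of_nonpos le_rfl

theorem timeStep_one : timeStep 1 = 1 := Real.smoothTransition.one_of_one_le le_rfl

theorem timeStep_mem_Icc (t : ℝ) : timeStep t ∈ Icc (0 : ℝ) 1 :=
  ⟨Real.smoothTransition.nonneg t, Real.smoothTransition.le_one t⟩

theorem exists_deriv_timeStep_le : ∃ C > 0, ∀ t, |deriv timeStep t| ≤ C := by
  obtain ⟨C, hC⟩ := isCompact_Icc.exists_bound_of_continuousOn (s := Icc (0 : ℝ) 1)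
    contDiff_deriv_timeStep.continuous.continuousOn
  refine ⟨max C 1, by positivity, fun t => ?_⟩
  by_cases ht : t ∈ Icc (0 : ℝ) 1
  · exact (hC t ht).trans (le_max_left _ _)
  · rw [deriv_timeStep_eq_zero ht, abs_zero]; positivity

theorem exists_deriv_timeStep_ne_zero : ∃ t, deriv timeStep t ≠ 0 := by
  by_contra! h
  have := is_const_of_deriv_eq_zero
    ((Real.smoothTransition.contDiff (n := 1)).differentiable (by simp)) h 0 1
  exact zero_ne_one (timeStep_zero.symm.trans (this.trans timeStep_one))

/-- A change of the time variable in a flat Hamiltonian. -/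
theorem IsFlatHamiltonian.reparam {H : ℝ → M → ℝ} (hH : IsFlatHamiltonian E H) {σ c : ℝ → ℝ}
    (hσ : ContDiff ℝ ∞ σ) (hc : ContDiff ℝ ∞ c)
    (h : ∀ t, t ∉ Icc (0 : ℝ) 1 → c t = 0 ∨ σ t ∉ Icc (0 : ℝ) 1) :
    IsFlatHamiltonian E (fun t x => c t * H (σ t) x) where
  smooth := (hc.contMDiff.comp contMDiff_fst).mul
    (hH.smooth.comp ((hσ.contMDiff.comp contMDiff_fst).prodMk contMDiff_snd))
  support := by
    obtain ⟨K, hK, hHK⟩ := hH.support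
    refine ⟨K, hK, fun t x htx => ?_⟩
    rcases htx with ht | hx
    · rcases h t ht with h0 | h0
      · simp [h0]
      · simp [hHK _ x (Or.inl h0)]
    · simp [hHK _ x (Or.inr hx)]

theorem IsFlatHamiltonian.comp_diffeomorph {H : ℝ → M → ℝ} (hH : IsFlatHamiltonian E H)
    (g : M ≃ₘ^∞⟮𝓘(ℝ, E), 𝓘(ℝ, E)⟯ M) : IsFlatHamiltonian E (fun t x => H t (g x)) where
  smooth := hH.smooth.comp (contMDiff_fst.prodMk (g.contMDiff.comp contMDiff_snd))
  support := by
    obtain ⟨K, hK, hHK⟩ := hH.support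
    refine ⟨g ⁻¹' K, g.toHomeomorph.isCompact_preimage.2 hK, fun t x h => hHK _ _ h⟩

namespace SymplecticForm

theorem IsSymplectic.symm {Ω : SymplecticForm E M} {g : M ≃ₘ^∞⟮𝓘(ℝ, E), 𝓘(ℝ, E)⟯ M}
    (hg : Ω.IsSymplectic g) : Ω.IsSymplectic g.symm := by
  intro y u w
  obtain ⟨x, rfl⟩ := g.surjective y
  have hgd := g.mdifferentiable (by simp)
  have hsurj := (g.mfderivToContinuousLinearEquiv (by simp) x).surjective
  obtain ⟨u, rfl⟩ : ∃ u', mfderiv 𝓘(ℝ, E) 𝓘(ℝ, E) g x u' = u := hsurj u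
  obtain ⟨w, rfl⟩ : ∃ w', mfderiv 𝓘(ℝ, E) 𝓘(ℝ, E) g x w' = w := hsurj w
  have hid {k : M → M} (hk : k = id) : Ω.bilin (k x) (mfderiv 𝓘(ℝ, E) 𝓘(ℝ, E) k x u)
      (mfderiv 𝓘(ℝ, E) 𝓘(ℝ, E) k x w) = Ω.bilin x u w := by
    rw [hk, mfderiv_id]; rfl
  have h1 := hid (k := g.symm ∘ g) (funext g.symm_apply_apply)
  rw [mfderiv_comp x (g.symm.mdifferentiable (by simp) (g x)) (hgd x)] at h1
  exact h1.trans (hg x u w).symm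

variable [FiniteDimensional ℝ E]

/-- The naturality of Hamiltonian vectors under symplectic diffeomorphisms. -/
theorem mfderiv_hamiltonianVectorField_comp (Ω : SymplecticForm E M)
    (g : M ≃ₘ^∞⟮𝓘(ℝ, E), 𝓘(ℝ, E)⟯ M) (hg : Ω.IsSymplectic g) {k : M → ℝ}
    (hk : MDifferentiable 𝓘(ℝ, E) 𝓘(ℝ, ℝ) k) (x : M) :
    mfderiv 𝓘(ℝ, E) 𝓘(ℝ, E) g x (Ω.hamiltonianVectorField (fun x => k (g x)) x) =
      Ω.hamiltonianVectorField k (g x) := by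
  refine (Ω.hamiltonianVectorField_eq fun v => ?_).symm
  obtain ⟨u, rfl⟩ : ∃ u, mfderiv 𝓘(ℝ, E) 𝓘(ℝ, E) g x u = v :=
    (g.mfderivToContinuousLinearEquiv (by simp) x).surjective v
  rw [hg, bilin_hamiltonianVectorField]
  exact DFunLike.congr_fun (mfderiv_comp x (hk (g x)) (g.mdifferentiable (by simp) x)) u

/-- Integral curves after a change of the time variable. -/
theorem hasMFDerivAt_reparam (Ω : SymplecticForm E M) {H : ℝ → M → ℝ}
    (hH : IsFlatHamiltonian E H) {γ : ℝ → M} {σ : ℝ → ℝ} {c t : ℝ}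
    (hγ : HasMFDerivAt 𝓘(ℝ, ℝ) 𝓘(ℝ, E) γ (σ t)
      ((1 : ℝ →L[ℝ] ℝ).smulRight (Ω.hamiltonianVectorField (H (σ t)) (γ (σ t)))))
    (hσ : HasDerivAt σ c t) :
    HasMFDerivAt 𝓘(ℝ, ℝ) 𝓘(ℝ, E) (fun t => γ (σ t)) t
      ((1 : ℝ →L[ℝ] ℝ).smulRight
        (Ω.hamiltonianVectorField (fun x => c * H (σ t) x) (γ (σ t)))) := by
  rw [Ω.hamiltonianVectorField_const_mul c (hH.mdifferentiable (σ t) _)]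
  exact hγ.reparam hσ

variable [IsManifold 𝓘(ℝ, E) ∞ M] [T2Space M]

/-- A symplectic diffeomorphism `g` intertwines the evolutions of `H ∘ g` and `H`. -/
theorem evolution_conj (Ω : SymplecticForm E M) (g : M ≃ₘ^∞⟮𝓘(ℝ, E), 𝓘(ℝ, E)⟯ M)
    (hg : Ω.IsSymplectic g) {H : ℝ → M → ℝ} (hH : IsFlatHamiltonian E H) (s t : ℝ) (x : M) :
    g (Ω.evolution (fun t x => H t (g x)) s t x) = Ω.evolution H s t (g x) := by
  set K : ℝ → M → ℝ := fun t x => H t (g x) with hK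
  have hKf : IsFlatHamiltonian E K := hH.comp_diffeomorph g
  have h := Ω.evolution_eq_of_integralCurve hH (γ := fun t => g (Ω.evolution K s t x))
    (fun t => by
      have h1 := HasMFDerivAt.comp_curve
        ((g.mdifferentiable (by simp) (Ω.evolution K s t x)).hasMFDerivAt)
        (Ω.hasMFDerivAt_evolution hKf s t x)
      exact (congrArg (fun z => (1 : ℝ →L[ℝ] ℝ).smulRight z)
        (Ω.mfderiv_hamiltonianVectorField_comp g hg (hH.mdifferentiable t) _)) ▸ h1) s t
  rw [← h, Ω.evolution_self hKf]

theorem evolution_reparam (Ω : SymplecticForm E M) {H : ℝ → M → ℝ}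
    (hH : IsFlatHamiltonian E H) {σ c : ℝ → ℝ} (hσc : ∀ t, HasDerivAt σ (c t) t)
    (hK : IsFlatHamiltonian E (fun t x => c t * H (σ t) x)) (s t : ℝ) (x : M) :
    Ω.evolution (fun t x => c t * H (σ t) x) s t x = Ω.evolution H (σ s) (σ t) x := by
  have h := Ω.evolution_eq_of_integralCurve hK (γ := fun t => Ω.evolution H (σ s) (σ t) x)
    (fun t => Ω.hasMFDerivAt_reparam hH (Ω.hasMFDerivAt_evolution hH (σ s) (σ t) x) (hσc t)) s t
  rw [← h, Ω.evolution_self hH]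

theorem evolution_zero (Ω : SymplecticForm E M) (s t : ℝ) (x : M) :
    Ω.evolution (fun _ _ => 0) s t x = x :=
  Ω.evolution_eq_of_integralCurve isFlatHamiltonian_zero (γ := fun _ => x)
    (fun t => by
      rw [Ω.hamiltonianVectorField_zero]
      exact hasMFDerivAt_const_zero_velocity x t) s t

/-- Every piece of a Hamiltonian evolution is the time-one map of a flat Hamiltonian, whose size
is controlled by that of the original one. -/
theorem exists_evolution_zero_one_eq (Ω : SymplecticForm E M) (a b : ℝ) :
    ∃ C > 0, ∀ H : ℝ → M → ℝ, IsFlatHamiltonian E H → ∃ K : ℝ → M → ℝ, IsFlatHamiltonian E K ∧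
      (∀ ε, (∀ t x, |H t x| ≤ ε) → ∀ t x, |K t x| ≤ C * ε) ∧
      ∀ x, Ω.evolution K 0 1 x = Ω.evolution H a b x := by
  obtain ⟨C, hC, hCb⟩ := exists_deriv_timeStep_le
  refine ⟨(|b - a| + 1) * C, by positivity, fun H hH => ?_⟩
  set σ : ℝ → ℝ := fun t => a + (b - a) * timeStep t with hσ
  set c : ℝ → ℝ := fun t => (b - a) * deriv timeStep t with hc
  have hK : IsFlatHamiltonian E (fun t x => c t * H (σ t) x) :=
    hH.reparam (contDiff_const.add (contDiff_const.mul Real.smoothTransition.contDiff))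
      (contDiff_const.mul contDiff_deriv_timeStep)
      (fun t ht => Or.inl (by simp [hc, deriv_timeStep_eq_zero ht]))
  refine ⟨_, hK, fun ε hε t x => ?_, fun x => ?_⟩
  · rw [abs_mul, hc]
    simp only [abs_mul]
    exact mul_le_mul (mul_le_mul (by linarith) (hCb t) (abs_nonneg _) (by positivity)) (hε _ _)
      (abs_nonneg _) (by positivity)
  · rw [Ω.evolution_reparam hH
      (fun t => ((hasDerivAt_timeStep t).const_mul (b - a)).const_add a) hK]
    simp [Real.smoothTransition.zero_of_nonpos, Real.smoothTransition.one_of_one_le]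

/-- `A` and `B` are related by time-one maps of arbitrarily small flat Hamiltonians. -/
def HoferClose (Ω : SymplecticForm E M) (A B : Set M) : Prop :=
  ∀ ε > 0, ∃ H : ℝ → M → ℝ, IsFlatHamiltonian E H ∧ (∀ t x, |H t x| ≤ ε) ∧
    Ω.evolution H 0 1 '' A = B

theorem HoferClose.refl (Ω : SymplecticForm E M) (A : Set M) : Ω.HoferClose A A := fun ε hε =>
  ⟨_, isFlatHamiltonian_zero, fun _ _ => by simpa using hε.le, by
    rw [funext (Ω.evolution_zero 0 1), image_id']⟩

theorem HoferClose.symm {Ω : SymplecticForm E M} {A B : Set M} (h : Ω.HoferClose A B) :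
    Ω.HoferClose B A := by
  intro ε hε
  obtain ⟨H, hH, hHε, rfl⟩ := h ε hε
  have hK : IsFlatHamiltonian E (fun t x => (-1 : ℝ) * H (1 - t) x) :=
    hH.reparam (σ := fun t => 1 - t) (c := fun _ => -1) (contDiff_const.sub contDiff_id)
      contDiff_const fun t ht => Or.inr fun h => ht ⟨by linarith [h.2], by linarith [h.1]⟩
  refine ⟨_, hK, fun t x => by simpa using hHε (1 - t) x, ?_⟩
  have h1 (x : M) : Ω.evolution (fun t x => (-1 : ℝ) * H (1 - t) x) 0 1 x
      = Ω.evolution H 1 0 x := by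
    rw [Ω.evolution_reparam hH (σ := fun t => 1 - t) (c := fun _ => -1)
      (fun t => (hasDerivAt_id t).const_sub 1) hK]
    simp
  rw [funext h1]
  exact (Ω.evolutionDiffeo hH 0 1).toEquiv.symm_image_image A

theorem HoferClose.trans {Ω : SymplecticForm E M} {A B C : Set M} (hAB : Ω.HoferClose A B)
    (hBC : Ω.HoferClose B C) : Ω.HoferClose A C := by
  intro ε hε
  -- the concatenation runs both Hamiltonians at double speed
  obtain ⟨H, hH, hHε, rfl⟩ := hAB (ε / 4) (by positivity)
  obtain ⟨K, hK, hKε, rfl⟩ := hBC (ε / 4) (by positivity)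
  have hc1 : ContDiff ℝ ∞ (fun t : ℝ => 2 * t) := contDiff_const.mul contDiff_id
  have hc2 : ContDiff ℝ ∞ (fun t : ℝ => 2 * t - 1) := hc1.sub contDiff_const
  have hH' : IsFlatHamiltonian E (fun t x => (2 : ℝ) * H (2 * t) x) :=
    hH.reparam (c := fun _ => 2) hc1 contDiff_const fun t ht => Or.inr fun h =>
      ht ⟨by linarith [h.1], by linarith [h.2]⟩
  have hK' : IsFlatHamiltonian E (fun t x => (2 : ℝ) * K (2 * t - 1) x) :=
    hK.reparam (c := fun _ => 2) hc2 contDiff_const fun t ht => Or.inr fun h =>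
      ht ⟨by linarith [h.1], by linarith [h.2]⟩
  have hd1 (t : ℝ) : HasDerivAt (fun t : ℝ => 2 * t) 2 t :=
    ((hasDerivAt_id t).const_mul 2).congr_deriv (mul_one 2)
  have hd2 (t : ℝ) : HasDerivAt (fun t : ℝ => 2 * t - 1) 2 t := (hd1 t).sub_const 1
  have hHzero (t : ℝ) (ht : t ∉ Icc (0 : ℝ) 1) (x : M) : H t x = 0 := by
    obtain ⟨A, -, hA⟩ := hH.support
    exact hA t x (Or.inl ht)
  have hKzero (t : ℝ) (ht : t ∉ Icc (0 : ℝ) 1) (x : M) : K t x = 0 := by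
    obtain ⟨A, -, hA⟩ := hK.support
    exact hA t x (Or.inl ht)
  have hG := hH'.add hK'
  set G : ℝ → M → ℝ := fun t x => 2 * H (2 * t) x + 2 * K (2 * t - 1) x with hGdef
  have e1 (x : M) : Ω.evolution G 0 (1 / 2) x = Ω.evolution H 0 1 x := by
    have h := Ω.evolution_eq_of_integralCurveOn hG (a := 0) (b := 1 / 2)
      (γ := fun t => Ω.evolution H 0 (2 * t) x) (by norm_num)
      (fun t _ => ((Ω.hasMFDerivAt_evolution hH 0 (2 * t) x).reparam
        (hd1 t)).continuousAt.continuousWithinAt)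
      (fun t ht => by
        have h1 : G t = fun x => 2 * H (2 * t) x := funext fun x => by
          rw [hGdef]
          simp only
          rw [hKzero _ (fun h => by linarith [h.1, ht.2]), mul_zero, add_zero]
        rw [h1]
        exact Ω.hasMFDerivAt_reparam hH (Ω.hasMFDerivAt_evolution hH 0 (2 * t) x) (hd1 t))
      (s := 0) (t := 1 / 2) (by norm_num) (by norm_num)
    simpa [Ω.evolution_self hH] using h
  have e2 (x : M) : Ω.evolution G (1 / 2) 1 x = Ω.evolution K 0 1 x := by
    have h := Ω.evolution_eq_of_integralCurveOn hG (a := 1 / 2) (b := 1)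
      (γ := fun t => Ω.evolution K 0 (2 * t - 1) x) (by norm_num)
      (fun t _ => (HasMFDerivAt.reparam (σ := fun t => 2 * t - 1)
        (Ω.hasMFDerivAt_evolution hK 0 (2 * t - 1) x) (hd2 t)).continuousAt.continuousWithinAt)
      (fun t ht => by
        have h1 : G t = fun x => 2 * K (2 * t - 1) x := funext fun x => by
          rw [hGdef]
          simp only
          rw [hHzero _ (fun h => by linarith [h.2, ht.1]), mul_zero, zero_add]
        rw [h1]
        exact Ω.hasMFDerivAt_reparam hK (σ := fun t => 2 * t - 1)
          (Ω.hasMFDerivAt_evolution hK 0 (2 * t - 1) x) (hd2 t))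
      (s := 1 / 2) (t := 1) (by norm_num) (by norm_num)
    norm_num at h
    rwa [Ω.evolution_self hK] at h
  refine ⟨G, hG, fun t x => ?_, ?_⟩
  · have h1 := abs_le.1 (hHε (2 * t) x)
    have h2 := abs_le.1 (hKε (2 * t - 1) x)
    rw [hGdef, abs_le]
    constructor <;> simp only <;> linarith [h1.1, h1.2, h2.1, h2.2]
  · rw [image_image]
    refine image_congr fun x _ => ?_
    rw [← Ω.evolution_evolution hG 0 (1 / 2) 1, e1, e2]

/-- Symplectic diffeomorphisms preserve Hofer closeness, since they conjugate Hamiltonian evolutions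
to Hamiltonian evolutions. -/
theorem HoferClose.image {Ω : SymplecticForm E M} {A B : Set M} (h : Ω.HoferClose A B)
    (g : M ≃ₘ^∞⟮𝓘(ℝ, E), 𝓘(ℝ, E)⟯ M) (hg : Ω.IsSymplectic g) :
    Ω.HoferClose (g '' A) (g '' B) := by
  intro ε hε
  obtain ⟨H, hH, hHε, rfl⟩ := h ε hε
  refine ⟨_, hH.comp_diffeomorph g.symm, fun t x => hHε t _, ?_⟩
  rw [image_image, image_image]
  refine image_congr fun x _ => ?_
  have h1 := Ω.evolution_conj g.symm hg.symm hH 0 1 (g x)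
  rw [g.symm_apply_apply] at h1
  rw [← h1, g.apply_symm_apply]

end SymplecticForm

end HoferClose

/-! ### Local defining functions of embedded submanifolds -/

section Submanifold

open Set Filter Topology

variable {E : Type*} [NormedAddCommGroup E] [NormedSpace ℝ E]
  {M : Type*} [TopologicalSpace M] [ChartedSpace E M]
  {F : Type*} [NormedAddCommGroup F] [NormedSpace ℝ F]
  {X : Type*} [TopologicalSpace X] [ChartedSpace F X]

/-- Near each of its points, an embedded submanifold lies in the zero set of a smooth map, whose
derivative has a kernel no larger than the tangent space of the submanifold. -/
theorem exists_local_defining_map {f : X → M}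
    (hf : Manifold.IsSmoothEmbedding 𝓘(ℝ, F) 𝓘(ℝ, E) ∞ f) (p : X) :
    ∃ (π : M → E) (U : Set M), IsOpen U ∧ f p ∈ U ∧ ContMDiffOn 𝓘(ℝ, E) 𝓘(ℝ, E) ∞ π U ∧
      (∀ q, f q ∈ U → π (f q) = 0) ∧
      ∀ v, mfderiv 𝓘(ℝ, E) 𝓘(ℝ, E) π (f p) v = 0 → v ∈ imageTangentSpace E F f p := by
  have h := hf.isImmersion.isImmersionAt p
  set κ := h.codChart
  set δ := h.domChart
  set L := h.equiv
  have hδ : ContMDiffOn 𝓘(ℝ, F) 𝓘(ℝ, F) ∞ δ.symm δ.target :=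
    contMDiffOn_symm_of_mem_maximalAtlas h.domChart_mem_maximalAtlas
  have hκ : ContMDiffOn 𝓘(ℝ, E) 𝓘(ℝ, E) ∞ κ κ.source :=
    contMDiffOn_of_mem_maximalAtlas h.codChart_mem_maximalAtlas
  have hκ' : ContMDiffOn 𝓘(ℝ, E) 𝓘(ℝ, E) ∞ κ.symm κ.target :=
    contMDiffOn_symm_of_mem_maximalAtlas h.codChart_mem_maximalAtlas
  have hδd : δ.MDifferentiable 𝓘(ℝ, F) 𝓘(ℝ, F) :=
    ⟨(contMDiffOn_of_mem_maximalAtlas h.domChart_mem_maximalAtlas).mdifferentiableOn (by simp),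
      hδ.mdifferentiableOn (by simp)⟩
  have hκd : κ.MDifferentiable 𝓘(ℝ, E) 𝓘(ℝ, E) :=
    ⟨hκ.mdifferentiableOn (by simp), hκ'.mdifferentiableOn (by simp)⟩
  have hfp : f p ∈ κ.source := h.mem_codChart_source
  have hp : p ∈ δ.source := h.mem_domChart_source
  have hwrit (q : X) (hq : q ∈ δ.source) : κ (f q) = L (δ q, 0) := by
    have h1 := h.writtenInCharts
      (show δ q ∈ (δ.extend 𝓘(ℝ, F)).target by simpa using δ.map_source hq)
    have h2 : δ.symm (δ q) = q := δ.left_inv hq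
    have h3 : κ (f (δ.symm (δ q))) = L (δ q, 0) := by simpa [κ, δ, L] using h1
    rwa [h2] at h3
  -- `f` being an embedding, points of the image near `f p` come from the domain of `δ`
  obtain ⟨V, hV, hVδ⟩ := hf.isEmbedding.isOpen_iff.1 δ.open_source
  set P : E →L[ℝ] E := L.toContinuousLinearMap.comp
    (((ContinuousLinearMap.inr ℝ F h.complement).comp
      (ContinuousLinearMap.snd ℝ F h.complement)).comp L.symm.toContinuousLinearMap)
  have hP (e : E) : P e = L (0, (L.symm e).2) := rfl
  refine ⟨fun y => P (κ y), V ∩ κ.source, hV.inter κ.open_source, ⟨?_, hfp⟩, ?_, ?_, ?_⟩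
  · have : p ∈ f ⁻¹' V := hVδ ▸ hp
    exact this
  · exact P.contMDiff.comp_contMDiffOn (hκ.mono inter_subset_right)
  · intro q hq
    have hq' : q ∈ δ.source := hVδ ▸ (show q ∈ f ⁻¹' V from hq.1)
    simp only
    rw [hwrit q hq', hP]
    simp
  · intro v hv
    have hκx : HasMFDerivAt 𝓘(ℝ, E) 𝓘(ℝ, E) κ (f p) (mfderiv 𝓘(ℝ, E) 𝓘(ℝ, E) κ (f p)) :=
      (hκd.mdifferentiableAt hfp).hasMFDerivAt
    have h1 : (P (mfderiv 𝓘(ℝ, E) 𝓘(ℝ, E) κ (f p) v : E) : E) = 0 := by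
      have h2 : HasMFDerivAt 𝓘(ℝ, E) 𝓘(ℝ, E) P (κ (f p)) P := P.hasMFDerivAt
      have h3 := (h2.comp (f p) hκx).mfderiv
      exact (DFunLike.congr_fun h3 v).symm.trans hv
    set w : E := mfderiv 𝓘(ℝ, E) 𝓘(ℝ, E) κ (f p) v with hw
    rw [hP] at h1
    have h2 : (L.symm w).2 = 0 := by
      have := congrArg Prod.snd ((map_eq_zero_iff L L.injective).1 h1)
      exact this
    set u : F := (L.symm w).1 with hu
    have h3 : L (u, 0) = w := by
      rw [hu, ← h2, Prod.mk.eta, L.apply_symm_apply]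
    obtain ⟨a, ha⟩ := hδd.mfderiv_surjective hp u
    have h4 : HasMFDerivAt 𝓘(ℝ, F) 𝓘(ℝ, F) δ p (mfderiv 𝓘(ℝ, F) 𝓘(ℝ, F) δ p) :=
      (hδd.mdifferentiableAt hp).hasMFDerivAt
    have h5 : HasMFDerivAt 𝓘(ℝ, F) 𝓘(ℝ, E) f p (mfderiv 𝓘(ℝ, F) 𝓘(ℝ, E) f p) :=
      (hf.contMDiff.mdifferentiable (by simp) p).hasMFDerivAt
    set L' : F →L[ℝ] E := L.toContinuousLinearMap.comp (ContinuousLinearMap.inl ℝ F h.complement)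
    have h6 : HasMFDerivAt 𝓘(ℝ, F) 𝓘(ℝ, E) L' (δ p) L' := L'.hasMFDerivAt
    have h7 : (fun q => κ (f q)) =ᶠ[𝓝 p] fun q => L' (δ q) := by
      filter_upwards [δ.open_source.mem_nhds hp] with q hq
      exact hwrit q hq
    have h8 := hasMFDerivAt_unique (hκx.comp p h5)
      ((h6.comp p h4).congr_of_eventuallyEq h7)
    refine ⟨a, hκd.mfderiv_injective hfp ?_⟩
    refine (DFunLike.congr_fun h8 a).trans ?_
    refine Eq.trans ?_ h3
    exact congrArg L' ha

/-- The velocity of a curve on an embedded submanifold is tangent to the submanifold. -/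
theorem velocity_mem_imageTangentSpace {f : X → M}
    (hf : Manifold.IsSmoothEmbedding 𝓘(ℝ, F) 𝓘(ℝ, E) ∞ f) (p : X) {γ : ℝ → M} {t : ℝ}
    (hγt : γ t = f p) (hγ : ∀ t, γ t ∈ range f) {v : TangentSpace 𝓘(ℝ, E) (γ t)}
    (hv : HasMFDerivAt 𝓘(ℝ, ℝ) 𝓘(ℝ, E) γ t ((1 : ℝ →L[ℝ] ℝ).smulRight v)) :
    (v : E) ∈ imageTangentSpace E F f p := by
  obtain ⟨π, U, hU, hpU, hπ, hπ0, hker⟩ := exists_local_defining_map hf p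
  have h1 : HasMFDerivAt 𝓘(ℝ, E) 𝓘(ℝ, E) π (γ t) (mfderiv 𝓘(ℝ, E) 𝓘(ℝ, E) π (γ t)) := by
    rw [hγt]
    exact ((hπ.contMDiffAt (hU.mem_nhds hpU)).mdifferentiableAt (by simp)).hasMFDerivAt
  have h2 : HasDerivAt (fun t => π (γ t)) _ t := hasDerivAt_of_velocity (h1.comp_curve hv)
  have h3 : (fun t => π (γ t)) =ᶠ[𝓝 t] fun _ => 0 := by
    have hn : U ∈ 𝓝 (γ t) := hU.mem_nhds (by rwa [hγt])
    filter_upwards [hv.continuousAt.preimage_mem_nhds hn] with s hs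
    obtain ⟨q, hq⟩ := hγ s
    rw [← hq]
    exact hπ0 q (by rw [hq]; exact hs)
  have h4 := h2.unique ((hasDerivAt_const t (0 : E)).congr_of_eventuallyEq h3)
  have h5 (x : M) (hx : γ t = x) (hz : (mfderiv 𝓘(ℝ, E) 𝓘(ℝ, E) π (γ t) v : E) = 0) :
      (mfderiv 𝓘(ℝ, E) 𝓘(ℝ, E) π x (v : E) : E) = 0 := by
    subst hx; exact hz
  exact hker v (h5 _ hγt h4)

/-- A covector that vanishes on the tangent space of an embedded submanifold is the differential
of a compactly supported function that vanishes on the submanifold. -/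
theorem exists_function_vanishing_on_range [FiniteDimensional ℝ E] [IsManifold 𝓘(ℝ, E) ∞ M]
    [T2Space M] {f : X → M}
    (hf : Manifold.IsSmoothEmbedding 𝓘(ℝ, F) 𝓘(ℝ, E) ∞ f) (p : X)
    (α : TangentSpace 𝓘(ℝ, E) (f p) →ₗ[ℝ] ℝ) (hα : ∀ v ∈ imageTangentSpace E F f p, α v = 0) :
    ∃ G : M → ℝ, ContMDiff 𝓘(ℝ, E) 𝓘(ℝ, ℝ) ∞ G ∧ HasCompactSupport G ∧ (∀ q, G (f q) = 0) ∧
      ∀ v, (mfderiv 𝓘(ℝ, E) 𝓘(ℝ, ℝ) G (f p) v : ℝ) = α v := by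
  obtain ⟨π, U, hU, hpU, hπ, hπ0, hker⟩ := exists_local_defining_map hf p
  obtain ⟨l, hl⟩ : ∃ l : E →ₗ[ℝ] ℝ,
      l ∘ₗ (mfderiv 𝓘(ℝ, E) 𝓘(ℝ, E) π (f p)).toLinearMap = α := by
    have h1 : α ∈ LinearMap.range
        (mfderiv 𝓘(ℝ, E) 𝓘(ℝ, E) π (f p)).toLinearMap.dualMap := by
      rw [LinearMap.range_dualMap_eq_dualAnnihilator_ker, Submodule.mem_dualAnnihilator]
      exact fun v hv => hα v (hker v hv)
    obtain ⟨l, hl⟩ := h1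
    exact ⟨l, hl⟩
  set l' : E →L[ℝ] ℝ := LinearMap.toContinuousLinearMap l
  obtain ⟨χ, -, hχU⟩ := (SmoothBumpFunction.nhds_basis_tsupport (I := 𝓘(ℝ, E)) (f p)).mem_iff.1
    (hU.mem_nhds hpU)
  have hlπ (y : M) (hy : y ∈ U) : ContMDiffAt 𝓘(ℝ, E) 𝓘(ℝ, ℝ) ∞ (fun y => l' (π y)) y :=
    l'.contMDiff.contMDiffAt.comp y (hπ.contMDiffAt (hU.mem_nhds hy))
  refine ⟨fun y => χ y * l' (π y), fun y => ?_, ?_, fun q => ?_, fun v => ?_⟩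
  · by_cases hy : y ∈ tsupport χ
    · exact χ.contMDiffAt.mul (hlπ y (hχU hy))
    · refine (contMDiffAt_const (c := (0 : ℝ))).congr_of_eventuallyEq ?_
      filter_upwards [(isClosed_tsupport χ).isOpen_compl.mem_nhds hy] with z hz
      rw [image_eq_zero_of_notMem_tsupport hz, zero_mul]
  · exact χ.hasCompactSupport.mul_right
  · by_cases hq : f q ∈ tsupport χ
    · simp only
      rw [hπ0 q (hχU hq), map_zero, mul_zero]
    · simp only
      rw [image_eq_zero_of_notMem_tsupport hq, zero_mul]
  · have h1 : (fun y => χ y * l' (π y)) =ᶠ[𝓝 (f p)] fun y => l' (π y) := by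
      filter_upwards [χ.eventuallyEq_one] with y hy
      rw [hy, Pi.one_apply, one_mul]
    have h2 : HasMFDerivAt 𝓘(ℝ, E) 𝓘(ℝ, E) π (f p) (mfderiv 𝓘(ℝ, E) 𝓘(ℝ, E) π (f p)) :=
      ((hπ.contMDiffAt (hU.mem_nhds hpU)).mdifferentiableAt (by simp)).hasMFDerivAt
    have h3 : HasMFDerivAt 𝓘(ℝ, E) 𝓘(ℝ, ℝ) l' (π (f p)) l' := l'.hasMFDerivAt
    have h4 := ((h3.comp (f p) h2).congr_of_eventuallyEq h1).mfderiv
    rw [← hl]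
    exact DFunLike.congr_fun h4 v

end Submanifold

/-! ### Moving a subset off a point at no cost -/

section Displacement

open Set Filter Topology

variable {E : Type*} [NormedAddCommGroup E] [NormedSpace ℝ E]
  {M : Type*} [TopologicalSpace M] [ChartedSpace E M]

theorem IsFlatHamiltonian.of_mul {c : ℝ → ℝ} (hc : ContDiff ℝ ∞ c)
    (hc0 : ∀ t, t ∉ Icc (0 : ℝ) 1 → c t = 0) {G : M → ℝ} (hG : ContMDiff 𝓘(ℝ, E) 𝓘(ℝ, ℝ) ∞ G)
    (hGc : HasCompactSupport G) : IsFlatHamiltonian E (fun t x => c t * G x) where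
  smooth := (hc.contMDiff.comp contMDiff_fst).mul (hG.comp contMDiff_snd)
  support := ⟨tsupport G, hGc, fun t x h => by
    rcases h with h | h
    · simp [hc0 t h]
    · simp [image_eq_zero_of_notMem_tsupport h]⟩

theorem IsFlatHamiltonian.mul_left {χ : M → ℝ} (hχ : ContMDiff 𝓘(ℝ, E) 𝓘(ℝ, ℝ) ∞ χ)
    {H : ℝ → M → ℝ} (hH : IsFlatHamiltonian E H) :
    IsFlatHamiltonian E (fun t x => χ x * H t x) where
  smooth := (hχ.comp contMDiff_snd).mul hH.smooth
  support := by
    obtain ⟨K, hK, hHK⟩ := hH.support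
    exact ⟨K, hK, fun t x h => by rw [hHK t x h, mul_zero]⟩

namespace SymplecticForm

theorem bilin_self (Ω : SymplecticForm E M) (x : M) (v : TangentSpace 𝓘(ℝ, E) x) :
    Ω.bilin x v v = 0 := by
  have := Ω.bilin_swap x v v
  linarith

variable [FiniteDimensional ℝ E]

theorem hamiltonianVectorField_comp_real (Ω : SymplecticForm E M) {G : M → ℝ} {x : M} {κ : ℝ → ℝ}
    {k : ℝ} (hκ : HasDerivAt κ k (G x)) (hG : MDifferentiableAt 𝓘(ℝ, E) 𝓘(ℝ, ℝ) G x) :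
    Ω.hamiltonianVectorField (fun x => κ (G x)) x = k • Ω.hamiltonianVectorField G x := by
  refine Ω.hamiltonianVectorField_eq_smul ?_
  have h1 : HasMFDerivAt 𝓘(ℝ, ℝ) 𝓘(ℝ, ℝ) κ (G x) ((1 : ℝ →L[ℝ] ℝ).smulRight k) :=
    hκ.hasFDerivAt.hasMFDerivAt
  refine (h1.comp x hG.hasMFDerivAt).congr_mfderiv ?_
  exact ContinuousLinearMap.ext fun v => mul_comm (G := ℝ) _ k

variable [IsManifold 𝓘(ℝ, E) ∞ M] [T2Space M]

/-- The function `G` is conserved under the evolution of `c(t) G`. -/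
theorem apply_evolution_mul (Ω : SymplecticForm E M) {c : ℝ → ℝ} {G : M → ℝ}
    (hH : IsFlatHamiltonian E (fun t x => c t * G x))
    (hG : MDifferentiable 𝓘(ℝ, E) 𝓘(ℝ, ℝ) G) (s t : ℝ) (x : M) :
    G (Ω.evolution (fun t x => c t * G x) s t x) = G x := by
  have hd (t : ℝ) : HasDerivAt (fun t => G (Ω.evolution (fun t x => c t * G x) s t x)) 0 t := by
    set z := Ω.evolution (fun t x => c t * G x) s t x with hz
    have h1 : HasDerivAt (fun t => G (Ω.evolution (fun t x => c t * G x) s t x)) _ t :=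
      hasDerivAt_of_velocity (HasMFDerivAt.comp_curve (hG z).hasMFDerivAt
        (Ω.hasMFDerivAt_evolution hH s t x))
    refine h1.congr_deriv ?_
    refine (Ω.bilin_hamiltonianVectorField G z _).symm.trans ?_
    rw [Ω.hamiltonianVectorField_const_mul (c t) (hG _), map_smul, LinearMap.smul_apply,
      bilin_self, smul_zero]
  have h2 := is_const_of_deriv_eq_zero (fun t => (hd t).differentiableAt)
    (fun t => (hd t).deriv) t s
  simp only [Ω.evolution_self hH] at h2
  exact h2

/-- If `G` vanishes on `N`, the evolution of `c(t) G` moves `N` at no cost: replacing `G` by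
`δ sin (G / δ)` does not change the orbits of the points of `N`, on which `G` vanishes. -/
theorem hoferClose_evolution_image (Ω : SymplecticForm E M) {c : ℝ → ℝ} (hc : ContDiff ℝ ∞ c)
    (hc0 : ∀ t, t ∉ Icc (0 : ℝ) 1 → c t = 0) {G : M → ℝ} (hG : ContMDiff 𝓘(ℝ, E) 𝓘(ℝ, ℝ) ∞ G)
    (hGc : HasCompactSupport G) {N : Set M} (hN : ∀ x ∈ N, G x = 0) (s t : ℝ) :
    Ω.HoferClose N (Ω.evolution (fun t x => c t * G x) s t '' N) := by
  intro ε hε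
  have hGd : MDifferentiable 𝓘(ℝ, E) 𝓘(ℝ, ℝ) G := hG.mdifferentiable (by simp)
  have hH := IsFlatHamiltonian.of_mul hc hc0 hG hGc
  obtain ⟨C, hC, hgen⟩ := Ω.exists_evolution_zero_one_eq s t
  obtain ⟨D, hD, hcD⟩ : ∃ D > 0, ∀ t, |c t| ≤ D := by
    obtain ⟨D, hD⟩ := isCompact_Icc.exists_bound_of_continuousOn (s := Icc (0 : ℝ) 1)
      hc.continuous.continuousOn
    refine ⟨max D 1, by positivity, fun t => ?_⟩
    by_cases ht : t ∈ Icc (0 : ℝ) 1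
    · exact (hD t ht).trans (le_max_left _ _)
    · rw [hc0 t ht, abs_zero]; positivity
  obtain ⟨δ, hδ0, hδ⟩ : ∃ δ > 0, C * (D * δ) = ε := ⟨ε / (C * D), by positivity, by field_simp⟩
  set κ : ℝ → ℝ := fun r => δ * Real.sin (r / δ) with hκ
  have hκs : ContDiff ℝ ∞ κ := contDiff_const.mul (Real.contDiff_sin.comp (contDiff_id.div_const δ))
  have hκ' : HasDerivAt κ 1 0 := by
    have h1 : HasDerivAt (fun r : ℝ => r / δ) (1 / δ) 0 := (hasDerivAt_id 0).div_const δ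
    refine (h1.sin.const_mul δ).congr_deriv ?_
    rw [zero_div, Real.cos_zero]
    field_simp
  have hκ0 : κ 0 = 0 := by rw [hκ]; simp only [zero_div, Real.sin_zero, mul_zero]
  have hκG : ContMDiff 𝓘(ℝ, E) 𝓘(ℝ, ℝ) ∞ (fun x => κ (G x)) := hκs.contMDiff.comp hG
  have hκGc : HasCompactSupport (fun x => κ (G x)) := hGc.comp_left (g := κ) hκ0
  have hK : IsFlatHamiltonian E (fun t x => c t * κ (G x)) :=
    IsFlatHamiltonian.of_mul hc hc0 hκG hκGc
  obtain ⟨K', hK', hbound, hev⟩ := hgen _ hK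
  refine ⟨K', hK', fun r x => ?_, image_congr fun x hx => ?_⟩
  · refine (hbound (D * δ) (fun r x => ?_) r x).trans_eq ?_
    · rw [abs_mul, hκ]
      simp only [abs_mul, abs_of_pos hδ0]
      exact mul_le_mul (hcD r) (mul_le_of_le_one_right hδ0.le (Real.abs_sin_le_one _))
        (by positivity) hD.le
    · exact hδ
  · rw [hev]
    have h1 (r : ℝ) : G (Ω.evolution (fun t x => c t * G x) s r x) = 0 := by
      rw [Ω.apply_evolution_mul hH hGd, hN x hx]
    have h2 := Ω.evolution_eq_of_integralCurve hK
      (γ := fun r => Ω.evolution (fun t x => c t * G x) s r x) (fun r => by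
        have h3 := Ω.hasMFDerivAt_evolution hH s r x
        rw [Ω.hamiltonianVectorField_const_mul (c r) (hGd _)] at h3
        have h4 : HasDerivAt (fun u => c r * κ u) (c r)
            (G (Ω.evolution (fun t x => c t * G x) s r x)) := by
          rw [h1]; exact (hκ'.const_mul (c r)).congr_deriv (mul_one _)
        rw [Ω.hamiltonianVectorField_comp_real h4 (hGd _)]
        exact h3) s t
    simp only [Ω.evolution_self hH] at h2
    exact h2

/-- At a point where the submanifold `N = f(X)` is not coisotropic, `N` can be moved off the
point at no cost, along the Hamiltonian flow of a function that vanishes on `N` and whose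
Hamiltonian vector at the point lies in `T N^Ω` but not in `T N`. -/
theorem exists_hoferClose_notMem (Ω : SymplecticForm E M)
    {F : Type*} [NormedAddCommGroup F] [NormedSpace ℝ F]
    {X : Type*} [TopologicalSpace X] [ChartedSpace F X] [IsManifold 𝓘(ℝ, F) ∞ X]
    {f : X → M} (hf : Manifold.IsSmoothEmbedding 𝓘(ℝ, F) 𝓘(ℝ, E) ∞ f)
    (hclosed : IsClosed (range f)) (p : X)
    (hp : ¬ Ω.orthogonal (f p) (imageTangentSpace E F f p) ≤ imageTangentSpace E F f p) :
    ∃ A : Set M, IsClosed A ∧ Ω.HoferClose (range f) A ∧ f p ∉ A := by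
  obtain ⟨v, hv, hvN⟩ := SetLike.not_le_iff_exists.1 hp
  obtain ⟨G, hG, hGc, hGN, hGv⟩ := exists_function_vanishing_on_range hf p
    ((Ω.bilin (f p)).flip v) (fun w hw => by
      rw [LinearMap.flip_apply, bilin_swap, hv w hw, neg_zero])
  have hXv : Ω.hamiltonianVectorField G (f p) = v :=
    Ω.hamiltonianVectorField_eq fun w => (hGv w).symm
  have hGd : MDifferentiable 𝓘(ℝ, E) 𝓘(ℝ, ℝ) G := hG.mdifferentiable (by simp)
  have hH := IsFlatHamiltonian.of_mul (E := E) contDiff_deriv_timeStep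
    (fun t ht => deriv_timeStep_eq_zero ht) hG hGc
  obtain ⟨t₀, ht₀⟩ := exists_deriv_timeStep_ne_zero
  set Φ := Ω.evolution (fun t x => deriv timeStep t * G x) with hΦ
  -- the orbit of `f p` leaves the submanifold, because its velocity at time `t₀` is not tangent
  obtain ⟨t₁, ht₁⟩ : ∃ t₁, Φ t₀ t₁ (f p) ∉ range f := by
    by_contra! hcon
    have h1 := Ω.hasMFDerivAt_evolution hH t₀ t₀ (f p)
    have h2 := velocity_mem_imageTangentSpace hf p (Ω.evolution_self hH t₀ (f p)) hcon h1
    have h3 (x : M) (hx : x = f p) : (Ω.hamiltonianVectorField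
        (fun x => deriv timeStep t₀ * G x) x : E) = (deriv timeStep t₀ • v : E) := by
      subst hx
      rw [Ω.hamiltonianVectorField_const_mul _ (hGd _), hXv]
    rw [h3 _ (Ω.evolution_self hH t₀ (f p))] at h2
    exact hvN ((Submodule.smul_mem_iff _ ht₀).1 h2)
  refine ⟨Φ t₁ t₀ '' range f, ?_, ?_, ?_⟩
  · exact (Ω.evolutionDiffeo hH t₁ t₀).toHomeomorph.isClosedMap _ hclosed
  · exact Ω.hoferClose_evolution_image contDiff_deriv_timeStep
      (fun t ht => deriv_timeStep_eq_zero ht) hG hGc (by rintro _ ⟨q, rfl⟩; exact hGN q) t₁ t₀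
  · rintro ⟨y, hy, hyp⟩
    refine ht₁ ?_
    rw [← hyp, hΦ, Ω.evolution_evolution hH, Ω.evolution_self hH]
    exact hy

end SymplecticForm

end Displacement

/-! ### Fragmentation -/

section Fragmentation

open Set Filter Topology

variable {E : Type*} [NormedAddCommGroup E] [NormedSpace ℝ E] [FiniteDimensional ℝ E]
  {M : Type*} [TopologicalSpace M] [ChartedSpace E M] [IsManifold 𝓘(ℝ, E) ∞ M] [T2Space M]

namespace SymplecticForm

/-- If two Hamiltonians agree off a compact set `C` that is disjoint from the closed set `A`,
their evolutions agree on `A` for short times. -/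
theorem eventually_evolution_eq (Ω : SymplecticForm E M) {G G' : ℝ → M → ℝ}
    (hG : IsFlatHamiltonian E G) (hG' : IsFlatHamiltonian E G') {A C : Set M} (hA : IsClosed A)
    (hC : IsCompact C) (hAC : Disjoint C A) (hGG' : ∀ t, ∀ x ∉ C, G' t x = G t x) (s : ℝ) :
    ∀ᶠ t in 𝓝 s, ∀ x ∈ A, Ω.evolution G' s t x = Ω.evolution G s t x := by
  have h1 : ∀ᶠ r in 𝓝 s, ∀ y ∈ C, Ω.evolution G r s y ∈ Aᶜ := by
    refine hC.eventually_forall_of_forall_eventually fun y hy => ?_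
    have hc : Continuous (fun p : ℝ × M => Ω.evolution G p.1 s p.2) :=
      (Ω.evolution_spec hG).1.continuous.comp
        (continuous_fst.prodMk (continuous_const.prodMk continuous_snd))
    refine hc.continuousAt.preimage_mem_nhds (hA.isOpen_compl.mem_nhds ?_)
    simp only [Ω.evolution_self hG]
    exact disjoint_left.1 hAC hy
  obtain ⟨ε, hε, hball⟩ := Metric.eventually_nhds_iff_ball.1 h1
  filter_upwards [Metric.ball_mem_nhds s hε] with t ht x hx
  have hout (r : ℝ) (hr : r ∈ Metric.ball s ε) : Ω.evolution G s r x ∉ C := fun hrC => by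
    refine hball r hr _ hrC ?_
    rw [Ω.evolution_evolution hG, Ω.evolution_self hG]
    exact hx
  rw [Real.ball_eq_Ioo] at ht hout
  have h2 := Ω.evolution_eq_of_integralCurveOn hG' (γ := fun r => Ω.evolution G s r x)
    (a := s - ε) (b := s + ε) (by linarith)
    (fun r _ => (Ω.hasMFDerivAt_evolution hG s r x).continuousAt.continuousWithinAt)
    (fun r hr => by
      have h3 : G' r =ᶠ[𝓝 (Ω.evolution G s r x)] G r := by
        filter_upwards [hC.isClosed.isOpen_compl.mem_nhds (hout r hr)] with y hy
        exact hGG' r y hy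
      rw [Ω.hamiltonianVectorField_congr h3]
      exact Ω.hasMFDerivAt_evolution hG s r x)
    (s := s) (t := t) ⟨by linarith, by linarith⟩ (Ioo_subset_Icc_self ht)
  simpa only [Ω.evolution_self hG] using h2

theorem HoferClose.evolution_image {Ω : SymplecticForm E M} {A B : Set M}
    (h : Ω.HoferClose A B) {H : ℝ → M → ℝ} (hH : IsFlatHamiltonian E H) (s t : ℝ) :
    Ω.HoferClose (Ω.evolution H s t '' A) (Ω.evolution H s t '' B) :=
  h.image (Ω.evolutionDiffeo hH s t) (Ω.isSymplectic_evolution hH s t)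

/-- For short times, a Hamiltonian evolution moves `N` at no cost, if `N` can be moved off each
point at no cost. Cutting the Hamiltonian by a partition of unity, the evolution is changed in
steps; in each step the change takes place off a set `A` to which `N` can be moved at no cost. -/
theorem eventually_hoferClose_evolution_image [SecondCountableTopology M] (Ω : SymplecticForm E M)
    {N : Set M} (hN : ∀ x, ∃ A, IsClosed A ∧ Ω.HoferClose N A ∧ x ∉ A) {H : ℝ → M → ℝ}
    (hH : IsFlatHamiltonian E H) (s : ℝ) :
    ∀ᶠ t in 𝓝 s, Ω.HoferClose N (Ω.evolution H s t '' N) := by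
  classical
  have : LocallyCompactSpace M := Manifold.locallyCompact_of_finiteDimensional 𝓘(ℝ, E)
  obtain ⟨K, hK, hHK⟩ := hH.support
  choose A hAc hNA hxA using hN
  obtain ⟨T, hT⟩ := hK.elim_finite_subcover (fun x => (A x)ᶜ) (fun x => (hAc x).isOpen_compl)
    (fun x _ => mem_iUnion.2 ⟨x, hxA x⟩)
  obtain ⟨χ, hχ⟩ := SmoothPartitionOfUnity.exists_isSubordinate 𝓘(ℝ, E) hK.isClosed
    (fun i : T => (A i)ᶜ) (fun i => (hAc i).isOpen_compl) (by
      intro x hx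
      obtain ⟨y, hy, hxy⟩ := mem_iUnion₂.1 (hT hx)
      exact mem_iUnion.2 ⟨⟨y, hy⟩, hxy⟩)
  have hflat (S : Finset T) : IsFlatHamiltonian E (fun t x => (∑ i ∈ S, χ i x) * H t x) :=
    IsFlatHamiltonian.mul_left (contMDiff_finsetSum fun i _ => (χ i).contMDiff) hH
  have hS (S : Finset T) : ∀ᶠ t in 𝓝 s,
      Ω.HoferClose N (Ω.evolution (fun t x => (∑ i ∈ S, χ i x) * H t x) s t '' N) := by
    induction S using Finset.induction_on with
    | empty =>
      refine Eventually.of_forall fun t => ?_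
      simp only [Finset.sum_empty, zero_mul]
      rw [funext (Ω.evolution_zero s t), image_id']
      exact HoferClose.refl Ω N
    | insert i S hi ih =>
      filter_upwards [ih, Ω.eventually_evolution_eq (hflat S) (hflat (insert i S)) (hAc i)
        (hK.inter_left (isClosed_tsupport (χ i)))
        (disjoint_left.2 fun x hx => hχ i hx.1) (fun t x hx => by
          rw [Finset.sum_insert hi, add_mul, add_eq_right]
          by_cases hxK : x ∈ K
          · rw [image_eq_zero_of_notMem_tsupport (fun h => hx ⟨h, hxK⟩), zero_mul]
          · rw [hHK t x (Or.inr hxK), mul_zero]) s] with t h1 h2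
      have h3 := (hNA i).evolution_image (hflat S) s t
      have h4 := (hNA i).evolution_image (hflat (insert i S)) s t
      rw [image_congr h2] at h4
      exact h1.trans (h3.trans h4.symm)
  have hsum : (fun t x => (∑ i ∈ Finset.univ, χ i x) * H t x) = H := by
    funext t x
    by_cases hx : x ∈ K
    · have h1 := χ.sum_eq_one hx
      rw [finsum_eq_sum_of_fintype] at h1
      rw [h1, one_mul]
    · rw [hHK t x (Or.inr hx), mul_zero]
  have h := hS Finset.univ
  rwa [hsum] at h

/-- If `N` can be moved off each point at no cost, every Hamiltonian evolution moves `N` at no cost: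
by the short-time case, the set of times for which this holds is open and closed. -/
theorem hoferClose_evolution_zero_image [SecondCountableTopology M] (Ω : SymplecticForm E M)
    {N : Set M} (hN : ∀ x, ∃ A, IsClosed A ∧ Ω.HoferClose N A ∧ x ∉ A) {H : ℝ → M → ℝ}
    (hH : IsFlatHamiltonian E H) (t : ℝ) : Ω.HoferClose N (Ω.evolution H 0 t '' N) := by
  have himage (s t : ℝ) : Ω.evolution H s t '' (Ω.evolution H 0 s '' N)
      = Ω.evolution H 0 t '' N := by
    rw [image_image]
    exact image_congr fun x _ => Ω.evolution_evolution hH 0 s t x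
  have hloc : IsLocallyConstant (fun t => Ω.HoferClose N (Ω.evolution H 0 t '' N)) := by
    rw [IsLocallyConstant.iff_eventually_eq]
    intro s
    filter_upwards [Ω.eventually_hoferClose_evolution_image hN hH s] with t ht
    refine propext ⟨fun h => ?_, fun h => ?_⟩
    · have h1 := (ht.symm.trans h).evolution_image hH t s
      rw [himage] at h1
      have h2 : Ω.evolution H t s '' (Ω.evolution H s t '' N) = N :=
        (Ω.evolutionDiffeo hH s t).toEquiv.symm_image_image N
      rwa [h2] at h1
    · have h1 := h.evolution_image hH s t
      rw [himage] at h1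
      exact ht.trans h1
  have h0 : Ω.HoferClose N (Ω.evolution H 0 0 '' N) := by
    rw [funext (Ω.evolution_self hH 0), image_id']
    exact HoferClose.refl Ω N
  exact (hloc.apply_eq_of_preconnectedSpace t 0).mpr h0

end SymplecticForm

end Fragmentation

/-! ### Hofer energy and time-one maps -/

section Energy

open Set Filter Topology

variable {E : Type*} [NormedAddCommGroup E] [NormedSpace ℝ E]
  {M : Type*} [TopologicalSpace M] [ChartedSpace E M]

theorem abs_iSup_le {ι : Type*} {u : ι → ℝ} {ε : ℝ} (hε : 0 ≤ ε) (h : ∀ i, |u i| ≤ ε) :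
    |⨆ i, u i| ≤ ε := by
  rcases isEmpty_or_nonempty ι with hι | ⟨⟨i⟩⟩
  · rwa [Real.iSup_of_isEmpty, abs_zero]
  · have hb : BddAbove (range u) := ⟨ε, by rintro _ ⟨i, rfl⟩; exact (abs_le.1 (h i)).2⟩
    exact abs_le.2 ⟨(abs_le.1 (h i)).1.trans (le_ciSup hb i),
      Real.iSup_le (fun i => (abs_le.1 (h i)).2) hε⟩

theorem abs_iInf_le {ι : Type*} {u : ι → ℝ} {ε : ℝ} (hε : 0 ≤ ε) (h : ∀ i, |u i| ≤ ε) :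
    |⨅ i, u i| ≤ ε := by
  rcases isEmpty_or_nonempty ι with hι | ⟨⟨i⟩⟩
  · rwa [Real.iInf_of_isEmpty, abs_zero]
  · have : Nonempty ι := ⟨i⟩
    have hb : BddBelow (range u) := ⟨-ε, by rintro _ ⟨i, rfl⟩; exact (abs_le.1 (h i)).1⟩
    exact abs_le.2 ⟨le_ciInf fun i => (abs_le.1 (h i)).1,
      (ciInf_le hb i).trans (abs_le.1 (h i)).2⟩

theorem hamiltonianEnergy_le {M : Type*} {H : ℝ → M → ℝ} {ε : ℝ} (hε : 0 ≤ ε)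
    (h : ∀ t x, |H t x| ≤ ε) :
    hamiltonianEnergy H ≤ 2 * ε := by
  have h1 := intervalIntegral.norm_integral_le_of_norm_le_const (a := 0) (b := 1) (C := 2 * ε)
    (f := fun t => (⨆ x, H t x) - (⨅ x, H t x)) (fun t _ => by
      rw [Real.norm_eq_abs]
      refine (abs_sub _ _).trans ?_
      linarith [abs_iSup_le hε (h t), abs_iInf_le hε (h t)])
  rw [sub_zero, abs_one, mul_one] at h1
  exact (le_abs_self _).trans h1

theorem IsFlatHamiltonian.isCompactlySupportedHamiltonian {H : ℝ → M → ℝ}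
    (hH : IsFlatHamiltonian E H) : IsCompactlySupportedHamiltonian E H where
  smooth := hH.smooth.contMDiffOn
  compactSupport := by
    obtain ⟨K, hK, hHK⟩ := hH.support
    exact ⟨K, hK, fun t _ x hx => hHK t x (Or.inr hx)⟩

/-- Slowing down a Hamiltonian on `[0, 1] × M` near the end points makes it flat. -/
theorem IsCompactlySupportedHamiltonian.isFlatHamiltonian {H : ℝ → M → ℝ}
    (hH : IsCompactlySupportedHamiltonian E H) :
    IsFlatHamiltonian E (fun t x => deriv timeStep t * H (timeStep t) x) where
  smooth := by
    have h1 : ContMDiff (𝓘(ℝ, ℝ).prod 𝓘(ℝ, E)) 𝓘(ℝ, ℝ) ∞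
        (fun p : ℝ × M => H (timeStep p.1) p.2) := by
      rw [← contMDiffOn_univ]
      refine hH.smooth.comp (f := fun p : ℝ × M => (timeStep p.1, p.2)) ?_
        (fun p _ => ⟨timeStep_mem_Icc p.1, mem_univ _⟩)
      exact ((Real.smoothTransition.contDiff.contMDiff.comp contMDiff_fst).prodMk
        contMDiff_snd).contMDiffOn
    exact (contDiff_deriv_timeStep.contMDiff.comp contMDiff_fst).mul h1
  support := by
    obtain ⟨K, hK, hHK⟩ := hH.compactSupport
    refine ⟨K, hK, fun t x h => ?_⟩
    rcases h with h | h
    · rw [deriv_timeStep_eq_zero h, zero_mul]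
    · rw [hHK _ (timeStep_mem_Icc t) x h, mul_zero]

namespace SymplecticForm

variable [FiniteDimensional ℝ E] [IsManifold 𝓘(ℝ, E) ∞ M] [T2Space M]

theorem isTimeOneMap_evolution (Ω : SymplecticForm E M) {H : ℝ → M → ℝ}
    (hH : IsFlatHamiltonian E H) : IsTimeOneMap Ω H (Ω.evolution H 0 1) := fun x =>
  ⟨fun t => Ω.evolution H 0 t x, Ω.evolution_self hH 0 x, rfl, fun t _ =>
    (Ω.hasMFDerivAt_evolution hH 0 t x).hasMFDerivWithinAt⟩

/-- Every element of `Ham(M, Ω)` is the time-one map of a flat Hamiltonian. -/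
theorem exists_evolution_eq_of_mem_Ham (Ω : SymplecticForm E M) {φ : M → M} (hφ : φ ∈ Ham Ω) :
    ∃ H : ℝ → M → ℝ, IsFlatHamiltonian E H ∧ Ω.evolution H 0 1 = φ := by
  obtain ⟨H, hH, hHφ⟩ := hφ
  have hK := hH.isFlatHamiltonian
  refine ⟨_, hK, funext fun x => ?_⟩
  obtain ⟨γ, hγ0, hγ1, hγ⟩ := hHφ x
  have h := Ω.evolution_eq_of_integralCurve hK (γ := fun t => γ (timeStep t)) (fun t => by
    have ht := timeStep_mem_Icc t
    have hd : MDifferentiable 𝓘(ℝ, E) 𝓘(ℝ, ℝ) (H (timeStep t)) := by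
      refine ContMDiff.mdifferentiable (n := ∞) ?_ (by simp)
      rw [← contMDiffOn_univ]
      exact hH.smooth.comp (f := fun x : M => (timeStep t, x))
        (contMDiff_const.prodMk contMDiff_id).contMDiffOn (fun y _ => ⟨ht, mem_univ _⟩)
    rw [Ω.hamiltonianVectorField_const_mul _ (hd _)]
    have h1 : HasMFDerivWithinAt 𝓘(ℝ, ℝ) 𝓘(ℝ, ℝ) timeStep univ t
        ((1 : ℝ →L[ℝ] ℝ).smulRight (deriv timeStep t)) :=
      (hasDerivAt_timeStep t).hasFDerivAt.hasMFDerivAt.hasMFDerivWithinAt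
    have h2 := HasMFDerivWithinAt.comp t (hγ (timeStep t) ht) h1 (fun s _ => timeStep_mem_Icc s)
    rw [hasMFDerivWithinAt_univ] at h2
    refine h2.congr_mfderiv ?_
    exact ContinuousLinearMap.ext fun r =>
      @mul_smul ℝ (TangentSpace 𝓘(ℝ, E) (γ (timeStep t))) _ _ r (deriv timeStep t) _) 0 1
  rw [timeStep_zero, timeStep_one, hγ0, hγ1] at h
  exact h

theorem HoferClose.chekanovHofer_eq_zero {Ω : SymplecticForm E M} {A B : Set M}
    (h : Ω.HoferClose A B) : chekanovHofer Ω A B = 0 := by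
  refine le_antisymm (ENNReal.le_of_forall_pos_le_add fun ε hε _ => ?_) zero_le
  rw [zero_add]
  have hε' : (0 : ℝ) < ε := hε
  obtain ⟨H, hH, hHε, hAB⟩ := h (ε / 2) (by positivity)
  have hcs := hH.isCompactlySupportedHamiltonian
  have h1 := Ω.isTimeOneMap_evolution hH
  refine (iInf₂_le_of_le _ ⟨H, hcs, h1⟩ (iInf_le_of_le hAB
    (iInf₂_le_of_le H hcs (iInf_le_of_le h1 ?_))))
  refine (ENNReal.ofReal_le_ofReal (hamiltonianEnergy_le (by positivity) hHε)).trans ?_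
  rw [mul_div_cancel₀ _ two_ne_zero, ENNReal.ofReal_coe_nnreal]

/-- A subset that can be moved off each point at no cost is weightless. -/
theorem isWeightless_of_forall_exists_hoferClose [SecondCountableTopology M]
    (Ω : SymplecticForm E M) {N : Set M}
    (hN : ∀ x, ∃ A, IsClosed A ∧ Ω.HoferClose N A ∧ x ∉ A) : IsWeightless Ω N := by
  have h {N' : Set M} (hN' : N' ∈ hamOrbit Ω N) : Ω.HoferClose N N' := by
    obtain ⟨φ, hφ, rfl⟩ := hN'
    obtain ⟨H, hH, rfl⟩ := Ω.exists_evolution_eq_of_mem_Ham hφ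
    exact Ω.hoferClose_evolution_zero_image hN hH 1
  exact fun N₀ h₀ N₁ h₁ => ((h h₀).symm.trans (h h₁)).chekanovHofer_eq_zero

variable {F : Type*} [NormedAddCommGroup F] [NormedSpace ℝ F]
  {X : Type*} [TopologicalSpace X] [ChartedSpace F X] [IsManifold 𝓘(ℝ, F) ∞ X]

theorem isWeightless_range [SecondCountableTopology M] (Ω : SymplecticForm E M) {f : X → M}
    (hf : Manifold.IsSmoothEmbedding 𝓘(ℝ, F) 𝓘(ℝ, E) ∞ f) (hclosed : IsClosed (range f))
    (h : IsNowhereCoisotropic F Ω f) : IsWeightless Ω (range f) := by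
  refine Ω.isWeightless_of_forall_exists_hoferClose fun x => ?_
  by_cases hx : x ∈ range f
  · obtain ⟨p, rfl⟩ := hx
    exact Ω.exists_hoferClose_notMem hf hclosed p (h p)
  · exact ⟨range f, hclosed, HoferClose.refl Ω _, hx⟩

end SymplecticForm

end Energy

/-! ### Dimension counts -/

section Dimension

variable {E : Type*} [NormedAddCommGroup E] [NormedSpace ℝ E] [FiniteDimensional ℝ E]
  {M : Type*} [TopologicalSpace M] [ChartedSpace E M]

/-- The orthogonal complement has at least the complementary dimension. -/
theorem SymplecticForm.finrank_le_finrank_orthogonal_add (Ω : SymplecticForm E M) (x : M)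
    (W : Submodule ℝ (TangentSpace 𝓘(ℝ, E) x)) :
    Module.finrank ℝ E ≤ Module.finrank ℝ (Ω.orthogonal x W) + Module.finrank ℝ W := by
  have : FiniteDimensional ℝ (TangentSpace 𝓘(ℝ, E) x) := inferInstanceAs (FiniteDimensional ℝ E)
  set T : TangentSpace 𝓘(ℝ, E) x →ₗ[ℝ] Module.Dual ℝ W := W.subtype.dualMap ∘ₗ Ω.bilin x with hT
  have hker : LinearMap.ker T = Ω.orthogonal x W := by
    ext v
    rw [LinearMap.mem_ker]
    refine ⟨fun h w hw => LinearMap.congr_fun h ⟨w, hw⟩, fun h => ?_⟩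
    ext w
    exact h w w.2
  have h1 := T.finrank_range_add_finrank_ker
  have h2 : Module.finrank ℝ (LinearMap.range T) ≤ Module.finrank ℝ W :=
    (Submodule.finrank_le _).trans_eq Subspace.dual_finrank_eq
  have h3 : Module.finrank ℝ (TangentSpace 𝓘(ℝ, E) x) = Module.finrank ℝ E := rfl
  rw [hker] at h1
  omega

variable {F : Type*} [NormedAddCommGroup F] [NormedSpace ℝ F] [FiniteDimensional ℝ F]
  {X : Type*} [TopologicalSpace X] [ChartedSpace F X]

theorem finrank_imageTangentSpace_le {E : Type*} [NormedAddCommGroup E] [NormedSpace ℝ E]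
    {M : Type*} [TopologicalSpace M] [ChartedSpace E M]
    {F : Type*} [NormedAddCommGroup F] [NormedSpace ℝ F] [FiniteDimensional ℝ F]
    {X : Type*} [TopologicalSpace X] [ChartedSpace F X] (f : X → M) (p : X) :
    Module.finrank ℝ (imageTangentSpace E F f p) ≤ Module.finrank ℝ F := by
  have : FiniteDimensional ℝ (TangentSpace 𝓘(ℝ, F) p) := inferInstanceAs (FiniteDimensional ℝ F)
  exact LinearMap.finrank_range_le _

theorem isNowhereCoisotropic_of_two_mul_finrank_lt (Ω : SymplecticForm E M) (f : X → M)
    (h : 2 * Module.finrank ℝ F < Module.finrank ℝ E) : IsNowhereCoisotropic F Ω f := by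
  intro p hp
  have : FiniteDimensional ℝ (TangentSpace 𝓘(ℝ, E) (f p)) :=
    inferInstanceAs (FiniteDimensional ℝ E)
  have h1 := Ω.finrank_le_finrank_orthogonal_add (f p) (imageTangentSpace E F f p)
  have h2 := Submodule.finrank_mono hp
  have h3 := finrank_imageTangentSpace_le (E := E) (F := F) f p
  omega

theorem IsSymplecticSubmanifold.isNowhereCoisotropic {Ω : SymplecticForm E M} {f : X → M}
    (hs : IsSymplecticSubmanifold F Ω f) (h : Module.finrank ℝ F < Module.finrank ℝ E) :
    IsNowhereCoisotropic F Ω f := by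
  intro p hp
  have h1 := Ω.finrank_le_finrank_orthogonal_add (f p) (imageTangentSpace E F f p)
  have h2 : Ω.orthogonal (f p) (imageTangentSpace E F f p) = ⊥ :=
    (Submodule.eq_bot_iff _).2 fun v hv => hs p v (hp hv) hv
  have h3 := finrank_imageTangentSpace_le (E := E) (F := F) f p
  rw [h2, finrank_bot] at h1
  omega

end Dimension

/-! ### Weightlessness -/

theorem theorem1p5
    {E : Type*} [NormedAddCommGroup E] [NormedSpace ℝ E] [FiniteDimensional ℝ E]
    {M : Type*} [TopologicalSpace M] [T2Space M] [SecondCountableTopology M]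
    [ChartedSpace E M] [IsManifold 𝓘(ℝ, E) ∞ M]
    (Ω : SymplecticForm E M)
    {F : Type*} [NormedAddCommGroup F] [NormedSpace ℝ F] [FiniteDimensional ℝ F]
    {X : Type*} [TopologicalSpace X] [ChartedSpace F X] [IsManifold 𝓘(ℝ, F) ∞ X]
    (f : X → M) (hf : Manifold.IsSmoothEmbedding 𝓘(ℝ, F) 𝓘(ℝ, E) ∞ f) :
    (IsClosed (Set.range f) → IsNowhereCoisotropic F Ω f → IsWeightless Ω (Set.range f)) ∧
    (2 * Module.finrank ℝ F < Module.finrank ℝ E →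
      IsNowhereCoisotropic F Ω f ∧
        (IsClosed (Set.range f) → IsWeightless Ω (Set.range f))) ∧
    (IsSymplecticSubmanifold F Ω f → Module.finrank ℝ F < Module.finrank ℝ E →
      IsNowhereCoisotropic F Ω f ∧
        (IsClosed (Set.range f) → IsWeightless Ω (Set.range f))) := by
  refine ⟨fun hc h => Ω.isWeightless_range hf hc h, fun hd => ?_, fun hs hd => ?_⟩
  · have h := isNowhereCoisotropic_of_two_mul_finrank_lt Ω f hd
    exact ⟨h, fun hc => Ω.isWeightless_range hf hc h⟩
  · have h := hs.isNowhereCoisotropic hd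
    exact ⟨h, fun hc => Ω.isWeightless_range hf hc h⟩
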